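/- Let $X$ be a smooth $(n+1)$-dimensional manifold with boundary $\partial X=M$, let $g$ be a smooth metric of signature $(p,q)$ on $M$ (with $p+q=n$), and let $g_+$ be a smooth metric of signature $(p+1,q)$ on the interior of $X$ which is asymptotically hyperbolic with conformal infinity $(M,[g])$: for a defining function $u$ of $M$, the tensor $u^2g_+$ extends smoothly to $X$, is nondegenerate along $M$, restricts on $TM$ to a metric in the conformal class $[g]$, and $|du|^2_{u^2g_+}=1$ on $M$. Let $\omega\in C^\infty(M)$. A geodesic normal form of $g_+$ relative to a metric $\hat g\in[g]$ consists of an open neighborhood $U$ of $M=M\times\{0\}$ in $M\times[0,\infty)$, a diffeomorphism $\varphi$ from $U$ onto a neighborhood of $M$ in $X$ with $\varphi|_M=\mathrm{id}$, and a smooth $1$-parameter family $\hat h(r)$ of metrics of signature $(p,q)$ (where $\hat h(r)$ is defined at the points $x\in M$ with $(x,r)\in U$), such that $\hat h(0)=\hat g$ and $\varphi^*g_+=r^{-2}\left(dr^2+\hat h(r)\right)$ for $r>0$. For each $t\in\mathbb R$ let $(U_t,\varphi_t,h^t)$ be a geodesic normal form of $g_+$ relative to $e^{2t\omega}g$, and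 write $h=h^0$ and $\delta h=\partial_t h^t|_{t=0}$. Let $x\in M$ and $r\ge 0$ be such that $\{x\}\times[0,r]\subset U_t$ for all $t$ sufficiently close to $0$. Then $t\mapsto h^t(r)$ is differentiable at $t=0$ at the point $x$, and there $$(\delta h)_{ij}=\omega\,(2-r\partial_r)h_{ij}+2\nabla_{(i}X_{j)},$$ where $X^i$ is the $r$-dependent family of vector fields $$X^i(r)=\int_0^r s\,h^{ij}(s)\,ds\;\partial_j\omega .$$ Here $h^{ij}$ is the inverse of $h_{ij}$, $X_j(r)=h_{ij}(r)X^i(r)$, $\nabla$ is the Levi-Civita connection of $h(r)$ on $M$ with $r$ fixed, and $2\nabla_{(i}X_{j)}=\nabla_iX_j+\nabla_jX_i$. -/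

import Mathlib

open Set Filter Topology
open scoped Manifold ContDiff

noncomputable section

namespace AHMetric

section General

variable {E : Type*} [NormedAddCommGroup E] [NormedSpace ℝ E]
  {H : Type*} [TopologicalSpace H] (I : ModelWithCorners ℝ E H)
  {N : Type*} [TopologicalSpace N] [ChartedSpace H N]

variable (N) in
/-- Fields of bilinear forms on the tangent spaces of `N`, that is, covariant `2`-tensor fields
(no regularity and no symmetry is built in). -/
abbrev TwoTensor : Type _ :=
  ∀ x : N, TangentSpace I x →L[ℝ] TangentSpace I x →L[ℝ] ℝ

variable (N) in
/-- Fields of linear forms on the tangent spaces of `N` (no regularity is built in). -/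
abbrev OneForm : Type _ := ∀ x : N, TangentSpace I x →L[ℝ] ℝ

variable {I}

/-- The bilinear form `b` on the tangent space at `x` is a scalar product of signature `(p, q)`:
it is symmetric, nondegenerate, and has `p` positive and `q` negative directions. -/
structure HasSignature {x : N} (b : TangentSpace I x →L[ℝ] TangentSpace I x →L[ℝ] ℝ)
    (p q : ℕ) : Prop where
  symm : ∀ v w, b v w = b w v
  nondegenerate : ∀ v, (∀ w, b v w = 0) → v = 0
  sigPos_eq : sigPos
    (LinearMap.BilinMap.toQuadraticMap (ContinuousLinearMap.toLinearMap₁₂ b)) = p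
  sigNeg_eq : sigNeg
    (LinearMap.BilinMap.toQuadraticMap (ContinuousLinearMap.toLinearMap₁₂ b)) = q

variable [IsManifold I ∞ N]

/-- The `2`-tensor field `b` is smooth on the set `s`. -/
def SmoothOn (b : TwoTensor I N) (s : Set N) : Prop :=
  ContMDiffOn I (I.prod 𝓘(ℝ, E →L[ℝ] E →L[ℝ] ℝ)) ∞
    (fun x ↦ Bundle.TotalSpace.mk' (E →L[ℝ] E →L[ℝ] ℝ)
      (E := fun x : N ↦ TangentSpace I x →L[ℝ] TangentSpace I x →L[ℝ] ℝ) x (b x)) s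

/-- The `1`-parameter family `h` of `2`-tensor fields on `N` is smooth, jointly in the point and in
the parameter, on the subset `U` of `N × ℝ`. If `U` is relatively open in `N × [0, ∞)`, this is
smoothness up to the boundary `N × {0}`. -/
def SmoothFamilyOn (h : ℝ → TwoTensor I N) (U : Set (N × ℝ)) : Prop :=
  ContMDiffOn (I.prod 𝓘(ℝ, ℝ)) (I.prod 𝓘(ℝ, E →L[ℝ] E →L[ℝ] ℝ)) ∞
    (fun z ↦ Bundle.TotalSpace.mk' (E →L[ℝ] E →L[ℝ] ℝ)
      (E := fun x : N ↦ TangentSpace I x →L[ℝ] TangentSpace I x →L[ℝ] ℝ) z.1 (h z.2 z.1)) U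


variable (I)

/-- The component function `y ↦ b (u, v)` of the `2`-tensor field `b` in the preferred chart
`extChartAt I x₀` at `x₀`; here `u v : E` are regarded as constant vector fields in that chart. -/
def chartComponent (b : TwoTensor I N) (x₀ : N) (u v : E) : E → ℝ := fun y ↦
  b ((extChartAt I x₀).symm y)
    (mfderiv 𝓘(ℝ, E) I (extChartAt I x₀).symm y u)
    (mfderiv 𝓘(ℝ, E) I (extChartAt I x₀).symm y v)

/-- The component function `y ↦ α (v)` of the `1`-form `α` in the preferred chart at `x₀`. -/
def chartComponentOneForm (α : OneForm I N) (x₀ : N) (v : E) : E → ℝ := fun y ↦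
  α ((extChartAt I x₀).symm y) (mfderiv 𝓘(ℝ, E) I (extChartAt I x₀).symm y v)

/-- The Christoffel symbol of the first kind
`Γ_{k,ij} = (∂_i b_{jk} + ∂_j b_{ik} - ∂_k b_{ij}) / 2`
of `b` at `x₀`, in the preferred chart at `x₀`, contracted with the vectors
`u` (index `i`), `v` (index `j`) and `w` (index `k`). -/
def christoffel (b : TwoTensor I N) (x₀ : N) (u v w : E) : ℝ :=
  (1 / 2) *
    (fderiv ℝ (chartComponent I b x₀ v w) (extChartAt I x₀ x₀) u
      + fderiv ℝ (chartComponent I b x₀ u w) (extChartAt I x₀ x₀) v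
      - fderiv ℝ (chartComponent I b x₀ u v) (extChartAt I x₀ x₀) w)

variable {I}

/-- Raising the index: `α^k = b^{kl} α_l`, where `b^{kl}` is the inverse of the nondegenerate
form `b` (junk if `b` is degenerate). -/
def sharp {x : N} (b : TangentSpace I x →L[ℝ] TangentSpace I x →L[ℝ] ℝ)
    (α : TangentSpace I x →L[ℝ] ℝ) : TangentSpace I x :=
  ContinuousLinearMap.inverse b α

/-- The covariant derivative of the `1`-form `α` with respect to the Levi-Civita connection of the
pseudo-Riemannian metric `b`, on a manifold without boundary:
`(∇_v α)(w) = v^i w^j ∇_i α_j` with `∇_i α_j = ∂_i α_j - Γ^k_{ij} α_k`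
and `Γ^k_{ij} α_k = Γ_{l,ij} b^{lk} α_k`.
It is computed at `x` in the preferred chart at `x`; `TangentSpace I x` is by definition `E`, each
tangent vector at `x` being identified with its components in that chart. -/
def covDeriv (b : TwoTensor I N) (α : OneForm I N) (x : N) (v w : TangentSpace I x) : ℝ :=
  fderiv ℝ (chartComponentOneForm I α x w) (extChartAt I x x) v
    - christoffel I b x v w (sharp (b x) (α x))

/-- The symmetrization `∇_{(i} α_{j)} = (∇_i α_j + ∇_j α_i) / 2`, evaluated on `v` and `w`. -/
def symmCovDeriv (b : TwoTensor I N) (α : OneForm I N) (x : N) (v w : TangentSpace I x) : ℝ :=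
  (1 / 2) * (covDeriv b α x v w + covDeriv b α x w v)

/-- The vector field `X^i(r) = ∫_0^r s h^{ij}(s) ds ∂_j om` attached to a `1`-parameter family `h`
of metrics and to a function `om`. -/
def fieldX (h : ℝ → TwoTensor I N) (om : N → ℝ) (r : ℝ) (x : N) : TangentSpace I x :=
  (∫ s in (0 : ℝ)..r, (s • sharp (h s x) (mvfderiv I om x) : E) : E)

/-- Lowering the index with `h(r)`: `X_j(r) = h_{ij}(r) X^i(r)`. -/
def formX (h : ℝ → TwoTensor I N) (om : N → ℝ) (r : ℝ) : OneForm I N := fun x ↦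
  h r x (fieldX h om r x)

end General

section BoundaryInfinity

variable {n : ℕ}
  {M : Type*} [TopologicalSpace M] [ChartedSpace (EuclideanSpace ℝ (Fin n)) M]
  {X : Type*} [TopologicalSpace X] [ChartedSpace (EuclideanHalfSpace (n + 1)) X]

/-- `ι : M → X` identifies the manifold `M` with the boundary of the manifold with boundary `X`:
it is a smooth embedding whose image is the boundary. -/
structure IsBoundaryInclusion (ι : M → X) : Prop where
  isEmbedding : IsEmbedding ι
  contMDiff : ContMDiff (𝓡 n) (𝓡∂ (n + 1)) ∞ ι
  injective_mfderiv : ∀ x, Function.Injective (mfderiv (𝓡 n) (𝓡∂ (n + 1)) ι x)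
  range_eq : range ι = (𝓡∂ (n + 1)).boundary X

/-- `u` is a defining function for the boundary of `X`. -/
structure IsDefiningFunction (u : X → ℝ) : Prop where
  contMDiff : ContMDiff (𝓡∂ (n + 1)) 𝓘(ℝ, ℝ) ∞ u
  pos : ∀ y ∈ (𝓡∂ (n + 1)).interior X, 0 < u y
  eq_zero : ∀ y ∈ (𝓡∂ (n + 1)).boundary X, u y = 0
  mvfderiv_ne_zero : ∀ y ∈ (𝓡∂ (n + 1)).boundary X, mvfderiv (𝓡∂ (n + 1)) u y ≠ 0

variable [IsManifold (𝓡 n) ∞ M] [IsManifold (𝓡∂ (n + 1)) ∞ X]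

/-- `g` is a smooth metric of signature `(p, q)` on `M`. -/
structure IsMetric (g : TwoTensor (𝓡 n) M) (p q : ℕ) : Prop where
  smooth : SmoothOn g univ
  signature : ∀ x, HasSignature (g x) p q

/-- `gp` is an asymptotically hyperbolic metric of signature `(p + 1, q)` on the interior of `X`,
with conformal infinity `(M, [g])`, where `M` is identified with the boundary of `X` through `ι`.
Only the values of `gp` in the interior of `X` matter. -/
structure IsAsymptoticallyHyperbolic (ι : M → X) (gp : TwoTensor (𝓡∂ (n + 1)) X)
    (g : TwoTensor (𝓡 n) M) (p q : ℕ) : Prop where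
  smooth : SmoothOn gp ((𝓡∂ (n + 1)).interior X)
  signature : ∀ y ∈ (𝓡∂ (n + 1)).interior X, HasSignature (gp y) (p + 1) q
  /-- For a defining function `u`, the tensor `u² gp` extends to a tensor `gbar` which is smooth up
  to the boundary and nondegenerate there, which restricts to a metric conformal to `g` on the
  boundary, and for which `|du|² = 1` on the boundary. -/
  compactification : ∃ (u : X → ℝ) (gbar : TwoTensor (𝓡∂ (n + 1)) X),
    IsDefiningFunction (n := n) u ∧ SmoothOn gbar univ ∧
    (∀ y ∈ (𝓡∂ (n + 1)).interior X, gbar y = (u y) ^ 2 • gp y) ∧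
    (∀ y ∈ (𝓡∂ (n + 1)).boundary X, ∀ v, (∀ w, gbar y v w = 0) → v = 0) ∧
    (∃ f : M → ℝ, ContMDiff (𝓡 n) 𝓘(ℝ, ℝ) ∞ f ∧ (∀ x, 0 < f x) ∧
      ∀ x v w, gbar (ι x) (mfderiv (𝓡 n) (𝓡∂ (n + 1)) ι x v)
        (mfderiv (𝓡 n) (𝓡∂ (n + 1)) ι x w) = f x * g x v w) ∧
    (∀ y ∈ (𝓡∂ (n + 1)).boundary X,
      mvfderiv (𝓡∂ (n + 1)) u y (sharp (gbar y) (mvfderiv (𝓡∂ (n + 1)) u y)) = 1)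

/-- The geodesic normal form of `gp` relative to the metric `g` on the boundary: `U` is an open
neighborhood of `M = M × {0}` in `M × [0, ∞)`, `φ` is a diffeomorphism from `U` to a neighborhood of
the boundary in `X` which is the identity on `M`, `h` is a smooth `1`-parameter family of metrics of
signature `(p, q)` with `h(0) = g`, and `φ^* gp = r⁻² (dr² + h(r))` where `r > 0`. -/
structure IsNormalForm (ι : M → X) (gp : TwoTensor (𝓡∂ (n + 1)) X) (p q : ℕ)
    (g : TwoTensor (𝓡 n) M) (U : Set (M × ℝ)) (φ : M × ℝ → X) (h : ℝ → TwoTensor (𝓡 n) M) :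
    Prop where
  isOpen : ∃ W : Set (M × ℝ), IsOpen W ∧ U = W ∩ {z | 0 ≤ z.2}
  mem : ∀ x, (x, (0 : ℝ)) ∈ U
  injOn : InjOn φ U
  isOpen_image : IsOpen (φ '' U)
  contMDiffOn : ContMDiffOn ((𝓡 n).prod 𝓘(ℝ, ℝ)) (𝓡∂ (n + 1)) ∞ φ U
  contMDiffOn_inverse : ∃ ψ : X → M × ℝ, LeftInvOn ψ φ U ∧
    ContMDiffOn (𝓡∂ (n + 1)) ((𝓡 n).prod 𝓘(ℝ, ℝ)) ∞ ψ (φ '' U)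
  apply_zero : ∀ x, φ (x, 0) = ι x
  smooth : SmoothFamilyOn h U
  signature : ∀ z ∈ U, HasSignature (h z.2 z.1) p q
  initial : h 0 = g
  /-- The pullback, evaluated on the tangent vectors `(v, a)` and `(w, b)` of `M × ℝ` at `(x, r)`. -/
  pullback : ∀ (x : M) (r : ℝ), 0 < r → (x, r) ∈ U →
    ∀ (v w : TangentSpace (𝓡 n) x) (a b : ℝ),
      gp (φ (x, r))
        (mfderiv ((𝓡 n).prod 𝓘(ℝ, ℝ)) (𝓡∂ (n + 1)) φ (x, r)
          ((v, a) : EuclideanSpace ℝ (Fin n) × ℝ))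
        (mfderiv ((𝓡 n).prod 𝓘(ℝ, ℝ)) (𝓡∂ (n + 1)) φ (x, r)
          ((w, b) : EuclideanSpace ℝ (Fin n) × ℝ))
        = (r ^ 2)⁻¹ * (a * b + h r x v w)

end BoundaryInfinity

end AHMetric

end

noncomputable section

set_option maxSynthPendingDepth 3
set_option linter.unusedSectionVars false

/-! Write `f = tω`, and compare the normal form at `t` with the one at `0` through the transition
map `Ψ_t = φ_0⁻¹ ∘ φ_t`, read in a chart cylinder `E × [0, ∞)`. It pulls `r⁻²(dr² + k)` back to
`r⁻²(dr² + k_t)` and is the identity on the boundary. Nothing is assumed about how `φ_t` depends on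
`t`, so differentiability in `t` must be proved, and the domain of `Ψ_t` has to be controlled along
the whole segment over `x`.

The curves `s ↦ Ψ_t(x, s) = (y, ρ)` are reparametrized geodesics. In the variables `W = log(ρ/s)`,
`y` and `η = (s/ρ²) k(∂_s y, ·)` the geodesic equation is regular down to `s = 0`, and its
right-hand side has the form `B η`, so every state with `η = 0` is stationary
(`IsTransition.fderiv_transitionState`). Comparing boundary expansions in the pullback identity
gives the initial values `W = -f`, `y = x`, `η = df`; the derivatives along `E` start at `-df`,
`id`, `D²f` (`IsTransition.tendsto_normalSpeed_and_transitionJet`).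

The metric `k_t` involves first derivatives of `Ψ_t`, so the equation is prolonged to the derivative
of the state along `E`. At `t = 0` the solution is the stationary one. The equation linearized there
is explicit: `δW = -ω` and `δη = dω` are constant, while `δy = ∫ s k⁻¹ dω ds` is the field `X` of
the theorem; its derivative along `E` is the remaining entry (`IsMetricFamily.linearPart_base`).
Grönwall estimates show that the actual jets are `t`-differentiable with this derivative
(`hasDerivAt_transitionJet_parameter`). A continuation argument, resting on the Hausdorff property
of the ambient manifold, keeps the curve in the domain of `Ψ_t`
(`IsTransition.mem_and_norm_jetCurve_sub_le`).

Finally `k_t(v, w) = r² dW(v) dW(w) + e^{-2W} k(y, re^W)(dy v, dy w)`. The first term is quadratic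
in `t`; differentiating the second at `t = 0` gives `ω(2 - r∂_r)k + L_X k`, and `L_X k` is twice the
symmetrized covariant derivative of the lowered field (`two_mul_symmCovDeriv_formX`). -/

namespace AHMetric

/-! ### Linearization of a time-dependent vector field, uniformly in time -/

section Linearization

variable {V V' : Type*} [NormedAddCommGroup V] [NormedSpace ℝ V]
  [NormedAddCommGroup V'] [NormedSpace ℝ V']

/-- The linear part in `v` at `v₀` of a function of `(σ, v)`. -/
def linearPart (F : ℝ × V → V') (v₀ : V) (σ : ℝ) : V →L[ℝ] V' :=
  (fderiv ℝ F (σ, v₀)).comp (ContinuousLinearMap.inr ℝ ℝ V)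

lemma continuousOn_linearPart {F : ℝ × V → V'} {O : Set (ℝ × V)} (hO : IsOpen O)
    (hF : ContDiffOn ℝ 1 F O) {v₀ : V} {R : ℝ} (hK : ∀ σ ∈ Icc 0 R, (σ, v₀) ∈ O) :
    ContinuousOn (linearPart F v₀) (Icc 0 R) := by
  have h1 : ContinuousOn (fderiv ℝ F) O := hF.continuousOn_fderiv_of_isOpen hO le_rfl
  have h2 : ContinuousOn (fun σ : ℝ ↦ fderiv ℝ F (σ, v₀)) (Icc 0 R) :=
    h1.comp (by fun_prop) hK
  exact h2.clm_comp continuousOn_const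

/-- Compactness of the time interval makes the derivative in `v` uniformly close to its value at
`v₀`. The mean value inequality then bounds the linearization error with one `δ` for all times. -/
lemma eventually_norm_sub_linearPart_le {F : ℝ × V → V'} {O : Set (ℝ × V)} (hO : IsOpen O)
    (hF : ContDiffOn ℝ 1 F O) {v₀ : V} {R : ℝ} (hK : ∀ σ ∈ Icc 0 R, (σ, v₀) ∈ O)
    (h0 : ∀ σ ∈ Icc 0 R, F (σ, v₀) = 0) {ε : ℝ} (hε : 0 < ε) :
    ∃ δ > 0, ∀ σ ∈ Icc 0 R, ∀ v, ‖v - v₀‖ ≤ δ →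
      (σ, v) ∈ O ∧ ‖F (σ, v) - linearPart F v₀ σ (v - v₀)‖ ≤ ε * ‖v - v₀‖ := by
  have h1 : ContinuousOn (fderiv ℝ F) O := hF.continuousOn_fderiv_of_isOpen hO le_rfl
  have key : ∀ᶠ v in 𝓝 v₀, ∀ σ ∈ Icc 0 R, (σ, v) ∈ O ∧
      ‖fderiv ℝ F (σ, v) - fderiv ℝ F (σ, v₀)‖ < ε := by
    refine isCompact_Icc.eventually_forall_of_forall_eventually fun σ hσ ↦ ?_
    have c1 : Tendsto (fun z : V × ℝ ↦ (z.2, z.1)) (𝓝 (v₀, σ)) (𝓝 (σ, v₀)) :=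
      (by fun_prop : Continuous fun z : V × ℝ ↦ (z.2, z.1)).tendsto' _ _ rfl
    have c2 : Tendsto (fun z : V × ℝ ↦ (z.2, v₀)) (𝓝 (v₀, σ)) (𝓝 (σ, v₀)) :=
      (by fun_prop : Continuous fun z : V × ℝ ↦ (z.2, v₀)).tendsto' _ _ rfl
    have hc := (h1.continuousAt (hO.mem_nhds (hK σ hσ))).tendsto
    have hd := ((hc.comp c1).sub (hc.comp c2)).norm
    rw [sub_self, norm_zero] at hd
    exact (c1.eventually (hO.mem_nhds (hK σ hσ))).and (hd.eventually_lt_const hε)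
  obtain ⟨δ, hδ, hball⟩ := Metric.eventually_nhds_iff_ball.1 key
  refine ⟨δ / 2, by positivity, fun σ hσ v hv ↦ ?_⟩
  have hv' : v ∈ Metric.ball v₀ δ := by
    rw [mem_ball_iff_norm]; linarith
  refine ⟨(hball v hv' σ hσ).1, ?_⟩
  have hder : ∀ u ∈ Metric.ball v₀ δ, HasFDerivWithinAt (fun u ↦ F (σ, u))
      ((fderiv ℝ F (σ, u)).comp (ContinuousLinearMap.inr ℝ ℝ V)) (Metric.ball v₀ δ) u := by
    intro u hu
    have hd : HasFDerivAt F (fderiv ℝ F (σ, u)) (σ, u) :=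
      ((hF.contDiffAt (hO.mem_nhds (hball u hu σ hσ).1)).differentiableAt
        one_ne_zero).hasFDerivAt
    exact (hd.comp u (hasFDerivAt_prodMk_right σ u)).hasFDerivWithinAt
  have hbd : ∀ u ∈ Metric.ball v₀ δ,
      ‖(fderiv ℝ F (σ, u)).comp (ContinuousLinearMap.inr ℝ ℝ V) - linearPart F v₀ σ‖ ≤ ε := by
    intro u hu
    rw [linearPart, ← ContinuousLinearMap.sub_comp]
    calc _ ≤ ‖fderiv ℝ F (σ, u) - fderiv ℝ F (σ, v₀)‖ * ‖ContinuousLinearMap.inr ℝ ℝ V‖ :=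
          ContinuousLinearMap.opNorm_comp_le _ _
      _ ≤ ε * 1 := mul_le_mul (hball u hu σ hσ).2.le (ContinuousLinearMap.norm_inr_le_one ℝ ℝ V)
          (norm_nonneg _) hε.le
      _ = ε := mul_one _
  have := (convex_ball v₀ δ).norm_image_sub_le_of_norm_hasFDerivWithin_le' hder hbd
    (Metric.mem_ball_self hδ) hv'
  simpa [h0 σ hσ] using this

end Linearization

/-! ### Grönwall estimates around a stationary solution -/

section Gronwall

variable {V : Type*} [NormedAddCommGroup V] [NormedSpace ℝ V]

/-- Apply Grönwall on `[u, s]` and let `u → 0⁺`. The geodesic equation is available only for `s >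
0`; at the boundary only continuity is known. -/
lemma norm_le_gronwallBound_of_Ioo {Y Y' : ℝ → V} {r K ε : ℝ}
    (hc : ContinuousOn Y (Icc 0 r)) (hd : ∀ s ∈ Ioo 0 r, HasDerivAt Y (Y' s) s)
    (hb : ∀ s ∈ Ioo 0 r, ‖Y' s‖ ≤ K * ‖Y s‖ + ε) {s : ℝ} (hs : s ∈ Icc 0 r) :
    ‖Y s‖ ≤ gronwallBound ‖Y 0‖ K ε s := by
  rcases hs.1.eq_or_lt with rfl | h0
  · simp [gronwallBound_x0]
  have key : ∀ᶠ u in 𝓝[>] (0 : ℝ), ‖Y s‖ ≤ gronwallBound ‖Y u‖ K ε (s - u) := by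
    filter_upwards [Ioo_mem_nhdsGT h0] with u hu
    refine norm_le_gronwallBound_of_norm_deriv_right_le (f := Y) (f' := Y') (b := s)
      (hc.mono (Icc_subset_Icc hu.1.le hs.2)) (fun τ hτ ↦ ?_) le_rfl (fun τ hτ ↦ ?_) s
      ⟨hu.2.le, le_rfl⟩
    · exact (hd τ ⟨hu.1.trans_le hτ.1, hτ.2.trans_le hs.2⟩).hasDerivWithinAt
    · exact hb τ ⟨hu.1.trans_le hτ.1, hτ.2.trans_le hs.2⟩
  have hY : Tendsto (fun u ↦ ‖Y u‖) (𝓝[>] 0) (𝓝 ‖Y 0‖) := by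
    have := (hc 0 ⟨le_rfl, h0.le.trans hs.2⟩).norm
    refine this.mono_left (le_trans ?_ (nhdsWithin_mono 0 (Icc_subset_Icc_right hs.2)))
    rw [← nhdsWithin_Ioc_eq_nhdsGT h0]
    exact nhdsWithin_mono 0 Ioc_subset_Icc_self
  have hsu : Tendsto (fun u : ℝ ↦ s - u) (𝓝[>] 0) (𝓝 s) :=
    ((by fun_prop : Continuous fun u : ℝ ↦ s - u).tendsto' 0 s (by simp)).mono_left
      nhdsWithin_le_nhds
  refine ge_of_tendsto ?_ key
  by_cases hK : K = 0
  · subst hK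
    simp only [gronwallBound_K0]
    exact hY.add (hsu.const_mul ε)
  · simp only [gronwallBound_of_K_ne_0 hK]
    exact (hY.mul (hsu.const_mul K).rexp).add (((hsu.const_mul K).rexp.sub_const 1).const_mul _)

/-- A solution of an ordinary differential equation that starts near a stationary solution `v₀`
stays near `v₀`. -/
lemma norm_sub_le_of_linearization {Z Z' : ℝ → V} {v₀ : V} {Λ : ℝ → V →L[ℝ] V} {r C ε : ℝ}
    (hc : ContinuousOn Z (Icc 0 r)) (hd : ∀ s ∈ Ioo 0 r, HasDerivAt Z (Z' s) s)
    (hΛ : ∀ s ∈ Ioo 0 r, ‖Λ s‖ ≤ C)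
    (hb : ∀ s ∈ Ioo 0 r, ‖Z' s - Λ s (Z s - v₀)‖ ≤ ε * ‖Z s - v₀‖) {s : ℝ} (hs : s ∈ Icc 0 r) :
    ‖Z s - v₀‖ ≤ ‖Z 0 - v₀‖ * Real.exp ((C + ε) * s) := by
  have := norm_le_gronwallBound_of_Ioo (Y := fun s ↦ Z s - v₀) (Y' := Z') (K := C + ε) (ε := 0)
    (hc.sub continuousOn_const) (fun s hs ↦ (hd s hs).sub_const v₀) (fun s hs ↦ ?_) hs
  · rwa [gronwallBound_ε0] at this
  · calc ‖Z' s‖ = ‖(Z' s - Λ s (Z s - v₀)) + Λ s (Z s - v₀)‖ := by simp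
      _ ≤ ‖Z' s - Λ s (Z s - v₀)‖ + ‖Λ s (Z s - v₀)‖ := norm_add_le _ _
      _ ≤ ε * ‖Z s - v₀‖ + C * ‖Z s - v₀‖ :=
        add_le_add (hb s hs) ((Λ s).le_of_opNorm_le (hΛ s hs) _)
      _ = (C + ε) * ‖Z s - v₀‖ + 0 := by ring

/-- The first variation of a stationary solution `v₀` of an ordinary differential equation is the
solution of the linearized equation. -/
lemma norm_sub_smul_le_of_linearization {Z Z' A : ℝ → V} {v₀ : V} {Λ : ℝ → V →L[ℝ] V}
    {r C ε t : ℝ} (hC : 0 ≤ C) (hε : 0 ≤ ε) (hε1 : ε ≤ 1)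
    (hc : ContinuousOn Z (Icc 0 r)) (hd : ∀ s ∈ Ioo 0 r, HasDerivAt Z (Z' s) s)
    (hΛ : ∀ s ∈ Ioo 0 r, ‖Λ s‖ ≤ C)
    (hb : ∀ s ∈ Ioo 0 r, ‖Z' s - Λ s (Z s - v₀)‖ ≤ ε * ‖Z s - v₀‖)
    (hA : ContinuousOn A (Icc 0 r)) (hA' : ∀ s ∈ Ioo 0 r, HasDerivAt A (Λ s (A s)) s)
    (h0 : Z 0 = v₀ + t • A 0) {s : ℝ} (hs : s ∈ Icc 0 r) :
    ‖Z s - v₀ - t • A s‖ ≤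
      ε * |t| * (‖A 0‖ * Real.exp ((C + 1) * r) * r * Real.exp (C * r)) := by
  have hr : 0 ≤ r := hs.1.trans hs.2
  set m := |t| * ‖A 0‖ * Real.exp ((C + 1) * r) with hm
  have hm0 : 0 ≤ m := by positivity
  have hbd : ∀ s ∈ Icc 0 r, ‖Z s - v₀‖ ≤ m := by
    intro s hs
    have h1 := norm_sub_le_of_linearization hc hd hΛ hb hs
    have h2 : ‖Z 0 - v₀‖ = |t| * ‖A 0‖ := by rw [h0, add_sub_cancel_left, norm_smul, Real.norm_eq_abs]
    rw [h2] at h1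
    refine h1.trans (mul_le_mul_of_nonneg_left (Real.exp_le_exp.2 ?_) (by positivity))
    exact mul_le_mul (by linarith) hs.2 hs.1 (by linarith)
  have hg := norm_le_gronwallBound_of_Ioo (Y := fun s ↦ Z s - v₀ - t • A s)
    (Y' := fun s ↦ Z' s - t • Λ s (A s)) (K := C) (ε := ε * m)
    ((hc.sub continuousOn_const).sub (hA.const_smul t))
    (fun s hs ↦ ((hd s hs).sub_const v₀).sub ((hA' s hs).const_smul t)) (fun s hs ↦ ?_) hs
  · refine hg.trans ?_
    simp only [h0, add_sub_cancel_left, sub_self, norm_zero]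
    have hmain : gronwallBound 0 C (ε * m) s ≤ ε * m * (r * Real.exp (C * r)) := by
      have hs' : gronwallBound 0 C (ε * m) s ≤ gronwallBound 0 C (ε * m) r :=
        gronwallBound_mono le_rfl (by positivity) hC hs.2
      refine hs'.trans ?_
      rcases hC.eq_or_lt with rfl | hC0
      · simp [gronwallBound_K0]
      · rw [gronwallBound_of_K_ne_0 hC0.ne']
        beta_reduce
        rw [zero_mul, zero_add, div_mul_eq_mul_div, mul_div_assoc]
        refine mul_le_mul_of_nonneg_left ?_ (by positivity)
        rw [div_le_iff₀ hC0]
        -- `1 - Cr ≤ e^{-Cr}`, multiplied by `e^{Cr}`, gives `e^{Cr} - 1 ≤ Cr e^{Cr}`.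
        have h3 := Real.add_one_le_exp (-(C * r))
        have h4 : Real.exp (C * r) * Real.exp (-(C * r)) = 1 := by
          rw [← Real.exp_add]; simp
        nlinarith [Real.exp_pos (C * r)]
    refine hmain.trans (le_of_eq ?_)
    rw [hm]; ring
  · have : Z' s - t • Λ s (A s) =
        (Z' s - Λ s (Z s - v₀)) + Λ s (Z s - v₀ - t • A s) := by
      simp only [map_sub, map_smul]; abel
    rw [this]
    calc _ ≤ ‖Z' s - Λ s (Z s - v₀)‖ + ‖Λ s (Z s - v₀ - t • A s)‖ := norm_add_le _ _
      _ ≤ ε * m + C * ‖Z s - v₀ - t • A s‖ :=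
        add_le_add ((hb s hs).trans (mul_le_mul_of_nonneg_left (hbd s (Ioo_subset_Icc_self hs)) hε))
          ((Λ s).le_of_opNorm_le (hΛ s hs) _)
      _ = _ := by ring

end Gronwall

/-! ### Families of nondegenerate forms on a half space -/

section LocalMetrics

variable {E : Type*} [NormedAddCommGroup E] [NormedSpace ℝ E]

/-- A smooth family of nondegenerate symmetric bilinear forms on `E`, defined on a relatively open
subset `S` of `E × [0, ∞)`. -/
structure IsMetricFamily (k : E × ℝ → E →L[ℝ] E →L[ℝ] ℝ) (S : Set (E × ℝ)) : Prop where
  exists_isOpen : ∃ W, IsOpen W ∧ S = W ∩ {z | 0 ≤ z.2}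
  contDiffOn : ContDiffOn ℝ ∞ k S
  symm : ∀ z ∈ S, ∀ v w, k z v w = k z w v
  nondegenerate : ∀ z ∈ S, ∀ v, (∀ w, k z v w = 0) → v = 0

lemma uniqueDiffOn_halfSpace {S : Set (E × ℝ)} (hS : ∃ W, IsOpen W ∧ S = W ∩ {z | 0 ≤ z.2}) :
    UniqueDiffOn ℝ S := by
  obtain ⟨W, hW, rfl⟩ := hS
  have h : {z : E × ℝ | 0 ≤ z.2} = univ ×ˢ Ici 0 := by ext; simp
  rw [inter_comm, h]
  exact (uniqueDiffOn_univ.prod (uniqueDiffOn_Ici 0)).inter hW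

lemma mem_nhds_of_halfSpace {S : Set (E × ℝ)} (hS : ∃ W, IsOpen W ∧ S = W ∩ {z | 0 ≤ z.2})
    {z : E × ℝ} (hz : z ∈ S) (h0 : 0 < z.2) : S ∈ 𝓝 z := by
  obtain ⟨W, hW, rfl⟩ := hS
  refine inter_mem (hW.mem_nhds hz.1) ?_
  filter_upwards [continuous_snd.continuousAt.eventually (lt_mem_nhds h0)] with u hu using
    le_of_lt hu

lemma isOpen_inter_pos_of_halfSpace {S : Set (E × ℝ)}
    (hS : ∃ W, IsOpen W ∧ S = W ∩ {z | 0 ≤ z.2}) : IsOpen (S ∩ {z | 0 < z.2}) := by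
  rw [isOpen_iff_mem_nhds]
  exact fun z hz ↦ inter_mem (mem_nhds_of_halfSpace hS hz.1 hz.2)
    ((isOpen_lt continuous_const continuous_snd).mem_nhds hz.2)

/-- The inverse of a family of bilinear forms. -/
def inverseFamily (k : E × ℝ → E →L[ℝ] E →L[ℝ] ℝ) (z : E × ℝ) : (E →L[ℝ] ℝ) →L[ℝ] E :=
  ContinuousLinearMap.inverse (k z)

lemma isInvertible_of_nondegenerate [FiniteDimensional ℝ E] {b : E →L[ℝ] E →L[ℝ] ℝ}
    (hb : ∀ v, (∀ w, b v w = 0) → v = 0) : b.IsInvertible := by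
  have hinj : Function.Injective b.toLinearMap := by
    rw [← LinearMap.ker_eq_bot, LinearMap.ker_eq_bot']
    intro v hv
    refine hb v fun w ↦ ?_
    have : b v = 0 := hv
    rw [this]; rfl
  have hdim : Module.finrank ℝ E = Module.finrank ℝ (E →L[ℝ] ℝ) := by
    rw [← (LinearMap.toContinuousLinearMap (𝕜 := ℝ) (E := E) (F' := ℝ)).finrank_eq]
    exact (Subspace.dual_finrank_eq).symm
  refine ⟨(LinearEquiv.ofInjectiveOfFinrankEq b.toLinearMap hinj hdim).toContinuousLinearEquiv, ?_⟩
  ext v w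
  rfl

variable [FiniteDimensional ℝ E] {k : E × ℝ → E →L[ℝ] E →L[ℝ] ℝ} {S : Set (E × ℝ)}

namespace IsMetricFamily

lemma isInvertible (hk : IsMetricFamily k S) {z : E × ℝ} (hz : z ∈ S) : (k z).IsInvertible :=
  isInvertible_of_nondegenerate (hk.nondegenerate z hz)

lemma apply_inverseFamily (hk : IsMetricFamily k S) {z : E × ℝ} (hz : z ∈ S) (α : E →L[ℝ] ℝ) :
    k z (inverseFamily k z α) = α :=
  (hk.isInvertible hz).self_apply_inverse α

lemma inverseFamily_apply (hk : IsMetricFamily k S) {z : E × ℝ} (hz : z ∈ S) (v : E) :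
    inverseFamily k z (k z v) = v :=
  (hk.isInvertible hz).inverse_apply_self v

lemma contDiffOn_inverseFamily (hk : IsMetricFamily k S) :
    ContDiffOn ℝ ∞ (inverseFamily k) S := by
  intro z hz
  obtain ⟨e, he⟩ := hk.isInvertible hz
  have h := contDiffAt_map_inverse (𝕜 := ℝ) (n := ∞) e
  rw [he] at h
  exact h.comp_contDiffWithinAt z (hk.contDiffOn z hz)

lemma uniqueDiffOn (hk : IsMetricFamily k S) : UniqueDiffOn ℝ S :=
  uniqueDiffOn_halfSpace hk.exists_isOpen

end IsMetricFamily

end LocalMetrics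

/-! ### The geodesic equation in desingularized variables -/

section GeodesicField

variable {E : Type*} [NormedAddCommGroup E] [NormedSpace ℝ E]

variable (E) in
/-- The states `(W, y, η)` of the geodesic equation. -/
abbrev GeodesicState : Type _ := ℝ × E × (E →L[ℝ] ℝ)

/-- The point `(y, s e^W)`, where `s = σ²`, attached to `σ` and to the state `(W, y, η)`. -/
def footPoint (p : ℝ × GeodesicState E) : E × ℝ := (p.2.2.1, p.1 ^ 2 * Real.exp p.2.1)

/-- The factor `s e^{2W}`, where `s = σ²`. -/
def footFactor (p : ℝ × GeodesicState E) : ℝ := p.1 ^ 2 * Real.exp (2 * p.2.1)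

variable (k : E × ℝ → E →L[ℝ] E →L[ℝ] ℝ) (S : Set (E × ℝ))

/-- The vector `η^♯`. -/
def stateSharp (p : ℝ × GeodesicState E) : E := inverseFamily k (footPoint p) p.2.2.2

/-- The square of the normal component of the velocity. -/
def normalSq (p : ℝ × GeodesicState E) : ℝ :=
  1 - p.1 ^ 2 * footFactor p * p.2.2.2 (stateSharp k p)

/-- The coefficients `B` of the geodesic equation, which has the form `∂_s (W, y, η) = B η`. -/
def geodesicCoeff (p : ℝ × GeodesicState E) : (E →L[ℝ] ℝ) →L[ℝ] GeodesicState E :=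
  ((-(footFactor p / (1 + √(normalSq k p)))) •
      ContinuousLinearMap.apply ℝ ℝ (stateSharp k p)).prod
    ((footFactor p • inverseFamily k (footPoint p)).prod
      ((footFactor p / 2) •
        (((((fderivWithin ℝ k S (footPoint p)).comp (ContinuousLinearMap.inl ℝ E ℝ)).flip
          (stateSharp k p)).flip).comp (inverseFamily k (footPoint p)))))

/-- The domain of the geodesic equation. -/
def geodesicDomain : Set (ℝ × GeodesicState E) := {p | footPoint p ∈ S ∧ 0 < normalSq k p}

variable {k S} [FiniteDimensional ℝ E]

lemma contDiff_footPoint : ContDiff ℝ ∞ (footPoint (E := E)) := by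
  unfold footPoint; fun_prop

lemma contDiff_footFactor : ContDiff ℝ ∞ (footFactor (E := E)) := by
  unfold footFactor; fun_prop

-- The reason for the substitution `s = σ²`: the normal coordinate `σ² e^W` is nonnegative for every
-- real `σ`, so the half-space constraint is automatic. The equation thus lives on an open set
-- although `k` is given only up to a boundary.
omit [FiniteDimensional ℝ E] in
lemma isOpen_footPoint_preimage (hS : ∃ W, IsOpen W ∧ S = W ∩ {z | 0 ≤ z.2}) :
    IsOpen (footPoint (E := E) ⁻¹' S) := by
  obtain ⟨W, hW, rfl⟩ := hS
  have : footPoint (E := E) ⁻¹' (W ∩ {z | 0 ≤ z.2}) = footPoint ⁻¹' W := by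
    ext p
    simp only [mem_preimage, mem_inter_iff, mem_ofPred_eq, and_iff_left_iff_imp]
    intro _
    unfold footPoint
    positivity
  rw [this]
  exact hW.preimage (by unfold footPoint; fun_prop)

namespace IsMetricFamily

lemma contDiffOn_inverseFamily_footPoint (hk : IsMetricFamily k S) :
    ContDiffOn ℝ ∞ (fun p ↦ inverseFamily k (footPoint p)) (footPoint ⁻¹' S) :=
  hk.contDiffOn_inverseFamily.comp contDiff_footPoint.contDiffOn (mapsTo_preimage _ _)

lemma contDiffOn_stateSharp (hk : IsMetricFamily k S) :
    ContDiffOn ℝ ∞ (stateSharp k) (footPoint ⁻¹' S) :=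
  hk.contDiffOn_inverseFamily_footPoint.clm_apply (by fun_prop)

lemma contDiffOn_normalSq (hk : IsMetricFamily k S) :
    ContDiffOn ℝ ∞ (normalSq k) (footPoint ⁻¹' S) := by
  unfold normalSq
  refine contDiffOn_const.sub ((ContDiffOn.mul (by fun_prop) contDiff_footFactor.contDiffOn).mul ?_)
  exact ContDiffOn.clm_apply (by fun_prop) hk.contDiffOn_stateSharp

lemma isOpen_geodesicDomain (hk : IsMetricFamily k S) : IsOpen (geodesicDomain k S) := by
  have h := hk.contDiffOn_normalSq.continuousOn.isOpen_inter_preimage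
    (isOpen_footPoint_preimage hk.exists_isOpen) (isOpen_Ioi (a := (0 : ℝ)))
  exact h

/-- No negative power of `s` survives in these variables, so smoothness persists through `σ = 0`;
the square root is smooth because its argument is positive on the domain. -/
lemma contDiffOn_geodesicCoeff (hk : IsMetricFamily k S) :
    ContDiffOn ℝ ∞ (geodesicCoeff k S) (geodesicDomain k S) := by
  have hsub : geodesicDomain k S ⊆ footPoint ⁻¹' S := fun p hp ↦ hp.1
  have hκ := hk.contDiffOn_inverseFamily_footPoint.mono hsub
  have hv := hk.contDiffOn_stateSharp.mono hsub
  have hN := hk.contDiffOn_normalSq.mono hsub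
  have hc : ContDiffOn ℝ ∞ (footFactor (E := E)) (geodesicDomain k S) :=
    contDiff_footFactor.contDiffOn
  have hD : ContDiffOn ℝ ∞ (fun p ↦ fderivWithin ℝ k S (footPoint p)) (geodesicDomain k S) :=
    ((hk.contDiffOn.fderivWithin hk.uniqueDiffOn (m := ∞) (by simp)).comp
      contDiff_footPoint.contDiffOn (mapsTo_preimage _ _)).mono hsub
  have h1 : ContDiffOn ℝ ∞ (fun p ↦ 1 + √(normalSq k p)) (geodesicDomain k S) :=
    contDiffOn_const.add (hN.sqrt fun p hp ↦ hp.2.ne')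
  refine contDiffOn_clm_apply.2 fun α ↦ ?_
  refine ContDiffOn.prodMk ?_ (ContDiffOn.prodMk ?_ ?_)
  · exact ((hc.div h1 fun p _ ↦ by positivity).neg).mul
      ((contDiffOn_const (c := α)).clm_apply hv)
  · exact hc.smul (hκ.clm_apply contDiffOn_const)
  · refine contDiffOn_clm_apply.2 fun u ↦ ?_
    exact (hc.div_const 2).smul (((hD.clm_apply contDiffOn_const).clm_apply hv).clm_apply
      (hκ.clm_apply contDiffOn_const))

end IsMetricFamily

end GeodesicField

/-! ### Prolonging an equation `∂_s z = B(s, z) P z` to derivatives in parameters -/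

section Prolongation

variable {E F V : Type*} [NormedAddCommGroup E] [NormedSpace ℝ E] [NormedAddCommGroup F]
  [NormedSpace ℝ F] [NormedAddCommGroup V] [NormedSpace ℝ V]

variable (E) in
/-- The ordinary differential equation satisfied by a solution of `∂_s z = G (s, z)` together with
its derivative with respect to parameters in `E`. -/
def prolongation (G : ℝ × V → V) (p : ℝ × (V × (E →L[ℝ] V))) : V × (E →L[ℝ] V) :=
  (G (p.1, p.2.1), (linearPart G p.2.1 p.1).comp p.2.2)

lemma contDiffOn_prolongation {G : ℝ × V → V} {O : Set (ℝ × V)} (hO : IsOpen O)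
    (hG : ContDiffOn ℝ ∞ G O) :
    ContDiffOn ℝ ∞ (prolongation E G) {p | (p.1, p.2.1) ∈ O} := by
  have hp : ContDiffOn ℝ ∞ (fun p : ℝ × (V × (E →L[ℝ] V)) ↦ (p.1, p.2.1))
      {p | (p.1, p.2.1) ∈ O} := by fun_prop
  refine (hG.comp hp fun _ h ↦ h).prodMk ?_
  unfold linearPart
  exact (((hG.fderiv_of_isOpen hO (m := ∞) (by simp)).comp hp fun _ h ↦ h).clm_comp
    contDiffOn_const).clm_comp (by fun_prop)

/-- The difference quotient is exactly `B τ u`, so continuity of `B` suffices and no derivative of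
`B` enters. -/
lemma hasDerivAt_clm_apply_smul {B : ℝ → F →L[ℝ] V} (hB : ContinuousAt B 0) (u : F) :
    HasDerivAt (fun τ ↦ B τ (τ • u)) (B 0 u) 0 := by
  rw [hasDerivAt_iff_tendsto_slope_zero]
  have h : Tendsto (fun τ ↦ B τ u) (𝓝[≠] 0) (𝓝 (B 0 u)) :=
    ((hB.clm_apply continuousAt_const).tendsto).mono_left nhdsWithin_le_nhds
  refine h.congr' ?_
  filter_upwards [self_mem_nhdsWithin] with τ hτ
  simp [inv_smul_smul₀ (show τ ≠ 0 from hτ)]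

lemma fderiv_clm_apply_snd {B : ℝ × V → F →L[ℝ] V} (P : V →L[ℝ] F) {p : ℝ × V}
    (hB : DifferentiableAt ℝ B p) (q : ℝ × V) :
    fderiv ℝ (fun p ↦ B p (P p.2)) p q = fderiv ℝ B p q (P p.2) + B p (P q.2) := by
  have h := (hB.hasFDerivAt.clm_apply
    ((P.hasFDerivAt (x := p.2)).comp p (hasFDerivAt_snd (𝕜 := ℝ)))).fderiv
  have h2 : (fun p : ℝ × V ↦ B p (P p.2)) = fun p ↦ B p ((⇑P ∘ Prod.snd) p) := rfl
  rw [h2, h]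
  simp [add_comm]

/-- Since `P` kills both the state and its parameter derivative at the base jet, every term carrying
an extra derivative of `B` is multiplied by zero. Only `B` and its first derivative remain, which
makes the linearized equation explicitly solvable. -/
lemma linearPart_prolongation {B : ℝ × V → F →L[ℝ] V} {O : Set (ℝ × V)} (hO : IsOpen O)
    (hB : ContDiffOn ℝ ∞ B O) (P : V →L[ℝ] F) {v₀ : V × (E →L[ℝ] V)} {σ : ℝ}
    (hσ : (σ, v₀.1) ∈ O) (h1 : P v₀.1 = 0) (h2 : ∀ e, P (v₀.2 e) = 0) (A : V × (E →L[ℝ] V)) :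
    linearPart (prolongation E fun p ↦ B p (P p.2)) v₀ σ A =
      (B (σ, v₀.1) (P A.1),
        (fderiv ℝ B (σ, v₀.1)).flip (P A.1) ∘L (ContinuousLinearMap.inr ℝ ℝ V) ∘L v₀.2
          + B (σ, v₀.1) ∘L P ∘L A.2) := by
  set G : ℝ × V → V := fun p ↦ B p (P p.2) with hGdef
  have hG : ContDiffOn ℝ ∞ G O := hB.clm_apply (by fun_prop)
  have hO' : IsOpen {p : ℝ × (V × (E →L[ℝ] V)) | (p.1, p.2.1) ∈ O} :=
    hO.preimage (by fun_prop)
  have hdiff : HasFDerivAt (prolongation E G) (fderiv ℝ (prolongation E G) (σ, v₀)) (σ, v₀) :=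
    (((contDiffOn_prolongation hO hG).contDiffAt (hO'.mem_nhds hσ)).differentiableAt
      (by simp)).hasFDerivAt
  have hline : HasDerivAt (fun τ : ℝ ↦ ((σ, v₀ + τ • A) : ℝ × (V × (E →L[ℝ] V)))) (0, A) 0 := by
    have : HasDerivAt (fun τ : ℝ ↦ v₀ + τ • A) A 0 := by
      simpa using ((hasDerivAt_id (0 : ℝ)).smul_const A).const_add v₀
    exact (hasDerivAt_const _ _).prodMk this
  have hcurve := hdiff.comp_hasDerivAt_of_eq (0 : ℝ) hline (by simp)
  have hbase : ContinuousAt (fun τ : ℝ ↦ ((σ, v₀.1 + τ • A.1) : ℝ × V)) 0 := by fun_prop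
  have hBc : ContinuousAt (fun τ : ℝ ↦ B (σ, v₀.1 + τ • A.1)) 0 := by
    refine ContinuousAt.comp' (g := B) ?_ hbase
    simpa using (hB.continuousOn.continuousAt (hO.mem_nhds hσ))
  have hDc : ContinuousAt (fun τ : ℝ ↦ fderiv ℝ B (σ, v₀.1 + τ • A.1)) 0 := by
    refine ContinuousAt.comp' (g := fderiv ℝ B) ?_ hbase
    simpa using ((hB.continuousOn_fderiv_of_isOpen hO (by simp)).continuousAt (hO.mem_nhds hσ))
  have hmem : ∀ᶠ τ : ℝ in 𝓝 0, (σ, v₀.1 + τ • A.1) ∈ O := by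
    refine hbase.eventually (p := fun p ↦ p ∈ O) ?_
    simpa using hO.mem_nhds hσ
  have e1 : HasDerivAt (fun τ : ℝ ↦ G (σ, v₀.1 + τ • A.1)) (B (σ, v₀.1) (P A.1)) 0 := by
    have := hasDerivAt_clm_apply_smul hBc (P A.1)
    simpa [hGdef, h1] using this
  have hlin : linearPart (prolongation E G) v₀ σ A =
      fderiv ℝ (prolongation E G) (σ, v₀) (0, A) := rfl
  rw [hlin]
  have hfst : HasDerivAt (fun τ : ℝ ↦ G (σ, v₀.1 + τ • A.1))
      (fderiv ℝ (prolongation E G) (σ, v₀) (0, A)).1 0 := hcurve.fst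
  refine Prod.ext (hfst.unique e1) ?_
  ext1 e
  have hsnd : HasDerivAt (fun τ : ℝ ↦ linearPart G (v₀.1 + τ • A.1) σ ((v₀.2 + τ • A.2) e))
      ((fderiv ℝ (prolongation E G) (σ, v₀) (0, A)).2 e) 0 := by
    have h3 : HasDerivAt (fun τ : ℝ ↦ (linearPart G (v₀.1 + τ • A.1) σ).comp (v₀.2 + τ • A.2))
      (fderiv ℝ (prolongation E G) (σ, v₀) (0, A)).2 0 := hcurve.snd
    simpa using h3.clm_apply (hasDerivAt_const (0 : ℝ) e)
  refine hsnd.unique ?_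
  have e2 : HasDerivAt (fun τ : ℝ ↦
      ((fderiv ℝ B (σ, v₀.1 + τ • A.1)) (0, (v₀.2 + τ • A.2) e)) (τ • P A.1)
        + B (σ, v₀.1 + τ • A.1) (τ • P (A.2 e)))
      (fderiv ℝ B (σ, v₀.1) (0, v₀.2 e) (P A.1) + B (σ, v₀.1) (P (A.2 e))) 0 := by
    have hDc' : ContinuousAt
        (fun τ : ℝ ↦ (fderiv ℝ B (σ, v₀.1 + τ • A.1)) (0, (v₀.2 + τ • A.2) e)) 0 :=
      hDc.clm_apply (by simp only [add_apply, smul_apply]; fun_prop)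
    have h4 := (hasDerivAt_clm_apply_smul hDc' (P A.1)).fun_add
      (hasDerivAt_clm_apply_smul hBc (P (A.2 e)))
    simpa using h4
  refine e2.congr_of_eventuallyEq ?_
  filter_upwards [hmem] with τ hτ
  have hBd : DifferentiableAt ℝ B (σ, v₀.1 + τ • A.1) :=
    (hB.contDiffAt (hO.mem_nhds hτ)).differentiableAt (by simp)
  have := fderiv_clm_apply_snd P hBd (0, (v₀.2 + τ • A.2) e)
  simp only [linearPart, ContinuousLinearMap.comp_apply, ContinuousLinearMap.inr_apply]
  rw [hGdef, this]
  simp [h1, h2]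

end Prolongation

/-! ### Transition maps: the geodesic equation deduced from the pullback identity -/

section Transition

variable {E : Type*} [NormedAddCommGroup E] [NormedSpace ℝ E]

/-- The right-hand side of the geodesic equation. -/
def geodesicField (k : E × ℝ → E →L[ℝ] E →L[ℝ] ℝ) (S : Set (E × ℝ)) (p : ℝ × GeodesicState E) :
    GeodesicState E :=
  geodesicCoeff k S p (((ContinuousLinearMap.snd ℝ E (E →L[ℝ] ℝ)).comp
    (ContinuousLinearMap.snd ℝ ℝ (E × (E →L[ℝ] ℝ)))) p.2)

/-- `Ψ` pulls back the metric `r⁻² (dr² + k)` to the metric `r⁻² (dr² + k')`, it is the identity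
where `r = 0`, and `k' = e^{2f} k` there. -/
structure IsTransition (k : E × ℝ → E →L[ℝ] E →L[ℝ] ℝ) (S : Set (E × ℝ))
    (k' : E × ℝ → E →L[ℝ] E →L[ℝ] ℝ) (D : Set (E × ℝ)) (Ψ : E × ℝ → E × ℝ) (f : E → ℝ) :
    Prop where
  exists_isOpen : ∃ W, IsOpen W ∧ D = W ∩ {z | 0 ≤ z.2}
  contDiffOn : ContDiffOn ℝ ∞ Ψ D
  mapsTo : MapsTo Ψ D S
  pos : ∀ z ∈ D, 0 < z.2 → 0 < (Ψ z).2
  apply_zero : ∀ y, (y, (0 : ℝ)) ∈ D → Ψ (y, 0) = (y, 0)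
  continuousOn : ContinuousOn k' D
  initial : ∀ y, (y, (0 : ℝ)) ∈ D → k' (y, 0) = Real.exp (2 * f y) • k (y, 0)
  nondegenerate : ∀ z ∈ D, ∀ v, (∀ w, k' z v w = 0) → v = 0
  pullback : ∀ z ∈ D, 0 < z.2 → ∀ e e' : E × ℝ,
    z.2 ^ 2 * ((fderiv ℝ Ψ z e).2 * (fderiv ℝ Ψ z e').2
        + k (Ψ z) (fderiv ℝ Ψ z e).1 (fderiv ℝ Ψ z e').1)
      = (Ψ z).2 ^ 2 * (e.2 * e'.2 + k' z e.1 e'.1)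

/-- The tangential component of the momentum of the curves `s ↦ Ψ (x, s)`. -/
def momentum (k : E × ℝ → E →L[ℝ] E →L[ℝ] ℝ) (Ψ : E × ℝ → E × ℝ) (z : E × ℝ) : E →L[ℝ] ℝ :=
  (z.2 / (Ψ z).2 ^ 2) • k (Ψ z) (fderiv ℝ Ψ z (0, 1)).1

/-- The normal component of the momentum of the curves `s ↦ Ψ (x, s)`. -/
def normalMomentum (Ψ : E × ℝ → E × ℝ) (z : E × ℝ) : ℝ :=
  z.2 / (Ψ z).2 ^ 2 * (fderiv ℝ Ψ z (0, 1)).2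

/-- The normal component of the velocity of the curves `s ↦ Ψ (x, s)`. -/
def normalSpeed (Ψ : E × ℝ → E × ℝ) (z : E × ℝ) : ℝ :=
  z.2 * (fderiv ℝ Ψ z (0, 1)).2 / (Ψ z).2

/-- The state `(W, y, η)` of the geodesic equation along the curves `s ↦ Ψ (x, s)`. -/
def transitionState (k : E × ℝ → E →L[ℝ] E →L[ℝ] ℝ) (Ψ : E × ℝ → E × ℝ) (z : E × ℝ) :
    GeodesicState E :=
  (Real.log ((Ψ z).2 / z.2), (Ψ z).1, momentum k Ψ z)

/-- The state of the geodesic equation, together with its derivative along `E`. -/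
def transitionJet (k : E × ℝ → E →L[ℝ] E →L[ℝ] ℝ) (Ψ : E × ℝ → E × ℝ) (z : E × ℝ) :
    GeodesicState E × (E →L[ℝ] GeodesicState E) :=
  (transitionState k Ψ z, (fderiv ℝ (transitionState k Ψ) z).comp (ContinuousLinearMap.inl ℝ E ℝ))

variable [FiniteDimensional ℝ E] {k k' : E × ℝ → E →L[ℝ] E →L[ℝ] ℝ} {S D : Set (E × ℝ)}
  {Ψ : E × ℝ → E × ℝ} {f : E → ℝ}

namespace IsTransition

lemma mem_nhds (h : IsTransition k S k' D Ψ f) {z : E × ℝ} (hz : z ∈ D) (h0 : 0 < z.2) : D ∈ 𝓝 z :=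
  mem_nhds_of_halfSpace h.exists_isOpen hz h0

lemma contDiffAt (h : IsTransition k S k' D Ψ f) {z : E × ℝ} (hz : z ∈ D) (h0 : 0 < z.2) :
    ContDiffAt ℝ ∞ Ψ z :=
  h.contDiffOn.contDiffAt (h.mem_nhds hz h0)

lemma contDiffAt_fderiv (h : IsTransition k S k' D Ψ f) {z : E × ℝ} (hz : z ∈ D) (h0 : 0 < z.2) :
    ContDiffAt ℝ ∞ (fderiv ℝ Ψ) z :=
  (h.contDiffAt hz h0).fderiv_right (by simp)

lemma metric_contDiffAt (hk : IsMetricFamily k S) (h : IsTransition k S k' D Ψ f) {z : E × ℝ}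
    (hz : z ∈ D) (h0 : 0 < z.2) : ContDiffAt ℝ ∞ k (Ψ z) :=
  hk.contDiffOn.contDiffAt (mem_nhds_of_halfSpace hk.exists_isOpen (h.mapsTo hz) (h.pos z hz h0))

lemma contDiffAt_momentum (hk : IsMetricFamily k S) (h : IsTransition k S k' D Ψ f) {z : E × ℝ}
    (hz : z ∈ D) (h0 : 0 < z.2) : ContDiffAt ℝ ∞ (momentum k Ψ) z := by
  have h1 := h.contDiffAt hz h0
  have h2 := h.contDiffAt_fderiv hz h0
  have h3 : ContDiffAt ℝ ∞ (fun z ↦ k (Ψ z)) z := (metric_contDiffAt hk h hz h0).comp z h1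
  refine ContDiffAt.smul (contDiffAt_snd.div (h1.snd.pow 2) ?_) (h3.clm_apply ?_)
  · exact pow_ne_zero 2 (h.pos z hz h0).ne'
  · exact (h2.clm_apply contDiffAt_const).fst

lemma contDiffAt_normalMomentum (h : IsTransition k S k' D Ψ f) {z : E × ℝ}
    (hz : z ∈ D) (h0 : 0 < z.2) : ContDiffAt ℝ ∞ (normalMomentum Ψ) z := by
  have h1 := h.contDiffAt hz h0
  have h2 := h.contDiffAt_fderiv hz h0
  refine ContDiffAt.mul (contDiffAt_snd.div (h1.snd.pow 2) ?_)
    (h2.clm_apply contDiffAt_const).snd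
  exact pow_ne_zero 2 (h.pos z hz h0).ne'

lemma contDiffAt_normalSpeed (h : IsTransition k S k' D Ψ f) {z : E × ℝ}
    (hz : z ∈ D) (h0 : 0 < z.2) : ContDiffAt ℝ ∞ (normalSpeed Ψ) z :=
  (contDiffAt_snd.mul ((h.contDiffAt_fderiv hz h0).clm_apply contDiffAt_const).snd).div
    (h.contDiffAt hz h0).snd (h.pos z hz h0).ne'

lemma contDiffAt_transitionState (hk : IsMetricFamily k S) (h : IsTransition k S k' D Ψ f)
    {z : E × ℝ} (hz : z ∈ D) (h0 : 0 < z.2) : ContDiffAt ℝ ∞ (transitionState k Ψ) z := by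
  have h1 := h.contDiffAt hz h0
  refine ContDiffAt.prodMk ?_ (h1.fst.prodMk (contDiffAt_momentum hk h hz h0))
  exact (h1.snd.div contDiffAt_snd h0.ne').log (div_pos (h.pos z hz h0) h0).ne'

omit [FiniteDimensional ℝ E] in
lemma _root_.AHMetric.hasDerivAt_comp_line {V W : Type*} [NormedAddCommGroup V] [NormedSpace ℝ V]
    [NormedAddCommGroup W] [NormedSpace ℝ W] {g : W → V} {z : W} (hg : ContDiffAt ℝ ∞ g z) (u : W) :
    HasDerivAt (fun τ : ℝ ↦ g (z + τ • u)) (fderiv ℝ g z u) 0 := by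
  have hline : HasDerivAt (fun τ : ℝ ↦ z + τ • u) u 0 := by
    simpa using ((hasDerivAt_id (0 : ℝ)).smul_const u).const_add z
  exact (hg.differentiableAt (by simp)).hasFDerivAt.comp_hasDerivAt_of_eq (0 : ℝ) hline (by simp)

lemma _root_.AHMetric.fderiv_fderiv_comm {V W : Type*} [NormedAddCommGroup V] [NormedSpace ℝ V]
    [NormedAddCommGroup W] [NormedSpace ℝ W] {g : W → V} {z : W} (hg : ContDiffAt ℝ ∞ g z) (a b : W) :
    fderiv ℝ (fderiv ℝ g) z a b = fderiv ℝ (fderiv ℝ g) z b a :=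
  (hg.isSymmSndFDerivAt (by
    rw [minSmoothness_of_isRCLikeNormedField]; exact WithTop.coe_le_coe.2 (le_top (a := (2 : ℕ∞))))).eq a b

/-- Test the pullback identity on `(0, 1)` and `e`: since `dr² + k'` has no cross terms, the
momentum of the curve annihilates the images of the slices. This is the Gauss lemma. -/
lemma momentum_comp_fderiv (h : IsTransition k S k' D Ψ f) {z : E × ℝ} (hz : z ∈ D)
    (h0 : 0 < z.2) (e : E × ℝ) :
    z.2 * (normalMomentum Ψ z * (fderiv ℝ Ψ z e).2 + momentum k Ψ z (fderiv ℝ Ψ z e).1)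
      = e.2 := by
  have hρ := h.pos z hz h0
  have := h.pullback z hz h0 (0, 1) e
  simp only [map_zero, zero_apply, add_zero, one_mul] at this
  simp only [normalMomentum, momentum, smul_apply, smul_eq_mul]
  field_simp
  linear_combination this

lemma normSq_velocity (h : IsTransition k S k' D Ψ f) {z : E × ℝ} (hz : z ∈ D) (h0 : 0 < z.2) :
    z.2 ^ 2 * ((fderiv ℝ Ψ z (0, 1)).2 ^ 2
      + k (Ψ z) (fderiv ℝ Ψ z (0, 1)).1 (fderiv ℝ Ψ z (0, 1)).1) = (Ψ z).2 ^ 2 := by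
  have := h.pullback z hz h0 (0, 1) (0, 1)
  simp only [map_zero, add_zero, mul_one] at this
  linear_combination this

/-- A kernel vector would be null against everything for `dr² + k'`. Surjectivity lets the
Euler-Lagrange identity, known only on images of `dΨ`, be tested on arbitrary vectors. -/
lemma fderiv_surjective (h : IsTransition k S k' D Ψ f) {z : E × ℝ} (hz : z ∈ D) (h0 : 0 < z.2) :
    Function.Surjective (fderiv ℝ Ψ z) := by
  have hρ := h.pos z hz h0
  have hinj : Function.Injective (fderiv ℝ Ψ z).toLinearMap := by
    rw [← LinearMap.ker_eq_bot, LinearMap.ker_eq_bot']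
    intro e he
    have he' : fderiv ℝ Ψ z e = 0 := he
    have key : ∀ e' : E × ℝ, e.2 * e'.2 + k' z e.1 e'.1 = 0 := by
      intro e'
      have := h.pullback z hz h0 e e'
      simp only [he', Prod.fst_zero, Prod.snd_zero, zero_mul, map_zero, zero_apply,
        add_zero, mul_zero] at this
      have h2 := this.symm
      simpa [hρ.ne'] using h2
    have e1 : e.1 = 0 := h.nondegenerate z hz _ fun w ↦ by simpa using key (w, 0)
    have e2 : e.2 = 0 := by simpa using key (0, 1)
    exact Prod.ext e1 e2
  exact (LinearMap.injective_iff_surjective (f := (fderiv ℝ Ψ z).toLinearMap)).1 hinj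

/-- The Euler-Lagrange equation. -/
lemma fderiv_momentum_apply (hk : IsMetricFamily k S) (h : IsTransition k S k' D Ψ f) {z : E × ℝ}
    (hz : z ∈ D) (h0 : 0 < z.2) (e : E × ℝ) :
    fderiv ℝ (normalMomentum Ψ) z (0, 1) * (fderiv ℝ Ψ z e).2
        + fderiv ℝ (momentum k Ψ) z (0, 1) (fderiv ℝ Ψ z e).1
      = z.2 / (Ψ z).2 ^ 2 / 2 * fderiv ℝ k (Ψ z) (fderiv ℝ Ψ z e) (fderiv ℝ Ψ z (0, 1)).1
          (fderiv ℝ Ψ z (0, 1)).1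
        - (fderiv ℝ Ψ z e).2 / ((Ψ z).2 * z.2) := by
  have hρ := h.pos z hz h0
  have hsymm := fderiv_fderiv_comm (h.contDiffAt hz h0)
  have hline : ∀ u : E × ℝ, HasDerivAt (fun τ : ℝ ↦ z + τ • u) u 0 := fun u ↦ by
    simpa using ((hasDerivAt_id (0 : ℝ)).smul_const u).const_add z
  have hev : ∀ u : E × ℝ, ∀ᶠ τ : ℝ in 𝓝 0, z + τ • u ∈ D ∧ 0 < (z + τ • u).2 := fun u ↦ by
    have hc : ContinuousAt (fun τ : ℝ ↦ z + τ • u) 0 := (hline u).continuousAt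
    refine hc.eventually (p := fun z ↦ z ∈ D ∧ 0 < z.2) ?_
    beta_reduce
    rw [zero_smul, add_zero]
    exact (isOpen_inter_pos_of_halfSpace h.exists_isOpen).mem_nhds ⟨hz, h0⟩
  have hΨ1 : ∀ u e : E × ℝ, HasDerivAt (fun τ : ℝ ↦ fderiv ℝ Ψ (z + τ • u) e)
      (fderiv ℝ (fderiv ℝ Ψ) z u e) 0 := fun u e ↦ by
    simpa using (hasDerivAt_comp_line (h.contDiffAt_fderiv hz h0) u).clm_apply (hasDerivAt_const (0 : ℝ) e)
  have hs : ∀ u : E × ℝ, HasDerivAt (fun τ : ℝ ↦ (z + τ • u).2) u.2 0 := fun u ↦ (hline u).snd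
  have hΨ1' : ∀ u e : E × ℝ, HasDerivAt (fun τ : ℝ ↦ (fderiv ℝ Ψ (z + τ • u) e).1)
      (fderiv ℝ (fderiv ℝ Ψ) z u e).1 0 := fun u e ↦ (hΨ1 u e).fst
  have hΨ2' : ∀ u e : E × ℝ, HasDerivAt (fun τ : ℝ ↦ (fderiv ℝ Ψ (z + τ • u) e).2)
      (fderiv ℝ (fderiv ℝ Ψ) z u e).2 0 := fun u e ↦ (hΨ1 u e).snd
  have hρ' : HasDerivAt (fun τ : ℝ ↦ (Ψ (z + τ • e)).2) (fderiv ℝ Ψ z e).2 0 :=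
    (hasDerivAt_comp_line (h.contDiffAt hz h0) e).snd
  have hkΨ : HasDerivAt (fun τ : ℝ ↦ k (Ψ (z + τ • e)))
      (fderiv ℝ k (Ψ z) (fderiv ℝ Ψ z e)) 0 :=
    ((metric_contDiffAt hk h hz h0).differentiableAt (by simp)).hasFDerivAt.comp_hasDerivAt_of_eq
      (0 : ℝ) (hasDerivAt_comp_line (h.contDiffAt hz h0) e) (by simp)
  -- `d1` differentiates the Gauss identity along the curve and `d2` the unit-speed identity in the
  -- direction `e`. Both contain `∂_e ∂_s Ψ`, by symmetry of second derivatives; eliminating it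
  -- yields the Euler-Lagrange equation with no variational argument.
  have d1 := ((hs (0, 1)).fun_mul (((hasDerivAt_comp_line
    (h.contDiffAt_normalMomentum hz h0) (0, 1)).fun_mul (hΨ2' (0, 1) e)).fun_add
    ((hasDerivAt_comp_line (contDiffAt_momentum hk h hz h0) (0, 1)).clm_apply
    (hΨ1' (0, 1) e)))).unique ((hasDerivAt_const (0 : ℝ) e.2).congr_of_eventuallyEq (by
      filter_upwards [hev (0, 1)] with τ hτ using h.momentum_comp_fderiv hτ.1 hτ.2 e))
  have d2 := (((hs e).fun_pow 2).fun_mul (((hΨ2' e (0, 1)).fun_pow 2).fun_add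
    ((hkΨ.clm_apply (hΨ1' e (0, 1))).clm_apply (hΨ1' e (0, 1))))).unique
    ((hρ'.fun_pow 2).congr_of_eventuallyEq (by
      filter_upwards [hev e] with τ hτ using h.normSq_velocity hτ.1 hτ.2))
  have i1 := h.momentum_comp_fderiv hz h0 e
  have i2 := h.normSq_velocity hz h0
  have i3 := hk.symm _ (h.mapsTo hz) (fderiv ℝ Ψ z (0, 1)).1 (fderiv ℝ (fderiv ℝ Ψ) z e (0, 1)).1
  have hη : ∀ v, momentum k Ψ z v = z.2 / (Ψ z).2 ^ 2 * k (Ψ z) (fderiv ℝ Ψ z (0, 1)).1 v :=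
    fun v ↦ rfl
  simp only [zero_smul, add_zero, hsymm (0, 1) e, add_apply, Nat.cast_ofNat, pow_one,
    Nat.add_one_sub_one, one_mul] at d1 d2
  generalize fderiv ℝ (normalMomentum Ψ) z (0, 1) * (fderiv ℝ Ψ z e).2 = a at *
  rw [hη, hη] at d1
  rw [hη] at i1
  simp only [normalMomentum] at d1 i1
  rw [← i3] at d2
  generalize k (Ψ z) (fderiv ℝ Ψ z (0, 1)).1 (fderiv ℝ (fderiv ℝ Ψ) z e (0, 1)).1 = kys at *
  generalize k (Ψ z) (fderiv ℝ Ψ z (0, 1)).1 (fderiv ℝ Ψ z (0, 1)).1 = kss at *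
  generalize k (Ψ z) (fderiv ℝ Ψ z (0, 1)).1 (fderiv ℝ Ψ z e).1 = kse at *
  generalize fderiv ℝ k (Ψ z) (fderiv ℝ Ψ z e) (fderiv ℝ Ψ z (0, 1)).1
    (fderiv ℝ Ψ z (0, 1)).1 = dk at *
  generalize fderiv ℝ (momentum k Ψ) z (0, 1) (fderiv ℝ Ψ z e).1 = b at *
  generalize (fderiv ℝ Ψ z e).2 = ρe at *
  generalize (fderiv ℝ Ψ z (0, 1)).2 = ρs at *
  generalize (fderiv ℝ (fderiv ℝ Ψ) z e (0, 1)).2 = ρse at *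
  generalize (Ψ z).2 = ρ at *
  generalize z.2 = s at *
  have i2' : ρs ^ 2 + kss = ρ ^ 2 / s ^ 2 := by field_simp; linear_combination i2
  rw [i2'] at d2
  have hB : ρs * ρse + kys = (ρ * ρe - e.2 * ρ ^ 2 / s) / s ^ 2 - dk / 2 := by
    field_simp at d2 ⊢
    linear_combination d2
  have hA : a + b = -e.2 / s ^ 2 - s / ρ ^ 2 * (ρs * ρse + kys) := by
    rw [eq_sub_iff_add_eq, eq_div_iff (by positivity)]
    linear_combination s * d1 - i1
  rw [hA, hB]
  field_simp
  ring

lemma sq_normalSpeed (h : IsTransition k S k' D Ψ f) {z : E × ℝ} (hz : z ∈ D) (h0 : 0 < z.2) :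
    normalSpeed Ψ z ^ 2 = 1 - z.2 * momentum k Ψ z (fderiv ℝ Ψ z (0, 1)).1 := by
  have hρ := h.pos z hz h0
  have := h.normSq_velocity hz h0
  simp only [normalSpeed, momentum, smul_apply, smul_eq_mul]
  field_simp
  linear_combination this

lemma footPoint_transitionState (h : IsTransition k S k' D Ψ f) {z : E × ℝ} (hz : z ∈ D)
    (h0 : 0 < z.2) : footPoint (√z.2, transitionState k Ψ z) = Ψ z := by
  have hρ := h.pos z hz h0
  refine Prod.ext rfl ?_
  simp only [footPoint, transitionState]
  rw [Real.sq_sqrt h0.le, Real.exp_log (div_pos hρ h0)]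
  field_simp

lemma footFactor_transitionState (h : IsTransition k S k' D Ψ f) {z : E × ℝ} (hz : z ∈ D)
    (h0 : 0 < z.2) : footFactor (√z.2, transitionState k Ψ z) = (Ψ z).2 ^ 2 / z.2 := by
  have hρ := h.pos z hz h0
  simp only [footFactor, transitionState]
  rw [Real.sq_sqrt h0.le, two_mul, Real.exp_add, Real.exp_log (div_pos hρ h0)]
  field_simp

lemma stateSharp_transitionState (hk : IsMetricFamily k S) (h : IsTransition k S k' D Ψ f)
    {z : E × ℝ} (hz : z ∈ D) (h0 : 0 < z.2) :
    stateSharp k (√z.2, transitionState k Ψ z)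
      = (z.2 / (Ψ z).2 ^ 2) • (fderiv ℝ Ψ z (0, 1)).1 := by
  rw [stateSharp, h.footPoint_transitionState hz h0]
  simp only [transitionState, momentum, map_smul, hk.inverseFamily_apply (h.mapsTo hz)]

lemma normalSq_transitionState (hk : IsMetricFamily k S) (h : IsTransition k S k' D Ψ f)
    {z : E × ℝ} (hz : z ∈ D) (h0 : 0 < z.2) :
    normalSq k (√z.2, transitionState k Ψ z) = normalSpeed Ψ z ^ 2 := by
  have hρ := h.pos z hz h0
  rw [normalSq, h.footFactor_transitionState hz h0, stateSharp_transitionState hk h hz h0,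
    h.sq_normalSpeed hz h0]
  simp only [transitionState, map_smul, smul_eq_mul]
  rw [Real.sq_sqrt h0.le]
  field_simp

lemma mem_geodesicDomain (hk : IsMetricFamily k S) (h : IsTransition k S k' D Ψ f)
    {z : E × ℝ} (hz : z ∈ D) (h0 : 0 < z.2) (hN : 0 < normalSpeed Ψ z) :
    (√z.2, transitionState k Ψ z) ∈ geodesicDomain k S := by
  refine ⟨?_, ?_⟩
  · rw [h.footPoint_transitionState hz h0]
    exact h.mapsTo hz
  · rw [normalSq_transitionState hk h hz h0]
    positivity

/-- With `N = s ∂_s ρ / ρ` one has `W' = (N - 1)/s`. Unit speed gives `1 - N² = s (ρ²/s) η(η^♯)`,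
hence `W' = -(ρ²/s) η(η^♯)/(1 + N)`, in which the apparent pole has cancelled. Positivity of `N`
selects the root `N = √(N²)`. -/
lemma fderiv_transitionState (hk : IsMetricFamily k S) (h : IsTransition k S k' D Ψ f)
    {z : E × ℝ} (hz : z ∈ D) (h0 : 0 < z.2) (hN : 0 < normalSpeed Ψ z) :
    fderiv ℝ (transitionState k Ψ) z (0, 1) = geodesicField k S (√z.2, transitionState k Ψ z) := by
  have hρ := h.pos z hz h0
  have hΨd : HasFDerivAt Ψ (fderiv ℝ Ψ z) z :=
    ((h.contDiffAt hz h0).differentiableAt (by simp)).hasFDerivAt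
  have hηd : HasFDerivAt (momentum k Ψ) (fderiv ℝ (momentum k Ψ) z) z :=
    ((contDiffAt_momentum hk h hz h0).differentiableAt (by simp)).hasFDerivAt
  have hWd := ((hΨd.snd.fun_mul
    ((hasDerivAt_inv h0.ne').comp_hasFDerivAt z hasFDerivAt_snd)).log
      (mul_pos hρ (inv_pos.2 h0)).ne')
  have hstate : HasFDerivAt (transitionState k Ψ) _ z := hWd.prodMk (hΨd.fst.prodMk hηd)
  rw [hstate.fderiv]
  have hsq := h.sq_normalSpeed hz h0
  have hsharp := stateSharp_transitionState hk h hz h0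
  simp only [geodesicField, geodesicCoeff, ContinuousLinearMap.prod_apply,
    ContinuousLinearMap.comp_apply, h.footPoint_transitionState hz h0,
    h.footFactor_transitionState hz h0, hsharp, normalSq_transitionState hk h hz h0,
    Real.sqrt_sq hN.le]
  have hη : (ContinuousLinearMap.snd ℝ E (E →L[ℝ] ℝ))
      ((ContinuousLinearMap.snd ℝ ℝ (E × (E →L[ℝ] ℝ))) (transitionState k Ψ z)) = momentum k Ψ z := rfl
  have hsharp' : inverseFamily k (Ψ z) (momentum k Ψ z)
      = (z.2 / (Ψ z).2 ^ 2) • (fderiv ℝ Ψ z (0, 1)).1 := by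
    rw [← hsharp, stateSharp, h.footPoint_transitionState hz h0]; rfl
  rw [hη]
  refine Prod.ext ?_ (Prod.ext ?_ ?_)
  · simp only [smul_apply, ContinuousLinearMap.apply_apply, map_smul, smul_eq_mul]
    have hNeq : (fderiv ℝ Ψ z (0, 1)).2 = normalSpeed Ψ z * (Ψ z).2 / z.2 := by
      rw [normalSpeed]; field_simp
    simp only [add_apply, smul_apply, ContinuousLinearMap.comp_apply,
      ContinuousLinearMap.coe_snd', smul_eq_mul, mul_one, hNeq, Function.comp_apply]
    rw [show momentum k Ψ z (fderiv ℝ Ψ z (0, 1)).1 = (1 - normalSpeed Ψ z ^ 2) / z.2 by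
      field_simp; linear_combination hsq]
    generalize normalSpeed Ψ z = N at *
    field_simp
    ring
  · simp only [smul_apply, hsharp', smul_smul]
    rw [show (Ψ z).2 ^ 2 / z.2 * (z.2 / (Ψ z).2 ^ 2) = 1 by field_simp, one_smul]
    rfl
  · ext u
    -- With image `(u, 0)` the normal terms of the Euler-Lagrange identity vanish, leaving the
    -- equation for `η` alone.
    obtain ⟨e, he⟩ := h.fderiv_surjective hz h0 (u, 0)
    have hEL := fderiv_momentum_apply hk h hz h0 e
    have hD : fderivWithin ℝ k S (Ψ z) = fderiv ℝ k (Ψ z) :=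
      fderivWithin_of_mem_nhds (mem_nhds_of_halfSpace hk.exists_isOpen (h.mapsTo hz) hρ)
    simp only [he, mul_zero, zero_add, zero_div, sub_zero] at hEL
    simp only [smul_apply, ContinuousLinearMap.comp_apply, hsharp',
      ContinuousLinearMap.flip_apply, ContinuousLinearMap.inl_apply, map_smul, smul_eq_mul, hD]
    refine hEL.trans ?_
    field_simp

end IsTransition

end Transition

/-! ### Derivatives up to the boundary of a half space -/

section HalfSpace

variable {E V : Type*} [NormedAddCommGroup E] [NormedSpace ℝ E]
  [NormedAddCommGroup V] [NormedSpace ℝ V]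

/-- The derivative of `g` in the direction `u`, within `D`. -/
def partialWithin (D : Set (E × ℝ)) (u : E × ℝ) (g : E × ℝ → V) (z : E × ℝ) : V :=
  fderivWithin ℝ g D z u

variable {D : Set (E × ℝ)} {g : E × ℝ → V}

lemma contDiffOn_partialWithin (hD : ∃ W, IsOpen W ∧ D = W ∩ {z | 0 ≤ z.2})
    (hg : ContDiffOn ℝ ∞ g D) (u : E × ℝ) : ContDiffOn ℝ ∞ (partialWithin D u g) D :=
  (hg.fderivWithin (uniqueDiffOn_halfSpace hD) (m := ∞) (by simp)).clm_apply contDiffOn_const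

lemma partialWithin_congr {g₁ g₂ : E × ℝ → V} (h : EqOn g₁ g₂ D) (u : E × ℝ) :
    EqOn (partialWithin D u g₁) (partialWithin D u g₂) D := fun z hz ↦ by
  simp only [partialWithin]
  rw [fderivWithin_congr h (h hz)]

/-- Boundary points lie in the closure of the interior, so second derivatives within `D` remain
symmetric there. This trades a normal derivative of a tangential one for a tangential derivative of
known boundary data. -/
lemma partialWithin_comm (hD : ∃ W, IsOpen W ∧ D = W ∩ {z | 0 ≤ z.2})
    (hg : ContDiffOn ℝ ∞ g D) (u v : E × ℝ) :
    EqOn (partialWithin D u (partialWithin D v g)) (partialWithin D v (partialWithin D u g)) D := by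
  intro z hz
  have hU := uniqueDiffOn_halfSpace hD
  have hd : DifferentiableWithinAt ℝ (fderivWithin ℝ g D) D z :=
    ((hg.fderivWithin hU (m := ∞) (by simp)).differentiableOn (by simp)) z hz
  have hcl : z ∈ closure (interior D) := by
    obtain ⟨W, hW, rfl⟩ := hD
    have hint : W ∩ {z : E × ℝ | 0 < z.2} ⊆ interior (W ∩ {z | 0 ≤ z.2}) :=
      interior_maximal (inter_subset_inter_right _ fun z (hz : 0 < z.2) ↦ (le_of_lt hz : 0 ≤ z.2))
        (hW.inter (isOpen_lt continuous_const continuous_snd))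
    refine closure_mono hint ?_
    -- Approach `z` by moving inward along the normal direction.
    refine mem_closure_of_tendsto (f := fun s : ℝ ↦ z + s • ((0, 1) : E × ℝ)) (b := 𝓝[>] 0) ?_ ?_
    · exact ((by fun_prop : Continuous fun s : ℝ ↦ z + s • ((0, 1) : E × ℝ)).tendsto' 0 z
        (by simp)).mono_left nhdsWithin_le_nhds
    · have h1 : ∀ᶠ s : ℝ in 𝓝[>] 0, z + s • ((0, 1) : E × ℝ) ∈ W :=
        (((by fun_prop : Continuous fun s : ℝ ↦ z + s • ((0, 1) : E × ℝ)).tendsto' 0 z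
        (by simp)).mono_left nhdsWithin_le_nhds).eventually (hW.mem_nhds hz.1)
      filter_upwards [h1, self_mem_nhdsWithin] with s hs hs0
      refine ⟨hs, ?_⟩
      have h2 : 0 ≤ z.2 := hz.2
      have h3 : 0 < s := hs0
      simp only [mem_ofPred_eq, Prod.snd_add, Prod.smul_snd, smul_eq_mul, mul_one]
      positivity
  have hs := (hg z hz).isSymmSndFDerivWithinAt (by
    rw [minSmoothness_of_isRCLikeNormedField]; exact WithTop.coe_le_coe.2 (le_top (a := (2 : ℕ∞))))
    hU hcl hz
  have key : ∀ a b : E × ℝ, partialWithin D a (partialWithin D b g) z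
      = fderivWithin ℝ (fderivWithin ℝ g D) D z a b := by
    intro a b
    have : HasFDerivWithinAt (fun z ↦ fderivWithin ℝ g D z b) _ D z :=
      hd.hasFDerivWithinAt.clm_apply (hasFDerivWithinAt_const b z D)
    simp only [partialWithin]
    have e : (partialWithin D b g) = fun z ↦ fderivWithin ℝ g D z b := rfl
    rw [e, this.fderivWithin (hU z hz)]
    simp
  rw [key, key]
  exact hs.eq u v

lemma partialWithin_eq_fderiv (hD : ∃ W, IsOpen W ∧ D = W ∩ {z | 0 ≤ z.2}) {z : E × ℝ}
    (hz : z ∈ D) (h0 : 0 < z.2) (u : E × ℝ) : partialWithin D u g z = fderiv ℝ g z u := by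
  rw [partialWithin, fderivWithin_of_mem_nhds (mem_nhds_of_halfSpace hD hz h0)]

lemma partialWithin_partialWithin_eq (hD : ∃ W, IsOpen W ∧ D = W ∩ {z | 0 ≤ z.2})
    (hg : ContDiffOn ℝ ∞ g D) {z : E × ℝ}
    (hz : z ∈ D) (h0 : 0 < z.2) (u v : E × ℝ) :
    partialWithin D u (partialWithin D v g) z = fderiv ℝ (fderiv ℝ g) z u v := by
  rw [partialWithin_eq_fderiv hD hz h0]
  have hev : partialWithin D v g =ᶠ[𝓝 z] fun z ↦ fderiv ℝ g z v := by
    filter_upwards [(isOpen_inter_pos_of_halfSpace hD).mem_nhds ⟨hz, h0⟩] with w hw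
    exact partialWithin_eq_fderiv hD hw.1 hw.2 v
  have hd : DifferentiableAt ℝ (fderiv ℝ g) z :=
    ((hg.contDiffAt (mem_nhds_of_halfSpace hD hz h0)).fderiv_right (m := ∞)
      (by simp)).differentiableAt (by simp)
  have : HasFDerivAt (fun z ↦ fderiv ℝ g z v) _ z :=
    hd.hasFDerivAt.clm_apply (hasFDerivAt_const v z)
  rw [hev.fderiv_eq, this.fderiv]
  simp

lemma eventually_mem_halfSpace_slice (hD : ∃ W, IsOpen W ∧ D = W ∩ {z | 0 ≤ z.2}) {x : E} {s : ℝ}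
    (hx : (x, s) ∈ D) : ∀ᶠ y in 𝓝 x, (y, s) ∈ D := by
  obtain ⟨W, hW, rfl⟩ := hD
  have : ContinuousAt (fun y : E ↦ (y, s)) x := by fun_prop
  filter_upwards [this.eventually (hW.mem_nhds hx.1)] with y hy
  exact ⟨hy, hx.2⟩

lemma eventually_mem_halfSpace (hD : ∃ W, IsOpen W ∧ D = W ∩ {z | 0 ≤ z.2}) {x : E}
    (hx : (x, (0 : ℝ)) ∈ D) : ∀ᶠ s in 𝓝[>] (0 : ℝ), (x, s) ∈ D := by
  obtain ⟨W, hW, rfl⟩ := hD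
  have : ContinuousAt (fun s : ℝ ↦ (x, s)) 0 := by fun_prop
  filter_upwards [(this.eventually (hW.mem_nhds hx.1)).filter_mono nhdsWithin_le_nhds,
    self_mem_nhdsWithin] with s hs h0
  exact ⟨hs, le_of_lt (show (0 : ℝ) < s from h0)⟩

lemma tendsto_halfSpace (hD : ∃ W, IsOpen W ∧ D = W ∩ {z | 0 ≤ z.2}) (hg : ContinuousOn g D)
    {x : E} (hx : (x, (0 : ℝ)) ∈ D) :
    Tendsto (fun s : ℝ ↦ g (x, s)) (𝓝[>] 0) (𝓝 (g (x, 0))) := by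
  refine (hg _ hx).tendsto.comp (tendsto_nhdsWithin_iff.2 ⟨?_, eventually_mem_halfSpace hD hx⟩)
  exact ((by fun_prop : Continuous fun s : ℝ ↦ (x, s)).tendsto 0).mono_left nhdsWithin_le_nhds

lemma hasFDerivAt_slice (hD : ∃ W, IsOpen W ∧ D = W ∩ {z | 0 ≤ z.2})
    (hg : ContDiffOn ℝ ∞ g D) {x : E} {s : ℝ} (hx : (x, s) ∈ D) :
    HasFDerivAt (fun y ↦ g (y, s))
      ((fderivWithin ℝ g D (x, s)).comp (ContinuousLinearMap.inl ℝ E ℝ)) x :=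
  ((hg.differentiableOn (by simp)) _ hx).hasFDerivWithinAt.comp_hasFDerivAt x
    (hasFDerivAt_prodMk_left x s) (eventually_mem_halfSpace_slice hD hx)

/-- The one-sided difference quotient of a function vanishing at the boundary point; it resolves the
`0/0` limits such as `ρ/s` and `∂_v ρ / s`. -/
lemma tendsto_inv_smul_halfSpace (hD : ∃ W, IsOpen W ∧ D = W ∩ {z | 0 ≤ z.2})
    (hg : ContDiffOn ℝ ∞ g D) {x : E} (hx : (x, (0 : ℝ)) ∈ D) (h0 : g (x, 0) = 0) :
    Tendsto (fun s : ℝ ↦ s⁻¹ • g (x, s)) (𝓝[>] 0) (𝓝 (partialWithin D (0, 1) g (x, 0))) := by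
  have h1 : HasDerivWithinAt (fun s : ℝ ↦ (x, s)) (0, 1) (Ioi 0) 0 :=
    ((hasDerivAt_const _ _).prodMk (hasDerivAt_id 0)).hasDerivWithinAt
  have hd := ((hg.differentiableOn (by simp)) _ hx).hasFDerivWithinAt
  have hmaps : Tendsto (fun s : ℝ ↦ (x, s)) (𝓝[>] 0) (𝓝[D] (x, 0)) :=
    tendsto_nhdsWithin_iff.2 ⟨h1.continuousWithinAt, eventually_mem_halfSpace hD hx⟩
  have h2 : HasDerivWithinAt (fun s : ℝ ↦ g (x, s)) (fderivWithin ℝ g D (x, 0) (0, 1)) (Ioi 0) 0 :=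
    ((hd.comp_hasDerivWithinAt_of_eq (0 : ℝ) (h1.mono inter_subset_left)
      (fun s (hs : s ∈ Ioi (0 : ℝ) ∩ {s | (x, s) ∈ D}) ↦ hs.2) rfl)).mono_of_mem_nhdsWithin
      (inter_mem self_mem_nhdsWithin (eventually_mem_halfSpace hD hx))
  have h3 := hasDerivWithinAt_iff_tendsto_slope.1 h2
  have h4 : Ioi (0 : ℝ) \ {0} = Ioi 0 := by simp
  rw [h4] at h3
  refine h3.congr fun s ↦ ?_
  simp [slope, h0]

end HalfSpace

/-! ### Limits of linear maps in finite dimension -/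

section CLM

variable {E V : Type*} [NormedAddCommGroup E] [NormedSpace ℝ E] [FiniteDimensional ℝ E]
  [NormedAddCommGroup V] [NormedSpace ℝ V]

lemma tendsto_clm_of_apply {ι : Type*} {l : Filter ι} {T : ι → E →L[ℝ] V} {T₀ : E →L[ℝ] V}
    (h : ∀ v, Tendsto (fun i ↦ T i v) l (𝓝 (T₀ v))) : Tendsto T l (𝓝 T₀) := by
  let b := Module.finBasis ℝ E
  have key : ∀ L : E →L[ℝ] V,
      L = ∑ j, (LinearMap.toContinuousLinearMap (b.coord j)).smulRight (L (b j)) := by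
    intro L
    ext v
    conv_lhs => rw [← b.sum_repr v]
    rw [map_sum]
    simp
  rw [key T₀]
  have : T = fun i ↦ ∑ j, (LinearMap.toContinuousLinearMap (b.coord j)).smulRight (T i (b j)) := by
    ext1 i; exact key _
  rw [this]
  refine tendsto_finsetSum _ fun j _ ↦ ?_
  exact ((ContinuousLinearMap.smulRightL ℝ E V
    (LinearMap.toContinuousLinearMap (b.coord j))).continuous.tendsto _).comp (h (b j))

/-- The maps `T` are eventually invertible with inverses tending to the identity. The pullback
identity controls the momentum only on the vectors `∂_v y`, and this removes that distortion. -/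
lemma tendsto_of_tendsto_comp {ι : Type*} {l : Filter ι} {η : ι → E →L[ℝ] V}
    {T : ι → E →L[ℝ] E} {α : E →L[ℝ] V}
    (hT : Tendsto T l (𝓝 (ContinuousLinearMap.id ℝ E)))
    (h : Tendsto (fun i ↦ (η i).comp (T i)) l (𝓝 α)) : Tendsto η l (𝓝 α) := by
  have : CompleteSpace E := FiniteDimensional.complete ℝ E
  have hinv : Tendsto (fun i ↦ Ring.inverse (T i)) l (𝓝 (1 : E →L[ℝ] E)) := by
    have := (NormedRing.inverse_continuousAt (1 : (E →L[ℝ] E)ˣ)).tendsto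
    simp only [Units.val_one, Ring.inverse_one] at this
    exact this.comp hT
  have hunit : ∀ᶠ i in l, IsUnit (T i) :=
    hT.eventually (Units.isOpen.mem_nhds (isUnit_one : IsUnit (1 : E →L[ℝ] E)))
  have hc : Tendsto (fun i ↦ ((η i).comp (T i)).comp (Ring.inverse (T i))) l
      (𝓝 (α.comp (1 : E →L[ℝ] E))) :=
    (((isBoundedBilinearMap_comp (𝕜 := ℝ) (E := E) (F := E)
      (G := V)).continuous.tendsto (α, (1 : E →L[ℝ] E)))).comp (h.prodMk_nhds hinv)
  refine hc.congr' ?_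
  filter_upwards [hunit] with i hi
  have : (T i).comp (Ring.inverse (T i)) = 1 := Ring.mul_inverse_cancel _ hi
  rw [ContinuousLinearMap.comp_assoc, this]
  rfl

end CLM

/-! ### Initial values at the boundary, and the equation for the jet -/

section InitialValues

variable {E : Type*} [NormedAddCommGroup E] [NormedSpace ℝ E]

lemma tendsto_clm_apply {ι V W : Type*} [NormedAddCommGroup V] [NormedSpace ℝ V]
    [NormedAddCommGroup W] [NormedSpace ℝ W] {l : Filter ι} {T : ι → V →L[ℝ] W} {T₀ : V →L[ℝ] W}
    {u : ι → V} {u₀ : V} (hT : Tendsto T l (𝓝 T₀)) (hu : Tendsto u l (𝓝 u₀)) :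
    Tendsto (fun i ↦ T i (u i)) l (𝓝 (T₀ u₀)) :=
  ((isBoundedBilinearMap_apply (𝕜 := ℝ) (E := V) (F := W)).continuous.tendsto (T₀, u₀)).comp
    (hT.prodMk_nhds hu)

/-- Tangential derivatives at a boundary point see only the boundary values. -/
lemma partialWithin_of_restrict_eventuallyEq {V : Type*} [NormedAddCommGroup V] [NormedSpace ℝ V]
    {D : Set (E × ℝ)} {g : E × ℝ → V}
    (hD : ∃ W, IsOpen W ∧ D = W ∩ {z | 0 ≤ z.2}) (hg : ContDiffOn ℝ ∞ g D) {x : E}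
    (hx : (x, (0 : ℝ)) ∈ D) {φ : E → V} {φ' : E →L[ℝ] V}
    (h : ∀ᶠ y in 𝓝 x, g (y, 0) = φ y) (hφ : HasFDerivAt φ φ' x) (v : E) :
    partialWithin D (v, 0) g (x, 0) = φ' v := by
  have h1 := hasFDerivAt_slice hD hg hx
  have h2 := hφ.congr_of_eventuallyEq h
  rw [← h1.unique h2]
  rfl

variable [FiniteDimensional ℝ E] {k k' : E × ℝ → E →L[ℝ] E →L[ℝ] ℝ} {S D : Set (E × ℝ)}
  {Ψ : E × ℝ → E × ℝ} {f : E → ℝ}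

namespace IsTransition

lemma fderiv_fst (h : IsTransition k S k' D Ψ f) {z : E × ℝ} (hz : z ∈ D) (h0 : 0 < z.2)
    (e : E × ℝ) : fderiv ℝ (fun z ↦ (Ψ z).1) z e = (fderiv ℝ Ψ z e).1 := by
  have := ((h.contDiffAt hz h0).differentiableAt (by simp)).hasFDerivAt.fst
  rw [this.fderiv]; rfl

lemma fderiv_snd (h : IsTransition k S k' D Ψ f) {z : E × ℝ} (hz : z ∈ D) (h0 : 0 < z.2)
    (e : E × ℝ) : fderiv ℝ (fun z ↦ (Ψ z).2) z e = (fderiv ℝ Ψ z e).2 := by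
  have := ((h.contDiffAt hz h0).differentiableAt (by simp)).hasFDerivAt.snd
  rw [this.fderiv]; rfl

lemma fderiv_fderiv_fst (h : IsTransition k S k' D Ψ f) {z : E × ℝ} (hz : z ∈ D) (h0 : 0 < z.2)
    (a b : E × ℝ) : fderiv ℝ (fderiv ℝ (fun z ↦ (Ψ z).1)) z a b
      = (fderiv ℝ (fderiv ℝ Ψ) z a b).1 := by
  have hev : fderiv ℝ (fun z ↦ (Ψ z).1)
      =ᶠ[𝓝 z] fun w ↦ (ContinuousLinearMap.fst ℝ E ℝ).comp (fderiv ℝ Ψ w) := by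
    filter_upwards [(isOpen_inter_pos_of_halfSpace h.exists_isOpen).mem_nhds ⟨hz, h0⟩] with w hw
    ext e
    · exact h.fderiv_fst hw.1 hw.2 _
    · exact h.fderiv_fst hw.1 hw.2 _
  rw [hev.fderiv_eq]
  have := (hasFDerivAt_const (ContinuousLinearMap.fst ℝ E ℝ) z).clm_comp
    ((h.contDiffAt_fderiv hz h0).differentiableAt (by simp)).hasFDerivAt
  rw [this.fderiv]
  simp

lemma fderiv_fderiv_snd (h : IsTransition k S k' D Ψ f) {z : E × ℝ} (hz : z ∈ D) (h0 : 0 < z.2)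
    (a b : E × ℝ) : fderiv ℝ (fderiv ℝ (fun z ↦ (Ψ z).2)) z a b
      = (fderiv ℝ (fderiv ℝ Ψ) z a b).2 := by
  have hev : fderiv ℝ (fun z ↦ (Ψ z).2)
      =ᶠ[𝓝 z] fun w ↦ (ContinuousLinearMap.snd ℝ E ℝ).comp (fderiv ℝ Ψ w) := by
    filter_upwards [(isOpen_inter_pos_of_halfSpace h.exists_isOpen).mem_nhds ⟨hz, h0⟩] with w hw
    ext e
    · exact h.fderiv_snd hw.1 hw.2 _
    · exact h.fderiv_snd hw.1 hw.2 _
  rw [hev.fderiv_eq]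
  have := (hasFDerivAt_const (ContinuousLinearMap.snd ℝ E ℝ) z).clm_comp
    ((h.contDiffAt_fderiv hz h0).differentiableAt (by simp)).hasFDerivAt
  rw [this.fderiv]
  simp

lemma fderiv_transitionState_apply (hk : IsMetricFamily k S) (h : IsTransition k S k' D Ψ f)
    {z : E × ℝ} (hz : z ∈ D) (h0 : 0 < z.2) (w : E) :
    fderiv ℝ (transitionState k Ψ) z (w, 0) = ((fderiv ℝ Ψ z (w, 0)).2 / (Ψ z).2,
      (fderiv ℝ Ψ z (w, 0)).1, fderiv ℝ (momentum k Ψ) z (w, 0)) := by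
  have hρ := h.pos z hz h0
  have hΨd : HasFDerivAt Ψ (fderiv ℝ Ψ z) z :=
    ((h.contDiffAt hz h0).differentiableAt (by simp)).hasFDerivAt
  have hηd : HasFDerivAt (momentum k Ψ) (fderiv ℝ (momentum k Ψ) z) z :=
    ((contDiffAt_momentum hk h hz h0).differentiableAt (by simp)).hasFDerivAt
  have hWd := ((hΨd.snd.fun_mul
    ((hasDerivAt_inv h0.ne').comp_hasFDerivAt z hasFDerivAt_snd)).log
      (mul_pos hρ (inv_pos.2 h0)).ne')
  have hstate : HasFDerivAt (transitionState k Ψ) _ z := hWd.prodMk (hΨd.fst.prodMk hηd)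
  rw [hstate.fderiv]
  refine Prod.ext ?_ rfl
  simp only [ContinuousLinearMap.prod_apply, add_apply, smul_apply, ContinuousLinearMap.comp_apply,
      ContinuousLinearMap.coe_snd', smul_eq_mul, Function.comp_apply]
  field_simp
  ring

lemma momentum_tangential (h : IsTransition k S k' D Ψ f) {z : E × ℝ} (hz : z ∈ D)
    (h0 : 0 < z.2) (v : E) :
    (Ψ z).2 ^ 2 * momentum k Ψ z (fderiv ℝ Ψ z (v, 0)).1
      = -(z.2 * (fderiv ℝ Ψ z (0, 1)).2 * (fderiv ℝ Ψ z (v, 0)).2) := by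
  have hρ := h.pos z hz h0
  have := h.momentum_comp_fderiv hz h0 (v, 0)
  rw [mul_eq_zero, or_iff_right h0.ne', normalMomentum] at this
  field_simp at this
  linear_combination this

/-- Differentiate `momentum_tangential` along `(w, 0)` and solve for the derivative of the momentum;
each term on the right has a limit at the boundary once powers of `s` are distributed. -/
lemma fderiv_momentum_tangential (hk : IsMetricFamily k S) (h : IsTransition k S k' D Ψ f)
    {z : E × ℝ} (hz : z ∈ D) (h0 : 0 < z.2) (v w : E) :
    fderiv ℝ (momentum k Ψ) z (w, 0) (fderiv ℝ Ψ z (v, 0)).1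
      = -momentum k Ψ z (fderiv ℝ (fderiv ℝ Ψ) z (w, 0) (v, 0)).1
        - 2 * ((fderiv ℝ Ψ z (w, 0)).2 / (Ψ z).2) * momentum k Ψ z (fderiv ℝ Ψ z (v, 0)).1
        - z.2 / (Ψ z).2 ^ 2 * ((fderiv ℝ (fderiv ℝ Ψ) z (w, 0) (0, 1)).2 * (fderiv ℝ Ψ z (v, 0)).2
          + (fderiv ℝ Ψ z (0, 1)).2 * (fderiv ℝ (fderiv ℝ Ψ) z (w, 0) (v, 0)).2) := by
  have hρ := h.pos z hz h0
  have hline : HasDerivAt (fun τ : ℝ ↦ z + τ • ((w, 0) : E × ℝ)) (w, 0) 0 := by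
    simpa using ((hasDerivAt_id (0 : ℝ)).smul_const ((w, 0) : E × ℝ)).const_add z
  have hev : ∀ᶠ τ : ℝ in 𝓝 0, z + τ • ((w, 0) : E × ℝ) ∈ D ∧ 0 < (z + τ • ((w, 0) : E × ℝ)).2 := by
    have hc : ContinuousAt (fun τ : ℝ ↦ z + τ • ((w, 0) : E × ℝ)) 0 := hline.continuousAt
    refine hc.eventually (p := fun z ↦ z ∈ D ∧ 0 < z.2) ?_
    beta_reduce
    rw [zero_smul, add_zero]
    exact (isOpen_inter_pos_of_halfSpace h.exists_isOpen).mem_nhds ⟨hz, h0⟩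
  have hΨ1 : ∀ e : E × ℝ, HasDerivAt (fun τ : ℝ ↦ fderiv ℝ Ψ (z + τ • ((w, 0) : E × ℝ)) e)
      (fderiv ℝ (fderiv ℝ Ψ) z (w, 0) e) 0 := fun e ↦ by
    simpa using (hasDerivAt_comp_line (h.contDiffAt_fderiv hz h0) (w, 0)).clm_apply
      (hasDerivAt_const (0 : ℝ) e)
  have hΨ1' : ∀ e : E × ℝ, HasDerivAt (fun τ : ℝ ↦ (fderiv ℝ Ψ (z + τ • ((w, 0) : E × ℝ)) e).1)
      (fderiv ℝ (fderiv ℝ Ψ) z (w, 0) e).1 0 := fun e ↦ (hΨ1 e).fst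
  have hΨ2' : ∀ e : E × ℝ, HasDerivAt (fun τ : ℝ ↦ (fderiv ℝ Ψ (z + τ • ((w, 0) : E × ℝ)) e).2)
      (fderiv ℝ (fderiv ℝ Ψ) z (w, 0) e).2 0 := fun e ↦ (hΨ1 e).snd
  have hρ' : HasDerivAt (fun τ : ℝ ↦ (Ψ (z + τ • ((w, 0) : E × ℝ))).2) (fderiv ℝ Ψ z (w, 0)).2 0 :=
    (hasDerivAt_comp_line (h.contDiffAt hz h0) (w, 0)).snd
  have hs : HasDerivAt (fun τ : ℝ ↦ (z + τ • ((w, 0) : E × ℝ)).2) 0 0 := hline.snd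
  have d := ((hρ'.fun_pow 2).fun_mul ((hasDerivAt_comp_line
    (contDiffAt_momentum hk h hz h0) (w, 0)).clm_apply (hΨ1' (v, 0)))).unique
    ((((hs.fun_mul (hΨ2' (0, 1))).fun_mul (hΨ2' (v, 0))).fun_neg).congr_of_eventuallyEq (by
      filter_upwards [hev] with τ hτ using h.momentum_tangential hτ.1 hτ.2 v))
  simp only [zero_smul, add_zero, Nat.cast_ofNat, Nat.add_one_sub_one, pow_one, zero_mul,
    zero_add] at d
  generalize fderiv ℝ (momentum k Ψ) z (w, 0) (fderiv ℝ Ψ z (v, 0)).1 = a at *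
  field_simp
  linear_combination d

lemma contDiffOn_fst (h : IsTransition k S k' D Ψ f) : ContDiffOn ℝ ∞ (fun z ↦ (Ψ z).1) D :=
  h.contDiffOn.fst

lemma contDiffOn_snd (h : IsTransition k S k' D Ψ f) : ContDiffOn ℝ ∞ (fun z ↦ (Ψ z).2) D :=
  h.contDiffOn.snd

lemma partialWithin_snd_zero (h : IsTransition k S k' D Ψ f) {x : E} (hx : (x, (0 : ℝ)) ∈ D)
    (v : E) : partialWithin D (v, 0) (fun z ↦ (Ψ z).2) (x, 0) = 0 := by
  rw [partialWithin_of_restrict_eventuallyEq h.exists_isOpen h.contDiffOn_snd hx (φ := fun _ ↦ 0)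
    ?_ (hasFDerivAt_const _ _)]
  · rfl
  · filter_upwards [eventually_mem_halfSpace_slice h.exists_isOpen hx] with y hy
    rw [h.apply_zero y hy]

lemma partialWithin_fst_zero (h : IsTransition k S k' D Ψ f) {x : E} (hx : (x, (0 : ℝ)) ∈ D)
    (v : E) : partialWithin D (v, 0) (fun z ↦ (Ψ z).1) (x, 0) = v := by
  rw [partialWithin_of_restrict_eventuallyEq h.exists_isOpen h.contDiffOn_fst hx (φ := fun y ↦ y)
    ?_ (hasFDerivAt_id _)]
  · rfl
  · filter_upwards [eventually_mem_halfSpace_slice h.exists_isOpen hx] with y hy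
    rw [h.apply_zero y hy]

lemma partialWithin_partialWithin_snd_zero (h : IsTransition k S k' D Ψ f) {x : E}
    (hx : (x, (0 : ℝ)) ∈ D) (v w : E) :
    partialWithin D (w, 0) (partialWithin D (v, 0) (fun z ↦ (Ψ z).2)) (x, 0) = 0 := by
  rw [partialWithin_of_restrict_eventuallyEq h.exists_isOpen
    (contDiffOn_partialWithin h.exists_isOpen h.contDiffOn_snd _) hx (φ := fun _ ↦ 0)
    ?_ (hasFDerivAt_const _ _)]
  · rfl
  · filter_upwards [eventually_mem_halfSpace_slice h.exists_isOpen hx] with y hy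
    exact h.partialWithin_snd_zero hy v

lemma partialWithin_partialWithin_fst_zero (h : IsTransition k S k' D Ψ f) {x : E}
    (hx : (x, (0 : ℝ)) ∈ D) (v w : E) :
    partialWithin D (w, 0) (partialWithin D (v, 0) (fun z ↦ (Ψ z).1)) (x, 0) = 0 := by
  rw [partialWithin_of_restrict_eventuallyEq h.exists_isOpen
    (contDiffOn_partialWithin h.exists_isOpen h.contDiffOn_fst _) hx (φ := fun _ ↦ v)
    ?_ (hasFDerivAt_const _ _)]
  · rfl
  · filter_upwards [eventually_mem_halfSpace_slice h.exists_isOpen hx] with y hy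
    exact h.partialWithin_fst_zero hy v

lemma tendsto_snd_div (h : IsTransition k S k' D Ψ f) {x : E} (hx : (x, (0 : ℝ)) ∈ D) :
    Tendsto (fun s : ℝ ↦ (Ψ (x, s)).2 / s) (𝓝[>] 0)
      (𝓝 (partialWithin D (0, 1) (fun z ↦ (Ψ z).2) (x, 0))) := by
  have := tendsto_inv_smul_halfSpace h.exists_isOpen h.contDiffOn_snd hx (by rw [h.apply_zero x hx])
  refine this.congr fun s ↦ ?_
  rw [smul_eq_mul, inv_mul_eq_div]

/-- Divide the tangential pullback identity by `s²` times the appropriate factors and let `s → 0`: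
with `π = lim ρ/s` this gives `π² e^{2f} k = k` at the boundary, so `π² = e^{-2f}`, and `ρ > 0`
fixes the sign. -/
lemma normal_partialWithin_snd (hk : IsMetricFamily k S) (h : IsTransition k S k' D Ψ f)
    [Nontrivial E] {x : E} (hx : (x, (0 : ℝ)) ∈ D) :
    partialWithin D (0, 1) (fun z ↦ (Ψ z).2) (x, 0) = Real.exp (-f x) := by
  set π := partialWithin D (0, 1) (fun z ↦ (Ψ z).2) (x, 0) with hπ
  have hmem := eventually_mem_halfSpace h.exists_isOpen hx
  have hxS : (x, (0 : ℝ)) ∈ S := by simpa [h.apply_zero x hx] using h.mapsTo hx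
  have hp := h.tendsto_snd_div hx
  have hpos : 0 ≤ π := by
    refine ge_of_tendsto hp ?_
    filter_upwards [hmem, self_mem_nhdsWithin] with s hs h0
    have h0' : 0 < s := h0
    exact (div_pos (h.pos _ hs h0') h0').le
  -- The form may be indefinite, so nondegeneracy supplies a pair with `k(v, w) ≠ 0` to cancel. In
  -- dimension zero the tangential metric would carry no information.
  obtain ⟨v, hv⟩ := exists_ne (0 : E)
  obtain ⟨w, hw⟩ : ∃ w, k (x, 0) v w ≠ 0 := by
    by_contra! hcon
    exact hv (hk.nondegenerate _ hxS v hcon)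
  have hpd1 : ∀ u : E, Tendsto (fun s : ℝ ↦ (fderiv ℝ Ψ (x, s) (u, 0)).1) (𝓝[>] 0) (𝓝 u) := by
    intro u
    have := tendsto_halfSpace h.exists_isOpen
      (contDiffOn_partialWithin h.exists_isOpen h.contDiffOn_fst (u, 0)).continuousOn hx
    rw [h.partialWithin_fst_zero hx] at this
    refine this.congr' ?_
    filter_upwards [hmem, self_mem_nhdsWithin] with s hs h0
    rw [partialWithin_eq_fderiv h.exists_isOpen hs h0, h.fderiv_fst hs h0]
  have hpd2 : ∀ u : E, Tendsto (fun s : ℝ ↦ (fderiv ℝ Ψ (x, s) (u, 0)).2) (𝓝[>] 0) (𝓝 0) := by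
    intro u
    have := tendsto_halfSpace h.exists_isOpen
      (contDiffOn_partialWithin h.exists_isOpen h.contDiffOn_snd (u, 0)).continuousOn hx
    rw [h.partialWithin_snd_zero hx] at this
    refine this.congr' ?_
    filter_upwards [hmem, self_mem_nhdsWithin] with s hs h0
    rw [partialWithin_eq_fderiv h.exists_isOpen hs h0, h.fderiv_snd hs h0]
  have hkΨ : Tendsto (fun s : ℝ ↦ k (Ψ (x, s))) (𝓝[>] 0) (𝓝 (k (x, 0))) := by
    have := tendsto_halfSpace h.exists_isOpen
      (hk.contDiffOn.continuousOn.comp h.contDiffOn.continuousOn h.mapsTo) hx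
    simpa [Function.comp_def, h.apply_zero x hx] using this
  have hk' := tendsto_halfSpace h.exists_isOpen h.continuousOn hx
  rw [h.initial x hx] at hk'
  have hl := ((hpd2 v).mul (hpd2 w)).add (tendsto_clm_apply (tendsto_clm_apply hkΨ (hpd1 v)) (hpd1 w))
  have hr := (hp.pow 2).mul (tendsto_clm_apply
    (tendsto_clm_apply hk' (tendsto_const_nhds (x := v))) (tendsto_const_nhds (x := w)))
  have heq := tendsto_nhds_unique_of_eventuallyEq hl hr (by
    filter_upwards [hmem, self_mem_nhdsWithin] with s hs h0
    have h0' : 0 < s := h0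
    have := h.pullback _ hs h0 (v, 0) (w, 0)
    simp only [mul_zero, zero_add] at this
    field_simp
    linear_combination this)
  simp only [mul_zero, zero_add, smul_apply, smul_eq_mul] at heq
  have h2 : π ^ 2 * Real.exp (2 * f x) = 1 := by
    refine mul_right_cancel₀ hw ?_
    linear_combination -heq
  have h3 : (π * Real.exp (f x)) ^ 2 = 1 := by
    rw [mul_pow, ← Real.exp_nat_mul]; exact_mod_cast h2
  have h4 : π * Real.exp (f x) = 1 := by
    have := Real.exp_pos (f x)
    exact (pow_eq_one_iff_of_nonneg (by positivity) two_ne_zero).1 h3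
  rw [Real.exp_neg]
  exact eq_inv_of_mul_eq_one_left h4

/-- The normal derivative of `ρ` equals `e^{-f}` at all nearby boundary points, so it may be
differentiated tangentially. -/
lemma partialWithin_normal_snd (hk : IsMetricFamily k S) (h : IsTransition k S k' D Ψ f)
    [Nontrivial E] {x : E} (hx : (x, (0 : ℝ)) ∈ D) (hf : DifferentiableAt ℝ f x) (v : E) :
    partialWithin D (v, 0) (partialWithin D (0, 1) (fun z ↦ (Ψ z).2)) (x, 0)
      = -Real.exp (-f x) * fderiv ℝ f x v := by
  rw [partialWithin_of_restrict_eventuallyEq h.exists_isOpen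
    (contDiffOn_partialWithin h.exists_isOpen h.contDiffOn_snd _) hx
    (φ := fun y ↦ Real.exp (-f y)) ?_ hf.hasFDerivAt.fun_neg.exp]
  · simp
  · filter_upwards [eventually_mem_halfSpace_slice h.exists_isOpen hx] with y hy
    exact normal_partialWithin_snd hk h hy

lemma partialWithin_partialWithin_normal_snd (hk : IsMetricFamily k S)
    (h : IsTransition k S k' D Ψ f) [Nontrivial E] {x : E} (hx : (x, (0 : ℝ)) ∈ D)
    (hf : ContDiffAt ℝ ∞ f x) (v w : E) :
    partialWithin D (w, 0) (partialWithin D (v, 0) (partialWithin D (0, 1) (fun z ↦ (Ψ z).2))) (x, 0)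
      = Real.exp (-f x) * (fderiv ℝ f x w * fderiv ℝ f x v - fderiv ℝ (fderiv ℝ f) x w v) := by
  have hf1 : ∀ᶠ y in 𝓝 x, DifferentiableAt ℝ f y := by
    filter_upwards [(hf.of_le (m := 1) (by simp)).eventually (by simp)] with y hy
    exact hy.differentiableAt (by simp)
  have hf2 := ((hf.fderiv_right (m := ∞) (by simp)).differentiableAt (by simp)).hasFDerivAt
  have hd := ((hf.differentiableAt (by simp)).hasFDerivAt.fun_neg.exp.fun_neg).fun_mul
    (hf2.clm_apply (hasFDerivAt_const v x))
  rw [partialWithin_of_restrict_eventuallyEq h.exists_isOpen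
    (contDiffOn_partialWithin h.exists_isOpen
      (contDiffOn_partialWithin h.exists_isOpen h.contDiffOn_snd _) _) hx
    (φ := fun y ↦ -Real.exp (-f y) * fderiv ℝ f y v) ?_ hd]
  · simp
    ring
  · filter_upwards [eventually_mem_halfSpace_slice h.exists_isOpen hx, hf1] with y hy hfy
    exact partialWithin_normal_snd hk h hy hfy v

variable (f) in
/-- The initial values of the state and of its derivative. -/
def _root_.AHMetric.initialJet (x : E) : GeodesicState E × (E →L[ℝ] GeodesicState E) :=
  ((-f x, x, fderiv ℝ f x),
    (-fderiv ℝ f x).prod ((ContinuousLinearMap.id ℝ E).prod (fderiv ℝ (fderiv ℝ f) x)))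

/-- Put `ρ ~ s e^{-f}` and `∂_v ρ ~ -s e^{-f} df(v)` into the Gauss identity `η(∂_v y) = -s ∂_sρ
∂_vρ / ρ²`: the right side tends to `df(v)`. The same computation one order higher produces the
Hessian of `f`. -/
lemma tendsto_normalSpeed_and_transitionJet (hk : IsMetricFamily k S)
    (h : IsTransition k S k' D Ψ f) [Nontrivial E] {x : E} (hx : (x, (0 : ℝ)) ∈ D)
    (hf : ContDiffAt ℝ ∞ f x) :
    Tendsto (fun s : ℝ ↦ normalSpeed Ψ (x, s)) (𝓝[>] 0) (𝓝 1) ∧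
      Tendsto (fun s : ℝ ↦ transitionJet k Ψ (x, s)) (𝓝[>] 0) (𝓝 (initialJet f x)) := by
  have hD := h.exists_isOpen
  have hπ := Real.exp_pos (-f x)
  have hmem : ∀ᶠ s in 𝓝[>] (0 : ℝ), (x, s) ∈ D ∧ 0 < s :=
    (eventually_mem_halfSpace hD hx).and self_mem_nhdsWithin
  have c1 := fun u ↦ contDiffOn_partialWithin hD h.contDiffOn_fst u
  have c2 := fun u ↦ contDiffOn_partialWithin hD h.contDiffOn_snd u
  have c11 := fun u u' ↦ contDiffOn_partialWithin hD (c1 u) u'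
  have c22 := fun u u' ↦ contDiffOn_partialWithin hD (c2 u) u'
  -- first derivatives
  have ly : Tendsto (fun s : ℝ ↦ (Ψ (x, s)).1) (𝓝[>] 0) (𝓝 x) := by
    simpa [h.apply_zero x hx] using tendsto_halfSpace hD h.contDiffOn_fst.continuousOn hx
  have lp : Tendsto (fun s : ℝ ↦ (Ψ (x, s)).2 / s) (𝓝[>] 0) (𝓝 (Real.exp (-f x))) := by
    rw [← normal_partialWithin_snd hk h hx]; exact h.tendsto_snd_div hx
  have lρs : Tendsto (fun s : ℝ ↦ (fderiv ℝ Ψ (x, s) (0, 1)).2) (𝓝[>] 0)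
      (𝓝 (Real.exp (-f x))) := by
    have := tendsto_halfSpace hD (c2 (0, 1)).continuousOn hx
    rw [normal_partialWithin_snd hk h hx] at this
    refine this.congr' ?_
    filter_upwards [hmem] with s hs
    rw [partialWithin_eq_fderiv hD hs.1 hs.2, h.fderiv_snd hs.1 hs.2]
  have lyv : ∀ v : E, Tendsto (fun s : ℝ ↦ (fderiv ℝ Ψ (x, s) (v, 0)).1) (𝓝[>] 0) (𝓝 v) := by
    intro v
    have := tendsto_halfSpace hD (c1 (v, 0)).continuousOn hx
    rw [h.partialWithin_fst_zero hx] at this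
    refine this.congr' ?_
    filter_upwards [hmem] with s hs
    rw [partialWithin_eq_fderiv hD hs.1 hs.2, h.fderiv_fst hs.1 hs.2]
  have lpv : ∀ v : E, Tendsto (fun s : ℝ ↦ s⁻¹ * (fderiv ℝ Ψ (x, s) (v, 0)).2) (𝓝[>] 0)
      (𝓝 (-Real.exp (-f x) * fderiv ℝ f x v)) := by
    intro v
    have := tendsto_inv_smul_halfSpace hD (c2 (v, 0)) hx (h.partialWithin_snd_zero hx v)
    -- The limit of `∂_v ρ / s` is the normal derivative of `∂_v ρ`, that is, the tangential
    -- derivative of the boundary function `e^{-f}`.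
    rw [partialWithin_comm hD h.contDiffOn_snd _ _ hx,
      partialWithin_normal_snd hk h hx (hf.differentiableAt (by simp))] at this
    refine this.congr' ?_
    filter_upwards [hmem] with s hs
    rw [partialWithin_eq_fderiv hD hs.1 hs.2, h.fderiv_snd hs.1 hs.2, smul_eq_mul]
  -- second derivatives
  have lyvw : ∀ v w : E, Tendsto (fun s : ℝ ↦ (fderiv ℝ (fderiv ℝ Ψ) (x, s) (w, 0) (v, 0)).1)
      (𝓝[>] 0) (𝓝 0) := by
    intro v w
    have := tendsto_halfSpace hD (c11 (v, 0) (w, 0)).continuousOn hx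
    rw [h.partialWithin_partialWithin_fst_zero hx] at this
    refine this.congr' ?_
    filter_upwards [hmem] with s hs
    rw [partialWithin_partialWithin_eq hD h.contDiffOn_fst hs.1 hs.2,
      h.fderiv_fderiv_fst hs.1 hs.2]
  have lρsw : ∀ w : E, Tendsto (fun s : ℝ ↦ (fderiv ℝ (fderiv ℝ Ψ) (x, s) (w, 0) (0, 1)).2)
      (𝓝[>] 0) (𝓝 (-Real.exp (-f x) * fderiv ℝ f x w)) := by
    intro w
    have := tendsto_halfSpace hD (c22 (0, 1) (w, 0)).continuousOn hx
    rw [partialWithin_normal_snd hk h hx (hf.differentiableAt (by simp))] at this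
    refine this.congr' ?_
    filter_upwards [hmem] with s hs
    rw [partialWithin_partialWithin_eq hD h.contDiffOn_snd hs.1 hs.2,
      h.fderiv_fderiv_snd hs.1 hs.2]
  have lpvw : ∀ v w : E, Tendsto
      (fun s : ℝ ↦ s⁻¹ * (fderiv ℝ (fderiv ℝ Ψ) (x, s) (w, 0) (v, 0)).2) (𝓝[>] 0)
      (𝓝 (Real.exp (-f x) *
        (fderiv ℝ f x w * fderiv ℝ f x v - fderiv ℝ (fderiv ℝ f) x w v))) := by
    intro v w
    have := tendsto_inv_smul_halfSpace hD (c22 (v, 0) (w, 0)) hx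
      (h.partialWithin_partialWithin_snd_zero hx v w)
    -- Two exchanges move the normal derivative innermost, where the boundary value `e^{-f}` is
    -- known.
    rw [partialWithin_comm hD (c2 _) _ _ hx,
      partialWithin_congr (partialWithin_comm hD h.contDiffOn_snd _ _) _ hx,
      partialWithin_partialWithin_normal_snd hk h hx hf] at this
    refine this.congr' ?_
    filter_upwards [hmem] with s hs
    rw [partialWithin_partialWithin_eq hD h.contDiffOn_snd hs.1 hs.2,
      h.fderiv_fderiv_snd hs.1 hs.2, smul_eq_mul]
  have lT : Tendsto (fun s : ℝ ↦ ((ContinuousLinearMap.fst ℝ E ℝ).comp (fderiv ℝ Ψ (x, s))).comp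
      (ContinuousLinearMap.inl ℝ E ℝ)) (𝓝[>] 0) (𝓝 (ContinuousLinearMap.id ℝ E)) :=
    tendsto_clm_of_apply fun v ↦ lyv v
  have lη : Tendsto (fun s : ℝ ↦ momentum k Ψ (x, s)) (𝓝[>] 0) (𝓝 (fderiv ℝ f x)) := by
    refine tendsto_of_tendsto_comp lT (tendsto_clm_of_apply fun v ↦ ?_)
    have := ((lρs.mul (lpv v)).div (lp.pow 2) (by positivity)).neg
    have e : -(Real.exp (-f x) * (-Real.exp (-f x) * fderiv ℝ f x v) / Real.exp (-f x) ^ 2)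
        = fderiv ℝ f x v := by field_simp
    rw [e] at this
    refine this.congr' ?_
    filter_upwards [hmem] with s hs
    have hρ := h.pos _ hs.1 hs.2
    have h1 := h.momentum_tangential hs.1 hs.2 v
    have hs0 := hs.2
    change _ = momentum k Ψ (x, s) (fderiv ℝ Ψ (x, s) (v, 0)).1
    simp only [Pi.div_apply] at h1 ⊢
    field_simp
    linear_combination -h1
  have lW : ∀ v : E, Tendsto (fun s : ℝ ↦ (fderiv ℝ Ψ (x, s) (v, 0)).2 / (Ψ (x, s)).2) (𝓝[>] 0)
      (𝓝 (-fderiv ℝ f x v)) := by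
    intro v
    have := (lpv v).div lp hπ.ne'
    have e : -Real.exp (-f x) * fderiv ℝ f x v / Real.exp (-f x) = -fderiv ℝ f x v := by field_simp
    rw [e] at this
    refine this.congr' ?_
    filter_upwards [hmem] with s hs
    have hρ := h.pos _ hs.1 hs.2
    have hs0 := hs.2
    rw [Pi.div_apply]
    field_simp
  have ldη : Tendsto (fun s : ℝ ↦ (fderiv ℝ (momentum k Ψ) (x, s)).comp
      (ContinuousLinearMap.inl ℝ E ℝ)) (𝓝[>] 0) (𝓝 (fderiv ℝ (fderiv ℝ f) x)) := by
    refine tendsto_clm_of_apply fun w ↦ ?_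
    refine tendsto_of_tendsto_comp lT (tendsto_clm_of_apply fun v ↦ ?_)
    have t1 := tendsto_clm_apply lη (lyvw v w)
    have t2 := ((lW w).const_mul 2).mul (tendsto_clm_apply lη (lyv v))
    have t3 := (((lρsw w).mul (lpv v)).add (lρs.mul (lpvw v w))).div (lp.pow 2) (by positivity)
    have := (t1.neg.sub t2).sub t3
    refine (this.congr' ?_).trans (le_of_eq ?_)
    · filter_upwards [hmem] with s hs
      have hρ := h.pos _ hs.1 hs.2
      have h1 := fderiv_momentum_tangential hk h hs.1 hs.2 v w
      have hs0 := hs.2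
      change _ = fderiv ℝ (momentum k Ψ) (x, s) (w, 0) (fderiv ℝ Ψ (x, s) (v, 0)).1
      rw [h1, Pi.div_apply]
      field_simp
    · congr 1
      simp only [map_zero, neg_zero, zero_sub]
      -- The limit is `2 f_w f_v - f_w f_v - (f_w f_v - f_wv)`, which collapses to `f_wv`.
      field_simp
      ring
  refine ⟨?_, Tendsto.prodMk_nhds (Tendsto.prodMk_nhds ?_ (ly.prodMk_nhds lη)) ?_⟩
  · have := lρs.div lp hπ.ne'
    rw [div_self hπ.ne'] at this
    refine this.congr' ?_
    filter_upwards [hmem] with s hs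
    have hρ := h.pos _ hs.1 hs.2
    have hs0 := hs.2
    rw [normalSpeed, Pi.div_apply]
    field_simp
  · have := lp.log hπ.ne'
    rwa [Real.log_exp] at this
  · refine tendsto_clm_of_apply fun w ↦ ?_
    refine ((lW w).prodMk_nhds ((lyv w).prodMk_nhds
      (tendsto_clm_apply ldη (tendsto_const_nhds (x := w))))).congr' ?_
    filter_upwards [hmem] with s hs
    exact (fderiv_transitionState_apply hk h hs.1 hs.2 w).symm

/-- The geodesic equation for the state and for its derivative. -/
lemma hasDerivAt_transitionJet (hk : IsMetricFamily k S) (h : IsTransition k S k' D Ψ f) {x : E}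
    {s : ℝ} (hs : (x, s) ∈ D) (h0 : 0 < s) (hN : 0 < normalSpeed Ψ (x, s)) :
    HasDerivAt (fun s ↦ transitionJet k Ψ (x, s))
      (prolongation E (geodesicField k S) (√s, transitionJet k Ψ (x, s))) s := by
  set z : E × ℝ := (x, s) with hz
  have hc := contDiffAt_transitionState hk h hs h0
  have hc1 : ContDiffAt ℝ ∞ (fderiv ℝ (transitionState k Ψ)) z := hc.fderiv_right (by simp)
  have hline : HasDerivAt (fun s : ℝ ↦ (x, s)) (0, 1) s :=
    (hasDerivAt_const _ _).prodMk (hasDerivAt_id s)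
  have d1 : HasDerivAt (fun s : ℝ ↦ transitionState k Ψ (x, s))
      (fderiv ℝ (transitionState k Ψ) z (0, 1)) s :=
    (hc.differentiableAt (by simp)).hasFDerivAt.comp_hasDerivAt s hline
  have d2 : HasDerivAt (fun s : ℝ ↦ fderiv ℝ (transitionState k Ψ) (x, s))
      (fderiv ℝ (fderiv ℝ (transitionState k Ψ)) z (0, 1)) s :=
    (hc1.differentiableAt (by simp)).hasFDerivAt.comp_hasDerivAt s hline
  have d3 := d2.clm_comp (hasDerivAt_const s (ContinuousLinearMap.inl ℝ E ℝ))
  rw [fderiv_transitionState hk h hs h0 hN] at d1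
  refine (d1.prodMk d3).congr_deriv (Prod.ext rfl ?_)
  ext1 v
  simp only [ContinuousLinearMap.comp_zero, add_zero, ContinuousLinearMap.comp_apply,
    prolongation, fderiv_fderiv_comm hc (0, 1), ContinuousLinearMap.inl_apply, linearPart,
    ContinuousLinearMap.inr_apply, transitionJet, ← hz]
  have e1 : HasDerivAt (fun τ : ℝ ↦ fderiv ℝ (transitionState k Ψ) (z + τ • ((v, 0) : E × ℝ)) (0, 1))
      (fderiv ℝ (fderiv ℝ (transitionState k Ψ)) z (v, 0) (0, 1)) 0 := by
    simpa using (hasDerivAt_comp_line hc1 (v, 0)).clm_apply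
      (hasDerivAt_const (0 : ℝ) ((0, 1) : E × ℝ))
  have hO : (√s, transitionState k Ψ z) ∈ geodesicDomain k S := mem_geodesicDomain hk h hs h0 hN
  have hG : DifferentiableAt ℝ (geodesicField k S) (√s, transitionState k Ψ z) :=
    ((hk.contDiffOn_geodesicCoeff.clm_apply (by fun_prop)).contDiffAt
      (hk.isOpen_geodesicDomain.mem_nhds hO)).differentiableAt (by simp)
  have e2 : HasDerivAt (fun τ : ℝ ↦ geodesicField k S
      (√s, transitionState k Ψ (z + τ • ((v, 0) : E × ℝ))))
      (fderiv ℝ (geodesicField k S) (√s, transitionState k Ψ z)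
        (0, fderiv ℝ (transitionState k Ψ) z (v, 0))) 0 :=
    hG.hasFDerivAt.comp_hasDerivAt_of_eq (0 : ℝ) ((hasDerivAt_const _ _).prodMk
      (hasDerivAt_comp_line hc (v, 0))) (by simp)
  -- After exchanging the order of differentiation, the derivative of the state along `E` evolves by
  -- differentiating the geodesic equation itself, which holds on a whole neighbourhood of the
  -- point.
  refine e1.unique (e2.congr_of_eventuallyEq ?_)
  have hev : ∀ᶠ w in 𝓝 z, (w ∈ D ∧ 0 < w.2) ∧ 0 < normalSpeed Ψ w :=
    (show ∀ᶠ w in 𝓝 z, w ∈ D ∧ 0 < w.2 from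
      (isOpen_inter_pos_of_halfSpace h.exists_isOpen).mem_nhds ⟨hs, h0⟩).and
      ((h.contDiffAt_normalSpeed hs h0).continuousAt.eventually (lt_mem_nhds hN))
  have hc0 : Tendsto (fun τ : ℝ ↦ z + τ • ((v, 0) : E × ℝ)) (𝓝 0) (𝓝 z) :=
    (by fun_prop : Continuous fun τ : ℝ ↦ z + τ • ((v, 0) : E × ℝ)).tendsto' _ _ (by simp)
  filter_upwards [hc0.eventually hev] with τ hτ
  rw [fderiv_transitionState hk h hτ.1.1 hτ.1.2 hτ.2]
  simp [hz]

end IsTransition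

end InitialValues

/-! ### The stationary solution and its explicit first variation -/

section BaseSolution

variable {E : Type*} [NormedAddCommGroup E] [NormedSpace ℝ E]

/-- The stationary solution of the prolonged geodesic equation. -/
def baseJet (x : E) : GeodesicState E × (E →L[ℝ] GeodesicState E) :=
  ((0, x, 0), (0 : E →L[ℝ] ℝ).prod
    ((ContinuousLinearMap.id ℝ E).prod (0 : E →L[ℝ] E →L[ℝ] ℝ)))

/-- The vector field `∫_0^s τ κ(τ) df dτ`, where `κ` is the inverse of `k`. -/
def localField (k : E × ℝ → E →L[ℝ] E →L[ℝ] ℝ) (f : E → ℝ) (s : ℝ) (x : E) : E :=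
  ∫ τ in (0 : ℝ)..s, τ • inverseFamily k (x, τ) (fderiv ℝ f x)

/-- The derivative of `τ κ(τ) df` along `E`. -/
def localFieldDerivIntegrand (k : E × ℝ → E →L[ℝ] E →L[ℝ] ℝ) (S : Set (E × ℝ)) (f : E → ℝ)
    (x : E) (τ : ℝ) : E →L[ℝ] E :=
  τ • (((fderivWithin ℝ (inverseFamily k) S (x, τ)).comp (ContinuousLinearMap.inl ℝ E ℝ)).flip
      (fderiv ℝ f x) + (inverseFamily k (x, τ)).comp (fderiv ℝ (fderiv ℝ f) x))

/-- The derivative of `localField` along `E`. -/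
def localFieldDeriv (k : E × ℝ → E →L[ℝ] E →L[ℝ] ℝ) (S : Set (E × ℝ)) (f : E → ℝ) (s : ℝ)
    (x : E) : E →L[ℝ] E :=
  ∫ τ in (0 : ℝ)..s, localFieldDerivIntegrand k S f x τ

/-- The first variation of the stationary solution. -/
def variationJet (k : E × ℝ → E →L[ℝ] E →L[ℝ] ℝ) (S : Set (E × ℝ)) (f : E → ℝ) (x : E) (s : ℝ) :
    GeodesicState E × (E →L[ℝ] GeodesicState E) :=
  ((-f x, localField k f s x, fderiv ℝ f x),
    (-fderiv ℝ f x).prod ((localFieldDeriv k S f s x).prod (fderiv ℝ (fderiv ℝ f) x)))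

variable [FiniteDimensional ℝ E] {k : E × ℝ → E →L[ℝ] E →L[ℝ] ℝ} {S : Set (E × ℝ)} {f : E → ℝ}

lemma initialJet_const_mul (t : ℝ) (x : E) :
    initialJet (fun y ↦ t * f y) x = baseJet x + t • variationJet k S f x 0 := by
  have h1 : fderiv ℝ (fun y ↦ t * f y) = t • fderiv ℝ f := fderiv_const_smul_field (𝕜 := ℝ) t
  have h2 : fderiv ℝ (t • fderiv ℝ f) x = t • fderiv ℝ (fderiv ℝ f) x :=
    congrFun (fderiv_const_smul_field (𝕜 := ℝ) t) x
  simp only [initialJet, baseJet, variationJet, localField, localFieldDeriv,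
    intervalIntegral.integral_same, h1, h2]
  refine Prod.ext (Prod.ext ?_ (Prod.ext ?_ ?_)) ?_
  · simp
  · simp
  · simp
  · ext v <;> simp

lemma footPoint_base (σ : ℝ) (x : E) : footPoint (σ, (0, x, (0 : E →L[ℝ] ℝ))) = (x, σ ^ 2) := by
  simp [footPoint]

lemma mem_geodesicDomain_base {σ : ℝ} {x : E} (h : (x, σ ^ 2) ∈ S) :
    (σ, (baseJet x).1) ∈ geodesicDomain k S := by
  refine ⟨?_, ?_⟩
  · change footPoint (σ, (0, x, (0 : E →L[ℝ] ℝ))) ∈ S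
    rwa [footPoint_base]
  · simp [normalSq, stateSharp, baseJet]

lemma geodesicCoeff_base (σ : ℝ) (x : E) (α : E →L[ℝ] ℝ) :
    geodesicCoeff k S (σ, (0, x, 0)) α = (0, σ ^ 2 • inverseFamily k (x, σ ^ 2) α, 0) := by
  simp [geodesicCoeff, stateSharp, footPoint_base, footFactor]

namespace IsMetricFamily

/-- Moving only the base point keeps `W = 0` and `η = 0`, and along such states the coefficients
reduce to `s` times the inverse metric. -/
lemma fderiv_geodesicCoeff_base (hk : IsMetricFamily k S) {σ : ℝ} {x : E} (h : (x, σ ^ 2) ∈ S)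
    (e : E) (α : E →L[ℝ] ℝ) :
    fderiv ℝ (geodesicCoeff k S) (σ, (baseJet x).1) (0, (0, e, 0)) α =
      (0, σ ^ 2 • fderivWithin ℝ (inverseFamily k) S (x, σ ^ 2) (e, 0) α, 0) := by
  have hB : DifferentiableAt ℝ (geodesicCoeff k S) (σ, (baseJet x).1) :=
    (hk.contDiffOn_geodesicCoeff.contDiffAt (hk.isOpen_geodesicDomain.mem_nhds
      (mem_geodesicDomain_base h))).differentiableAt (by simp)
  have hl : HasDerivAt (fun τ : ℝ ↦ (σ, ((0 : ℝ), x + τ • e, (0 : E →L[ℝ] ℝ)))) (0, (0, e, 0)) 0 := by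
    have : HasDerivAt (fun τ : ℝ ↦ x + τ • e) e 0 := by
      simpa using ((hasDerivAt_id (0 : ℝ)).smul_const e).const_add x
    exact (hasDerivAt_const _ _).prodMk ((hasDerivAt_const _ _).prodMk
      (this.prodMk (hasDerivAt_const _ _)))
  have h1 := (hB.hasFDerivAt.comp_hasDerivAt_of_eq (0 : ℝ) hl (by simp [baseJet])).clm_apply
    (hasDerivAt_const (0 : ℝ) α)
  have h2 : HasDerivAt (fun τ : ℝ ↦ inverseFamily k (x + τ • e, σ ^ 2))
      (fderivWithin ℝ (inverseFamily k) S (x, σ ^ 2) (e, 0)) 0 := by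
    have : HasDerivAt (fun τ : ℝ ↦ x + τ • e) e 0 := by
      simpa using ((hasDerivAt_id (0 : ℝ)).smul_const e).const_add x
    exact (hasFDerivAt_slice hk.exists_isOpen
      hk.contDiffOn_inverseFamily h).comp_hasDerivAt_of_eq (0 : ℝ) this (by simp)
  have h3 : HasDerivAt (fun τ : ℝ ↦ ((0 : ℝ), σ ^ 2 • inverseFamily k (x + τ • e, σ ^ 2) α,
      (0 : E →L[ℝ] ℝ)))
      (0, σ ^ 2 • fderivWithin ℝ (inverseFamily k) S (x, σ ^ 2) (e, 0) α, 0) 0 := by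
    refine (hasDerivAt_const _ _).prodMk (HasDerivAt.prodMk ?_ (hasDerivAt_const _ _))
    simpa using (h2.clm_apply (hasDerivAt_const (0 : ℝ) α)).fun_const_smul (σ ^ 2)
  have h4 := h1.unique (h3.congr_of_eventuallyEq (Eventually.of_forall fun τ ↦ by
    exact geodesicCoeff_base σ (x + τ • e) α))
  simpa using h4

lemma contDiffOn_geodesicField (hk : IsMetricFamily k S) :
    ContDiffOn ℝ ∞ (geodesicField k S) (geodesicDomain k S) :=
  hk.contDiffOn_geodesicCoeff.clm_apply (by fun_prop)

lemma prolongation_base (hk : IsMetricFamily k S) {σ : ℝ} {x : E} (h : (x, σ ^ 2) ∈ S) :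
    prolongation E (geodesicField k S) (σ, baseJet x) = 0 := by
  have hB : DifferentiableAt ℝ (geodesicCoeff k S) (σ, (baseJet x).1) :=
    (hk.contDiffOn_geodesicCoeff.contDiffAt (hk.isOpen_geodesicDomain.mem_nhds
      (mem_geodesicDomain_base h))).differentiableAt (by simp)
  refine Prod.ext ?_ ?_
  · simp [prolongation, geodesicField, baseJet]
  · ext1 e
    have := fderiv_clm_apply_snd ((ContinuousLinearMap.snd ℝ E (E →L[ℝ] ℝ)).comp
      (ContinuousLinearMap.snd ℝ ℝ (E × (E →L[ℝ] ℝ)))) hB (0, (0, e, 0))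
    change fderiv ℝ (geodesicField k S) (σ, (baseJet x).1) (0, (0, e, 0)) = 0
    refine this.trans ?_
    simp [baseJet]

/-- At `η = 0` the `W` and `η` rows of `B` are themselves proportional to `η^♯` and vanish; only the
`y` row survives. Hence the first variation is obtained by a single integration. -/
lemma linearPart_base (hk : IsMetricFamily k S) {s : ℝ} (hs : 0 ≤ s) {x : E} (h : (x, s) ∈ S) :
    linearPart (prolongation E (geodesicField k S)) (baseJet x) (√s) (variationJet k S f x s)
      = ((0, s • inverseFamily k (x, s) (fderiv ℝ f x), 0),
        (0 : E →L[ℝ] ℝ).prod ((localFieldDerivIntegrand k S f x s).prod 0)) := by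
  have h' : (x, √s ^ 2) ∈ S := by rwa [Real.sq_sqrt hs]
  refine (linearPart_prolongation hk.isOpen_geodesicDomain hk.contDiffOn_geodesicCoeff
    ((ContinuousLinearMap.snd ℝ E (E →L[ℝ] ℝ)).comp (ContinuousLinearMap.snd ℝ ℝ (E × (E →L[ℝ] ℝ))))
    (mem_geodesicDomain_base h') rfl (fun _ ↦ rfl) (variationJet k S f x s)).trans ?_
  have hc : ∀ α, geodesicCoeff k S (√s, (baseJet x).1) α
      = (0, s • inverseFamily k (x, s) α, 0) := fun α ↦ by
    have := geodesicCoeff_base (k := k) (S := S) (√s) x α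
    rwa [Real.sq_sqrt hs] at this
  have hd : ∀ (e : E) (α : E →L[ℝ] ℝ),
      fderiv ℝ (geodesicCoeff k S) (√s, (baseJet x).1) (0, (0, e, 0)) α =
      (0, s • fderivWithin ℝ (inverseFamily k) S (x, s) (e, 0) α, 0) := fun e α ↦ by
    have := hk.fderiv_geodesicCoeff_base h' e α
    rwa [Real.sq_sqrt hs] at this
  refine Prod.ext (hc _) ?_
  ext1 e
  change fderiv ℝ (geodesicCoeff k S) (√s, (baseJet x).1) (0, (0, e, 0)) (fderiv ℝ f x)
    + geodesicCoeff k S (√s, (baseJet x).1) (fderiv ℝ (fderiv ℝ f) x e) = _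
  rw [hc, hd]
  simp [localFieldDerivIntegrand]

lemma continuousOn_slice {V : Type*} [TopologicalSpace V] {g : E × ℝ → V} (hg : ContinuousOn g S)
    {x : E} {r : ℝ} (h : ∀ s ∈ Icc 0 r, (x, s) ∈ S) : ContinuousOn (fun s ↦ g (x, s)) (Icc 0 r) :=
  hg.comp (by fun_prop) h

lemma continuousOn_localField_integrand (hk : IsMetricFamily k S) {x : E} {r : ℝ}
    (h : ∀ s ∈ Icc 0 r, (x, s) ∈ S) :
    ContinuousOn (fun τ ↦ τ • inverseFamily k (x, τ) (fderiv ℝ f x)) (Icc 0 r) :=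
  continuousOn_id.smul ((continuousOn_slice hk.contDiffOn_inverseFamily.continuousOn h).clm_apply
    continuousOn_const)

lemma continuousOn_localFieldDerivIntegrand (hk : IsMetricFamily k S) {x : E} {r : ℝ}
    (h : ∀ s ∈ Icc 0 r, (x, s) ∈ S) :
    ContinuousOn (localFieldDerivIntegrand k S f x) (Icc 0 r) := by
  have hd : ContinuousOn (fderivWithin ℝ (inverseFamily k) S) S :=
    hk.contDiffOn_inverseFamily.continuousOn_fderivWithin hk.uniqueDiffOn (by simp)
  refine continuousOn_id.smul (ContinuousOn.add ?_ ?_)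
  · refine continuousOn_clm_apply.2 fun e ↦ ?_
    exact ((continuousOn_slice hd h).clm_apply continuousOn_const).clm_apply continuousOn_const
  · exact (continuousOn_slice hk.contDiffOn_inverseFamily.continuousOn h).clm_comp
      continuousOn_const

lemma _root_.AHMetric.continuousOn_hasDerivAt_primitive {V : Type*} [NormedAddCommGroup V]
    [NormedSpace ℝ V] [CompleteSpace V] {g : ℝ → V} {r : ℝ} (hr : 0 ≤ r)
    (hg : ContinuousOn g (Icc 0 r)) :
    ContinuousOn (fun s ↦ ∫ τ in (0 : ℝ)..s, g τ) (Icc 0 r) ∧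
      ∀ s ∈ Ioo 0 r, HasDerivAt (fun s ↦ ∫ τ in (0 : ℝ)..s, g τ) (g s) s := by
  constructor
  · have := intervalIntegral.continuousOn_primitive_interval (μ := MeasureTheory.volume)
      (f := g) (a := 0) (b := r) (by
        rw [uIcc_of_le hr]; exact hg.integrableOn_Icc)
    rwa [uIcc_of_le hr] at this
  · intro s hs
    refine intervalIntegral.integral_hasDerivAt_right ?_ ?_ ?_
    · refine ContinuousOn.intervalIntegrable ?_
      rw [uIcc_of_le hs.1.le]
      exact hg.mono (Icc_subset_Icc_right hs.2.le)
    · exact (hg.mono Ioo_subset_Icc_self).stronglyMeasurableAtFilter isOpen_Ioo s hs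
    · exact hg.continuousAt (Icc_mem_nhds hs.1 hs.2)

lemma continuousOn_variationJet (hk : IsMetricFamily k S) {x : E} {r : ℝ} (hr : 0 ≤ r)
    (h : ∀ s ∈ Icc 0 r, (x, s) ∈ S) : ContinuousOn (variationJet k S f x) (Icc 0 r) := by
  have : CompleteSpace E := FiniteDimensional.complete ℝ E
  refine ContinuousOn.prodMk (ContinuousOn.prodMk continuousOn_const (ContinuousOn.prodMk
    (continuousOn_hasDerivAt_primitive hr (hk.continuousOn_localField_integrand h)).1
    continuousOn_const)) ?_
  refine continuousOn_clm_apply.2 fun e ↦ ContinuousOn.prodMk continuousOn_const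
    (ContinuousOn.prodMk ?_ continuousOn_const)
  exact (continuousOn_hasDerivAt_primitive hr
    (hk.continuousOn_localFieldDerivIntegrand h)).1.clm_apply continuousOn_const

lemma hasDerivAt_variationJet (hk : IsMetricFamily k S) {x : E} {r : ℝ} (hr : 0 ≤ r)
    (h : ∀ s ∈ Icc 0 r, (x, s) ∈ S) {s : ℝ} (hs : s ∈ Ioo 0 r) :
    HasDerivAt (variationJet k S f x)
      (linearPart (prolongation E (geodesicField k S)) (baseJet x) (√s)
        (variationJet k S f x s)) s := by
  have : CompleteSpace E := FiniteDimensional.complete ℝ E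
  rw [hk.linearPart_base hs.1.le (h s (Ioo_subset_Icc_self hs))]
  refine HasDerivAt.prodMk ((hasDerivAt_const _ _).prodMk (HasDerivAt.prodMk
    ((continuousOn_hasDerivAt_primitive hr (hk.continuousOn_localField_integrand h)).2 s hs)
    (hasDerivAt_const _ _))) ?_
  have h1 := (continuousOn_hasDerivAt_primitive hr
    (hk.continuousOn_localFieldDerivIntegrand (f := f) h)).2 s hs
  -- Only the `y` slot of the derivative depends on `s`; splitting it off through this inclusion
  -- leaves a constant.
  set ι : E →L[ℝ] GeodesicState E := (ContinuousLinearMap.inr ℝ ℝ (E × (E →L[ℝ] ℝ))).comp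
    (ContinuousLinearMap.inl ℝ E (E →L[ℝ] ℝ)) with hι
  have e1 : ∀ (p : E →L[ℝ] ℝ) (L : E →L[ℝ] E) (q : E →L[ℝ] E →L[ℝ] ℝ),
      p.prod (L.prod q) = p.prod ((0 : E →L[ℝ] E).prod q) + ι.comp L := fun p L q ↦ by
    ext v <;> simp [hι]
  have h2 := ((hasDerivAt_const s ι).clm_comp h1).const_add
    ((-fderiv ℝ f x).prod ((0 : E →L[ℝ] E).prod (fderiv ℝ (fderiv ℝ f) x)))
  refine (h2.congr_of_eventuallyEq (Eventually.of_forall fun s ↦ e1 _ _ _)).congr_deriv ?_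
  rw [e1]
  ext v <;> simp

end IsMetricFamily

end BaseSolution

/-! ### Continuation of the transition map along a whole curve -/

section Continuation

variable {E : Type*} [NormedAddCommGroup E] [NormedSpace ℝ E] [FiniteDimensional ℝ E]
  {k k' : E × ℝ → E →L[ℝ] E →L[ℝ] ℝ} {S D : Set (E × ℝ)} {Ψ : E × ℝ → E × ℝ} {f : E → ℝ}

/-- The jet of the transition along the curve through `x`, with its initial value added. -/
def jetCurve (k : E × ℝ → E →L[ℝ] E →L[ℝ] ℝ) (Ψ : E × ℝ → E × ℝ) (f : E → ℝ) (x : E) (s : ℝ) :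
    GeodesicState E × (E →L[ℝ] GeodesicState E) :=
  Function.update (fun s ↦ transitionJet k Ψ (x, s)) 0 (initialJet f x) s

omit [FiniteDimensional ℝ E] in
lemma jetCurve_zero (x : E) : jetCurve k Ψ f x 0 = initialJet f x := by simp [jetCurve]

omit [FiniteDimensional ℝ E] in
lemma jetCurve_of_ne {x : E} {s : ℝ} (hs : s ≠ 0) :
    jetCurve k Ψ f x s = transitionJet k Ψ (x, s) := by simp [jetCurve, hs]

namespace IsTransition

lemma hasDerivAt_jetCurve (hk : IsMetricFamily k S) (h : IsTransition k S k' D Ψ f) {x : E}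
    {s : ℝ} (hs : (x, s) ∈ D) (h0 : 0 < s) (hN : 0 < normalSpeed Ψ (x, s)) :
    HasDerivAt (jetCurve k Ψ f x)
      (prolongation E (geodesicField k S) (√s, jetCurve k Ψ f x s)) s := by
  rw [jetCurve_of_ne h0.ne']
  refine (hasDerivAt_transitionJet hk h hs h0 hN).congr_of_eventuallyEq ?_
  filter_upwards [lt_mem_nhds h0] with u hu using jetCurve_of_ne hu.ne'

lemma tendsto_jetCurve (hk : IsMetricFamily k S) (h : IsTransition k S k' D Ψ f) [Nontrivial E]
    {x : E} (hx : (x, (0 : ℝ)) ∈ D) (hf : ContDiffAt ℝ ∞ f x) :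
    Tendsto (jetCurve k Ψ f x) (𝓝[>] 0) (𝓝 (initialJet f x)) := by
  refine (tendsto_normalSpeed_and_transitionJet hk h hx hf).2.congr' ?_
  filter_upwards [self_mem_nhdsWithin] with u hu
  exact (jetCurve_of_ne (ne_of_gt hu)).symm

lemma continuousOn_jetCurve (hk : IsMetricFamily k S) (h : IsTransition k S k' D Ψ f) [Nontrivial E]
    {x : E} (hx : (x, (0 : ℝ)) ∈ D) (hf : ContDiffAt ℝ ∞ f x) {r : ℝ}
    (hgood : ∀ s ∈ Ioc 0 r, (x, s) ∈ D ∧ 0 < normalSpeed Ψ (x, s)) :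
    ContinuousOn (jetCurve k Ψ f x) (Icc 0 r) := by
  intro s hs
  rcases hs.1.eq_or_lt with rfl | h0
  · have h1 : ContinuousWithinAt (jetCurve k Ψ f x) (Ioi 0) 0 := by
      rw [ContinuousWithinAt, jetCurve_zero]
      exact tendsto_jetCurve hk h hx hf
    exact (continuousWithinAt_Ioi_iff_Ici.1 h1).mono Icc_subset_Ici_self
  · exact (hasDerivAt_jetCurve hk h (hgood s ⟨h0, hs.2⟩).1 h0
      (hgood s ⟨h0, hs.2⟩).2).continuousAt.continuousWithinAt

lemma isCompact_footPoint_image (x : E) (r δ : ℝ) :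
    IsCompact (footPoint '' (Icc 0 (√r) ×ˢ Metric.closedBall (baseJet x).1 δ)) := by
  have : ProperSpace (GeodesicState E) := FiniteDimensional.proper_real _
  exact (isCompact_Icc.prod (isCompact_closedBall _ _)).image contDiff_footPoint.continuous

/-- The transition map exists along the whole curve through `x` if its initial values are close to
those of the identity. -/
lemma mem_and_norm_jetCurve_sub_le (hk : IsMetricFamily k S) (h : IsTransition k S k' D Ψ f)
    [Nontrivial E] {x : E} (hx : (x, (0 : ℝ)) ∈ D) (hf : ContDiffAt ℝ ∞ f x) {r : ℝ}
    (hcl : ∀ K ⊆ S, IsCompact K → IsClosed {s | s ∈ Icc 0 r ∧ (x, s) ∈ D ∧ Ψ (x, s) ∈ K})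
    {δ ε C : ℝ} (hC : 0 ≤ C) (hε : 0 ≤ ε)
    (hδ : ∀ σ ∈ Icc 0 (√r), ∀ v, ‖v - baseJet x‖ ≤ δ → (σ, v.1) ∈ geodesicDomain k S ∧
      ‖prolongation E (geodesicField k S) (σ, v)
        - linearPart (prolongation E (geodesicField k S)) (baseJet x) σ (v - baseJet x)‖
        ≤ ε * ‖v - baseJet x‖)
    (hΛ : ∀ σ ∈ Icc 0 (√r),
      ‖linearPart (prolongation E (geodesicField k S)) (baseJet x) σ‖ ≤ C)
    (hsmall : ‖initialJet f x - baseJet x‖ * Real.exp ((C + ε) * r) < δ) {s : ℝ}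
    (hs : s ∈ Ioc 0 r) :
    (x, s) ∈ D ∧ 0 < normalSpeed Ψ (x, s) ∧ ‖jetCurve k Ψ f x s - baseJet x‖ ≤ δ := by
  set Z := jetCurve k Ψ f x with hZ
  have hsq : ∀ s ∈ Icc 0 r, √s ∈ Icc 0 (√r) := fun s hs ↦ ⟨Real.sqrt_nonneg s, Real.sqrt_le_sqrt hs.2⟩
  -- Bootstrap with weak inequalities, which pass to limits. The strict forms are recovered a
  -- posteriori: `N ≠ 0` because `N²` is positive on the geodesic domain, and distance `< δ` by
  -- Grönwall and `hsmall`.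
  let P : ℝ → Prop := fun s ↦ s = 0 ∨
    ((x, s) ∈ D ∧ 0 ≤ normalSpeed Ψ (x, s) ∧ ‖Z s - baseJet x‖ ≤ δ)
  have hNpos : ∀ s ∈ Ioc 0 r, P s → 0 < normalSpeed Ψ (x, s) := by
    intro s hs hP
    obtain ⟨hD, hN, hd⟩ := hP.resolve_left hs.1.ne'
    have h1 := (hδ (√s) (hsq s (Ioc_subset_Icc_self hs)) _ hd).1.2
    rw [hZ, jetCurve_of_ne hs.1.ne'] at h1
    have h2 := normalSq_transitionState hk h hD hs.1
    refine lt_of_le_of_ne hN fun h0 ↦ ?_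
    have h1' : 0 < normalSq k (√s, transitionState k Ψ (x, s)) := h1
    change normalSq k (√s, transitionState k Ψ (x, s)) = _ at h2
    rw [h2, ← h0] at h1'
    simp at h1'
  have hlt : ∀ s ∈ Icc 0 r, (∀ τ ∈ Icc 0 s, P τ) → ‖Z s - baseJet x‖ < δ := by
    intro s hs hP
    have hgood : ∀ τ ∈ Ioc 0 s, (x, τ) ∈ D ∧ 0 < normalSpeed Ψ (x, τ) := fun τ hτ ↦
      ⟨((hP τ (Ioc_subset_Icc_self hτ)).resolve_left hτ.1.ne').1,
        hNpos τ ⟨hτ.1, hτ.2.trans hs.2⟩ (hP τ (Ioc_subset_Icc_self hτ))⟩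
    have h1 := norm_sub_le_of_linearization (Z := Z) (v₀ := baseJet x)
      (Λ := fun s ↦ linearPart (prolongation E (geodesicField k S)) (baseJet x) (√s))
      (C := C) (ε := ε) (r := s) (continuousOn_jetCurve hk h hx hf hgood)
      (fun τ hτ ↦ hasDerivAt_jetCurve hk h (hgood τ (Ioo_subset_Ioc_self hτ)).1 hτ.1
        (hgood τ (Ioo_subset_Ioc_self hτ)).2)
      (fun τ hτ ↦ hΛ _ (hsq τ ⟨hτ.1.le, hτ.2.le.trans hs.2⟩))
      (fun τ hτ ↦ (hδ _ (hsq τ ⟨hτ.1.le, hτ.2.le.trans hs.2⟩) _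
        ((hP τ (Ioo_subset_Icc_self hτ)).resolve_left hτ.1.ne').2.2).2)
      (s := s) ⟨hs.1, le_rfl⟩
    refine h1.trans_lt (lt_of_le_of_lt ?_ hsmall)
    rw [hZ, jetCurve_zero]
    refine mul_le_mul_of_nonneg_left (Real.exp_le_exp.2 ?_) (norm_nonneg _)
    exact mul_le_mul_of_nonneg_left hs.2 (by positivity)
  have hopen : ∀ s ∈ Ico 0 r, (∀ τ ∈ Icc 0 s, P τ) → ∀ᶠ τ in 𝓝[>] s, P τ := by
    intro s hs hP
    have hls := hlt s ⟨hs.1, hs.2.le⟩ hP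
    rcases hs.1.eq_or_lt with rfl | h0
    · obtain ⟨t1, -⟩ := tendsto_normalSpeed_and_transitionJet hk h hx hf
      have t2 := ((tendsto_jetCurve hk h hx hf).sub_const (baseJet x)).norm
      rw [hZ, jetCurve_zero] at hls
      filter_upwards [eventually_mem_halfSpace h.exists_isOpen hx,
        t1.eventually (lt_mem_nhds one_pos), t2.eventually (gt_mem_nhds hls)] with τ h1 h2 h3
      exact Or.inr ⟨h1, h2.le, h3.le⟩
    · have hsD := ((hP s ⟨hs.1, le_rfl⟩).resolve_left h0.ne').1
      have hN := hNpos s ⟨h0, hs.2.le⟩ (hP s ⟨hs.1, le_rfl⟩)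
      have hcurve : ContinuousAt (fun s : ℝ ↦ (x, s)) s := by fun_prop
      have c1 := hcurve.eventually (h.mem_nhds hsD h0)
      have c2 : ∀ᶠ τ in 𝓝 s, 0 < normalSpeed Ψ (x, τ) := hcurve.eventually
        ((h.contDiffAt_normalSpeed hsD h0).continuousAt.eventually (lt_mem_nhds hN))
      have c3 : ∀ᶠ τ in 𝓝 s, ‖Z τ - baseJet x‖ < δ :=
        (((hasDerivAt_jetCurve hk h hsD h0 hN).continuousAt.sub continuousAt_const).norm).eventually
          (gt_mem_nhds hls)
      filter_upwards [nhdsWithin_le_nhds c1, nhdsWithin_le_nhds c2, nhdsWithin_le_nhds c3]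
        with τ h1 h2 h3
      exact Or.inr ⟨h1, h2.le, h3.le⟩
  have hclosed : ∀ s ∈ Ioc 0 r, (∀ τ ∈ Ico 0 s, P τ) → P s := by
    intro s hs hP
    -- While the jet stays `δ`-close to the base, `Ψ (x, τ)` remains in this fixed compact subset of
    -- `S`. The hypothesis `hcl` then prevents the curve from leaving the domain at the limit time.
    set K := footPoint '' (Icc 0 (√r) ×ˢ Metric.closedBall (baseJet x).1 δ) with hK
    have hKS : K ⊆ S := by
      rintro _ ⟨⟨σ, z⟩, ⟨hσ, hz⟩, rfl⟩
      have hz' : ‖(z, (baseJet x).2) - baseJet x‖ ≤ δ := by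
        rw [Prod.norm_def]
        simpa [dist_eq_norm] using hz
      exact (hδ σ hσ _ hz').1.1
    have hmemK : ∀ τ ∈ Ioo 0 s, (x, τ) ∈ D ∧ Ψ (x, τ) ∈ K := by
      intro τ hτ
      obtain ⟨hD, hN, hd⟩ := (hP τ ⟨hτ.1.le, hτ.2⟩).resolve_left hτ.1.ne'
      refine ⟨hD, ⟨(√τ, transitionState k Ψ (x, τ)),
        ⟨hsq τ ⟨hτ.1.le, hτ.2.le.trans hs.2⟩, ?_⟩, h.footPoint_transitionState hD hτ.1⟩⟩
      rw [Metric.mem_closedBall, dist_eq_norm]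
      rw [hZ, jetCurve_of_ne hτ.1.ne'] at hd
      exact (norm_fst_le (transitionJet k Ψ (x, τ) - baseJet x)).trans hd
    have hev : ∀ᶠ τ in 𝓝[<] s, τ ∈ Ioo 0 s := Ioo_mem_nhdsLT hs.1
    have hsK := (hcl K hKS (isCompact_footPoint_image x r δ)).mem_of_tendsto
      (tendsto_nhdsWithin_of_tendsto_nhds tendsto_id : Tendsto id (𝓝[<] s) (𝓝 s)) (by
        filter_upwards [hev] with τ hτ
        exact ⟨⟨hτ.1.le, hτ.2.le.trans hs.2⟩, hmemK τ hτ⟩)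
    have hsD := hsK.2.1
    have hcurve : Tendsto (fun s : ℝ ↦ (x, s)) (𝓝[<] s) (𝓝 (x, s)) :=
      ((by fun_prop : Continuous fun s : ℝ ↦ (x, s)).tendsto s).mono_left nhdsWithin_le_nhds
    have l1 := (h.contDiffAt_normalSpeed hsD hs.1).continuousAt.tendsto.comp hcurve
    have hZc : Tendsto Z (𝓝[<] s) (𝓝 (Z s)) := by
      have hc1 := contDiffAt_transitionState hk h hsD hs.1
      have hc2 : ContinuousAt (transitionJet k Ψ) (x, s) :=
        hc1.continuousAt.prodMk (((hc1.fderiv_right (m := ∞) (by simp)).continuousAt).clm_comp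
          continuousAt_const)
      rw [hZ, jetCurve_of_ne hs.1.ne']
      refine (hc2.tendsto.comp hcurve).congr' ?_
      filter_upwards [hev] with τ hτ using (jetCurve_of_ne hτ.1.ne').symm
    refine Or.inr ⟨hsD, ge_of_tendsto l1 ?_, le_of_tendsto (hZc.sub_const (baseJet x)).norm ?_⟩
    · filter_upwards [hev] with τ hτ
      exact ((hP τ ⟨hτ.1.le, hτ.2⟩).resolve_left hτ.1.ne').2.1
    · filter_upwards [hev] with τ hτ
      exact ((hP τ ⟨hτ.1.le, hτ.2⟩).resolve_left hτ.1.ne').2.2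
  have hr : 0 < r := hs.1.trans_le hs.2
  let T : Set ℝ := {s | ∀ τ ∈ Icc 0 s, P τ}
  have hTcl : IsClosed (T ∩ Icc 0 r) := by
    refine isClosed_of_closure_subset fun s hsc ↦ ?_
    have hsI : s ∈ Icc 0 r := isClosed_Icc.closure_subset_iff.2 inter_subset_right hsc
    have hbelow : ∀ τ ∈ Ico 0 s, P τ := by
      intro τ hτ
      obtain ⟨u, hu1, hu2⟩ := mem_closure_iff.1 hsc (Ioi τ) isOpen_Ioi hτ.2
      exact hu2.1 τ ⟨hτ.1, le_of_lt hu1⟩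
    refine ⟨fun τ hτ ↦ ?_, hsI⟩
    rcases hτ.2.lt_or_eq with h1 | rfl
    · exact hbelow τ ⟨hτ.1, h1⟩
    · rcases hτ.1.eq_or_lt with h2 | h2
      · exact Or.inl h2.symm
      · exact hclosed τ ⟨h2, hsI.2⟩ hbelow
  -- The good initial segments form a closed set from which one can always move to the right, so
  -- they exhaust the interval.
  have hT : Icc 0 r ⊆ T := by
    refine hTcl.Icc_subset_of_forall_exists_gt ?_ ?_
    · intro τ hτ
      exact Or.inl (le_antisymm hτ.2 hτ.1)
    · rintro s ⟨hsT, hsI⟩ y hy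
      have hev : ∀ᶠ τ in 𝓝[>] s, P τ ∧ τ ≤ y := by
        filter_upwards [hopen s hsI hsT, Ioc_mem_nhdsGT hy] with τ h1 h2 using ⟨h1, h2.2⟩
      obtain ⟨u, hu, hus⟩ := (mem_nhdsGT_iff_exists_Ioc_subset).1 hev
      refine ⟨u, fun τ hτ ↦ ?_, hu, (hus ⟨hu, le_rfl⟩).2⟩
      rcases le_or_gt τ s with h1 | h1
      · exact hsT τ ⟨hτ.1, h1⟩
      · exact (hus ⟨h1, hτ.2⟩).1
  have hPs := hT (Ioc_subset_Icc_self hs) s ⟨hs.1.le, le_rfl⟩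
  obtain ⟨h1, -, h3⟩ := hPs.resolve_left hs.1.ne'
  exact ⟨h1, hNpos s hs hPs, h3⟩

end IsTransition

end Continuation

/-! ### First variation of the jets and of the metric -/

section Variation

variable {E : Type*} [NormedAddCommGroup E] [NormedSpace ℝ E] [FiniteDimensional ℝ E]
  {k : E × ℝ → E →L[ℝ] E →L[ℝ] ℝ} {S : Set (E × ℝ)}

/-- The first variation of the jets of a family of transition maps. -/
lemma hasDerivAt_transitionJet_parameter (hk : IsMetricFamily k S) [Nontrivial E]
    {kt : ℝ → E × ℝ → E →L[ℝ] E →L[ℝ] ℝ} {D : ℝ → Set (E × ℝ)} {Ψ : ℝ → E × ℝ → E × ℝ}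
    {f : E → ℝ} (h : ∀ᶠ t in 𝓝 0, IsTransition k S (kt t) (D t) (Ψ t) (fun y ↦ t * f y))
    {x : E} (hx : ∀ᶠ t in 𝓝 0, (x, (0 : ℝ)) ∈ D t) (hf : ContDiffAt ℝ ∞ f x) {r : ℝ} (hr : 0 < r)
    (hS : ∀ s ∈ Icc 0 r, (x, s) ∈ S)
    (hcl : ∀ᶠ t in 𝓝 0, ∀ K ⊆ S, IsCompact K →
      IsClosed {s | s ∈ Icc 0 r ∧ (x, s) ∈ D t ∧ Ψ t (x, s) ∈ K}) :
    (∀ᶠ t in 𝓝 0, (x, r) ∈ D t) ∧ transitionJet k (Ψ 0) (x, r) = baseJet x ∧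
      HasDerivAt (fun t ↦ transitionJet k (Ψ t) (x, r)) (variationJet k S f x r) 0 := by
  set F := prolongation E (geodesicField k S) with hF
  set O : Set (ℝ × (GeodesicState E × (E →L[ℝ] GeodesicState E))) :=
    {p | (p.1, p.2.1) ∈ geodesicDomain k S} with hO
  have hOo : IsOpen O := hk.isOpen_geodesicDomain.preimage (by fun_prop)
  have hFc : ContDiffOn ℝ 1 F O :=
    (contDiffOn_prolongation hk.isOpen_geodesicDomain hk.contDiffOn_geodesicField).of_le (by simp)
  have hmem : ∀ σ ∈ Icc 0 (√r), (x, σ ^ 2) ∈ S := fun σ hσ ↦ hS _ ⟨sq_nonneg σ, by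
    have := pow_le_pow_left₀ hσ.1 hσ.2 2
    rwa [Real.sq_sqrt hr.le] at this⟩
  have hbase : ∀ σ ∈ Icc 0 (√r), (σ, baseJet x) ∈ O := fun σ hσ ↦
    mem_geodesicDomain_base (hmem σ hσ)
  obtain ⟨C, hC⟩ := isCompact_Icc.exists_bound_of_continuousOn
    (continuousOn_linearPart hOo hFc hbase)
  have hC0 : 0 ≤ C := (norm_nonneg _).trans (hC 0 ⟨le_rfl, Real.sqrt_nonneg r⟩)
  set a := variationJet k S f x 0 with ha
  -- `M` must not depend on `ε`; the factor `C + 1` comes from restricting to `ε ≤ 1`.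
  set M := ‖a‖ * Real.exp ((C + 1) * r) * r * Real.exp (C * r) with hM
  have hM0 : 0 ≤ M := by positivity
  have key : ∀ ε > 0, ε ≤ 1 → ∀ᶠ t in 𝓝 (0 : ℝ), (x, r) ∈ D t ∧
      ‖transitionJet k (Ψ t) (x, r) - baseJet x - t • variationJet k S f x r‖
        ≤ ε * |t| * M := by
    intro ε hε hε1
    obtain ⟨δ, hδ, hlin⟩ := eventually_norm_sub_linearPart_le hOo hFc hbase
      (fun σ hσ ↦ hk.prolongation_base (hmem σ hσ)) hε
    have hsm : ∀ᶠ t in 𝓝 (0 : ℝ), ‖t • a‖ * Real.exp ((C + ε) * r) < δ := by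
      have : Tendsto (fun t : ℝ ↦ ‖t • a‖ * Real.exp ((C + ε) * r)) (𝓝 0) (𝓝 0) :=
        (by fun_prop : Continuous fun t : ℝ ↦ ‖t • a‖ * Real.exp ((C + ε) * r)).tendsto' _ _
          (by simp)
      exact this.eventually (gt_mem_nhds hδ)
    filter_upwards [hsm, h, hx, hcl] with t ht h1 h2 h3
    have hft : ContDiffAt ℝ ∞ (fun y ↦ t * f y) x := contDiffAt_const.mul hf
    have hinit : initialJet (fun y ↦ t * f y) x = baseJet x + t • a := initialJet_const_mul t x
    have hgood := fun s (hs : s ∈ Ioc 0 r) ↦ IsTransition.mem_and_norm_jetCurve_sub_le hk h1 h2 hft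
      h3 hC0 hε.le hlin hC (by rwa [hinit, add_sub_cancel_left]) hs
    refine ⟨(hgood r ⟨hr, le_rfl⟩).1, ?_⟩
    have hsq : ∀ s ∈ Ioo 0 r, √s ∈ Icc 0 (√r) := fun s hs ↦
      ⟨Real.sqrt_nonneg s, Real.sqrt_le_sqrt hs.2.le⟩
    have := norm_sub_smul_le_of_linearization (Z := jetCurve k (Ψ t) (fun y ↦ t * f y) x)
      (A := variationJet k S f x) (v₀ := baseJet x) (t := t)
      (Λ := fun s ↦ linearPart F (baseJet x) (√s)) hC0 hε.le hε1
      (IsTransition.continuousOn_jetCurve hk h1 h2 hft fun s hs ↦ ⟨(hgood s hs).1, (hgood s hs).2.1⟩)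
      (fun s hs ↦ IsTransition.hasDerivAt_jetCurve hk h1 (hgood s (Ioo_subset_Ioc_self hs)).1 hs.1
        (hgood s (Ioo_subset_Ioc_self hs)).2.1)
      (fun s hs ↦ hC _ (hsq s hs))
      (fun s hs ↦ (hlin _ (hsq s hs) _ (hgood s (Ioo_subset_Ioc_self hs)).2.2).2)
      (hk.continuousOn_variationJet hr.le hS)
      (fun s hs ↦ hk.hasDerivAt_variationJet hr.le hS hs)
      (by rw [jetCurve_zero, hinit]) (s := r) ⟨hr.le, le_rfl⟩
    rwa [jetCurve_of_ne hr.ne'] at this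
  -- At `t = 0` the error bound is zero, so the jet is the stationary one; there is no need to
  -- identify `Ψ 0` with the identity beforehand.
  have h0 : transitionJet k (Ψ 0) (x, r) = baseJet x := by
    have := (key 1 one_pos le_rfl).self_of_nhds.2
    simpa [sub_eq_zero] using this
  refine ⟨(key 1 one_pos le_rfl).mono fun t ht ↦ ht.1, h0, ?_⟩
  rw [hasDerivAt_iff_isLittleO, Asymptotics.isLittleO_iff]
  intro c hc
  -- `M + 1` avoids division by zero, as `M` may vanish.
  have hε : 0 < min 1 (c / (M + 1)) := by positivity
  filter_upwards [key _ hε (min_le_left _ _)] with t ht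
  rw [h0, sub_zero]
  refine ht.2.trans ?_
  rw [Real.norm_eq_abs]
  have h1 : min 1 (c / (M + 1)) * (M + 1) ≤ c := by
    calc _ ≤ c / (M + 1) * (M + 1) := by gcongr; exact min_le_right _ _
      _ = c := by field_simp
  nlinarith [abs_nonneg t, mul_nonneg hε.le (abs_nonneg t)]

/-- The metrics `k_t` are determined by the jets of the transition maps. -/
lemma IsTransition.metric_eq {k' : E × ℝ → E →L[ℝ] E →L[ℝ] ℝ} {D : Set (E × ℝ)}
    {Ψ : E × ℝ → E × ℝ} {f : E → ℝ} (hk : IsMetricFamily k S) (h : IsTransition k S k' D Ψ f)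
    {x : E} {r : ℝ} (hx : (x, r) ∈ D) (hr : 0 < r) (v w : E) :
    k' (x, r) v w =
      r ^ 2 * ((transitionJet k Ψ (x, r)).2 v).1 * ((transitionJet k Ψ (x, r)).2 w).1
      + Real.exp (-2 * (transitionJet k Ψ (x, r)).1.1)
        * k ((transitionJet k Ψ (x, r)).1.2.1, r * Real.exp (transitionJet k Ψ (x, r)).1.1)
          ((transitionJet k Ψ (x, r)).2 v).2.1 ((transitionJet k Ψ (x, r)).2 w).2.1 := by
  have hρ := h.pos _ hx hr
  have hfp := h.footPoint_transitionState hx hr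
  rw [footPoint, Real.sq_sqrt hr.le] at hfp
  have hd : ∀ u, (transitionJet k Ψ (x, r)).2 u = ((fderiv ℝ Ψ (x, r) (u, 0)).2 / (Ψ (x, r)).2,
      (fderiv ℝ Ψ (x, r) (u, 0)).1, fderiv ℝ (momentum k Ψ) (x, r) (u, 0)) := fun u ↦
    fderiv_transitionState_apply hk h hx hr u
  have hfp' : ((transitionJet k Ψ (x, r)).1.2.1, r * Real.exp (transitionJet k Ψ (x, r)).1.1)
      = Ψ (x, r) := hfp
  have hW : (transitionJet k Ψ (x, r)).1.1 = Real.log ((Ψ (x, r)).2 / r) := rfl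
  rw [hfp', hd, hd, hW, neg_mul, Real.exp_neg, two_mul, Real.exp_add,
    Real.exp_log (div_pos hρ hr)]
  have := h.pullback _ hx hr (v, 0) (w, 0)
  simp only [mul_zero, zero_add] at this
  field_simp
  linear_combination -this

/-- Differentiate the expression of `k_t` through the jet. The term in `dW(v) dW(w)` drops out since
both factors vanish at `t = 0`; `e^{-2W}` contributes `2ω k`, the argument `r e^W` contributes `-rω
∂_r k`, and `y` with its derivative gives the Lie derivative. -/
lemma hasDerivAt_metric_of_transition (hk : IsMetricFamily k S) [Nontrivial E]
    {kt : ℝ → E × ℝ → E →L[ℝ] E →L[ℝ] ℝ} {D : ℝ → Set (E × ℝ)} {Ψ : ℝ → E × ℝ → E × ℝ}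
    {f : E → ℝ} (h : ∀ᶠ t in 𝓝 0, IsTransition k S (kt t) (D t) (Ψ t) (fun y ↦ t * f y))
    {x : E} (hx : ∀ᶠ t in 𝓝 0, (x, (0 : ℝ)) ∈ D t) (hf : ContDiffAt ℝ ∞ f x) {r : ℝ} (hr : 0 < r)
    (hS : ∀ s ∈ Icc 0 r, (x, s) ∈ S)
    (hcl : ∀ᶠ t in 𝓝 0, ∀ K ⊆ S, IsCompact K →
      IsClosed {s | s ∈ Icc 0 r ∧ (x, s) ∈ D t ∧ Ψ t (x, s) ∈ K}) (v w : E) :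
    HasDerivAt (fun t ↦ kt t (x, r) v w)
      (f x * (2 * k (x, r) v w - r * fderiv ℝ k (x, r) (0, 1) v w)
        + (fderiv ℝ k (x, r) (localField k f r x, 0) v w
          + k (x, r) (localFieldDeriv k S f r x v) w
          + k (x, r) v (localFieldDeriv k S f r x w))) 0 := by
  obtain ⟨hD, hJ0, hJ⟩ := hasDerivAt_transitionJet_parameter hk h hx hf hr hS hcl
  set J := fun t ↦ transitionJet k (Ψ t) (x, r) with hJdef
  have hJ0' : J 0 = baseJet x := hJ0
  have hkd : HasFDerivAt k (fderiv ℝ k (x, r)) (x, r) :=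
    ((hk.contDiffOn.contDiffAt (mem_nhds_of_halfSpace hk.exists_isOpen
      (hS r ⟨hr.le, le_rfl⟩) hr)).differentiableAt (by simp)).hasFDerivAt
  have hW : HasDerivAt (fun t ↦ (J t).1.1) (-f x) 0 := hJ.fst.fst
  have hy : HasDerivAt (fun t ↦ (J t).1.2.1) (localField k f r x) 0 := hJ.fst.snd.fst
  have hζ : ∀ u, HasDerivAt (fun t ↦ (J t).2 u) ((variationJet k S f x r).2 u) 0 := fun u ↦ by
    have : HasDerivAt (fun t ↦ (J t).2) (variationJet k S f x r).2 0 := hJ.snd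
    simpa using this.clm_apply (hasDerivAt_const (0 : ℝ) u)
  have hζW : ∀ u, HasDerivAt (fun t ↦ ((J t).2 u).1) (-fderiv ℝ f x u) 0 := fun u ↦ (hζ u).fst
  have hζy : ∀ u, HasDerivAt (fun t ↦ ((J t).2 u).2.1) (localFieldDeriv k S f r x u) 0 :=
    fun u ↦ (hζ u).snd.fst
  have hfoot : HasDerivAt (fun t ↦ ((J t).1.2.1, r * Real.exp (J t).1.1))
      (localField k f r x, r * (Real.exp (J 0).1.1 * -f x)) 0 := hy.prodMk (hW.exp.const_mul r)
  have hkJ : HasDerivAt (fun t ↦ k ((J t).1.2.1, r * Real.exp (J t).1.1))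
      (fderiv ℝ k (x, r) (localField k f r x, r * (Real.exp (J 0).1.1 * -f x))) 0 :=
    hkd.comp_hasDerivAt_of_eq (0 : ℝ) hfoot (by simp [hJ0', baseJet])
  have hmain := ((((hζW v).const_mul (r ^ 2)).fun_mul (hζW w)).fun_add
    ((hW.const_mul (-2)).exp.fun_mul ((hkJ.clm_apply (hζy v)).clm_apply (hζy w))))
  refine (hmain.congr_of_eventuallyEq ?_).congr_deriv ?_
  · filter_upwards [h, hD] with t h1 h2
    exact h1.metric_eq hk h2 hr v w
  · have e : ((localField k f r x, -(r * f x)) : E × ℝ)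
        = (localField k f r x, 0) + (-(r * f x)) • (0, 1) := by simp
    simp only [hJ0', baseJet, Real.exp_zero, mul_zero, one_mul, ContinuousLinearMap.prod_apply,
      zero_apply, mul_one, zero_add, ContinuousLinearMap.id_apply, add_apply, mul_neg]
    rw [e, map_add, map_smul]
    simp only [add_apply, smul_apply, smul_eq_mul]
    ring

lemma _root_.AHMetric.eventually_forall_mem_of_halfSpace {S : Set (E × ℝ)}
    (hS : ∃ W, IsOpen W ∧ S = W ∩ {z | 0 ≤ z.2}) {x : E} {r : ℝ}
    (hx : ∀ s ∈ Icc 0 r, (x, s) ∈ S) : ∀ᶠ y in 𝓝 x, ∀ s ∈ Icc 0 r, (y, s) ∈ S := by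
  obtain ⟨W, hWo, rfl⟩ := hS
  have : ∀ᶠ y in 𝓝 x, ∀ s ∈ Icc 0 r, (y, s) ∈ W :=
    isCompact_Icc.eventually_forall_of_forall_eventually fun s hs ↦ hWo.mem_nhds (hx s hs).1
  filter_upwards [this] with y hy s hs
  exact ⟨hy s hs, hs.1⟩

/-- Differentiation under the integral sign. -/
lemma hasFDerivAt_localField (hk : IsMetricFamily k S) {f : E → ℝ} {x : E}
    (hf : ContDiffAt ℝ ∞ f x) {r : ℝ} (hr : 0 ≤ r) (hS : ∀ s ∈ Icc 0 r, (x, s) ∈ S) :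
    HasFDerivAt (localField k f r) (localFieldDeriv k S f r x) x := by
  have : CompleteSpace E := FiniteDimensional.complete ℝ E
  have hf1 : ∀ᶠ y in 𝓝 x, ContDiffAt ℝ 2 f y :=
    (hf.of_le (by exact WithTop.coe_le_coe.2 (le_top (a := (2 : ℕ∞))))).eventually (by simp)
  have hDκ : ContinuousOn (fderivWithin ℝ (inverseFamily k) S) S :=
    hk.contDiffOn_inverseFamily.continuousOn_fderivWithin hk.uniqueDiffOn (by simp)
  -- near `x` everything is defined and bounded
  have hmem := eventually_forall_mem_of_halfSpace hk.exists_isOpen hS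
  have hproper : ProperSpace E := FiniteDimensional.proper_real E
  obtain ⟨ρ, hρ, hball⟩ := Metric.nhds_basis_closedBall.eventually_iff.1 (hmem.and hf1)
  have hder : ∀ s ∈ Icc 0 r, ∀ y ∈ Metric.closedBall x ρ,
      HasFDerivAt (fun y ↦ s • inverseFamily k (y, s) (fderiv ℝ f y))
        (localFieldDerivIntegrand k S f y s) y := by
    intro s hs y hy
    obtain ⟨h1, h2⟩ := hball hy
    have d1 := hasFDerivAt_slice hk.exists_isOpen hk.contDiffOn_inverseFamily (h1 s hs)
    have d2 : HasFDerivAt (fderiv ℝ f) (fderiv ℝ (fderiv ℝ f) y) y :=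
      ((h2.fderiv_right (m := 1) (by norm_num)).differentiableAt (by simp)).hasFDerivAt
    refine ((d1.clm_apply d2).const_smul s).congr_fderiv ?_
    rw [localFieldDerivIntegrand, add_comm]
  have hcont : ContinuousOn (fun p : E × ℝ ↦ localFieldDerivIntegrand k S f p.1 p.2)
      (Metric.closedBall x ρ ×ˢ Icc 0 r) := by
    have hsub : MapsTo (fun p : E × ℝ ↦ (p.1, p.2)) (Metric.closedBall x ρ ×ˢ Icc 0 r) S :=
      fun p hp ↦ (hball hp.1).1 p.2 hp.2
    have hκ' := hk.contDiffOn_inverseFamily.continuousOn.comp (by fun_prop) hsub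
    have hD' := hDκ.comp (by fun_prop) hsub
    have hf' : ContinuousOn (fun p : E × ℝ ↦ fderiv ℝ f p.1)
        (Metric.closedBall x ρ ×ˢ Icc 0 r) := fun p hp ↦
      (((hball hp.1).2.fderiv_right (m := 1) (by norm_num)).continuousAt.comp
        continuousAt_fst).continuousWithinAt
    have hf'' : ContinuousOn (fun p : E × ℝ ↦ fderiv ℝ (fderiv ℝ f) p.1)
        (Metric.closedBall x ρ ×ˢ Icc 0 r) := fun p hp ↦
      ((((hball hp.1).2.fderiv_right (m := 1) (by norm_num)).fderiv_right (m := 0)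
        (by norm_num)).continuousAt.comp continuousAt_fst).continuousWithinAt
    refine continuousOn_snd.smul (ContinuousOn.add ?_ (hκ'.clm_comp hf''))
    refine continuousOn_clm_apply.2 fun e ↦ ?_
    exact (hD'.clm_apply continuousOn_const).clm_apply hf'
  obtain ⟨C, hC⟩ := ((isCompact_closedBall x ρ).prod isCompact_Icc).exists_bound_of_continuousOn
    hcont
  have hint : ∀ y ∈ Metric.closedBall x ρ,
      ContinuousOn (fun s ↦ s • inverseFamily k (y, s) (fderiv ℝ f y)) (Icc 0 r) := fun y hy ↦
    hk.continuousOn_localField_integrand (hball hy).1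
  have hxb : x ∈ Metric.closedBall x ρ := Metric.mem_closedBall_self hρ.le
  have hI : uIoc 0 r = Ioc 0 r := uIoc_of_le hr
  refine (intervalIntegral.hasFDerivAt_integral_of_dominated_of_fderiv_le
    (F := fun y s ↦ s • inverseFamily k (y, s) (fderiv ℝ f y))
    (F' := fun y s ↦ localFieldDerivIntegrand k S f y s) (bound := fun _ ↦ C)
    (s := Metric.closedBall x ρ)
    (Metric.closedBall_mem_nhds x hρ) ?_ ?_ ?_ ?_ ?_ ?_)
  · filter_upwards [Metric.closedBall_mem_nhds x hρ] with y hy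
    rw [hI]
    exact ((hint y hy).mono Ioc_subset_Icc_self).aestronglyMeasurable measurableSet_Ioc
  · refine ContinuousOn.intervalIntegrable ?_
    rw [uIcc_of_le hr]
    exact hint x hxb
  · rw [hI]
    exact ((hk.continuousOn_localFieldDerivIntegrand hS).mono
      Ioc_subset_Icc_self).aestronglyMeasurable measurableSet_Ioc
  · refine Eventually.of_forall fun s hs y hy ↦ ?_
    rw [hI] at hs
    exact hC (y, s) ⟨hy, Ioc_subset_Icc_self hs⟩
  · exact intervalIntegrable_const
  · refine Eventually.of_forall fun s hs y hy ↦ ?_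
    rw [hI] at hs
    exact hder s (Ioc_subset_Icc_self hs) y hy

end Variation

/-! ### Tensor families in the preferred chart -/

section Chart

variable {E : Type*} [NormedAddCommGroup E] [NormedSpace ℝ E]
  {H : Type*} [TopologicalSpace H] (I : ModelWithCorners ℝ E H) [I.Boundaryless]
  {N : Type*} [TopologicalSpace N] [ChartedSpace H N] [IsManifold I ∞ N]

/-- The frame of the preferred chart at `x`, over the chart domain. -/
def chartFrame (x : N) (y : E) : E →L[ℝ] E :=
  mfderiv 𝓘(ℝ, E) I (extChartAt I x).symm y

theorem contMDiffOn_extChartAt_symm_target (x : N) :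
    ContMDiffOn 𝓘(ℝ, E) I ∞ (extChartAt I x).symm (extChartAt I x).target :=
  contMDiffOn_extChartAt_symm x

theorem mdifferentiableAt_extChartAt_symm {x : N} {y : E} (hy : y ∈ (extChartAt I x).target) :
    MDifferentiableAt 𝓘(ℝ, E) I (extChartAt I x).symm y :=
  ((contMDiffOn_extChartAt_symm_target I x).contMDiffAt
    ((isOpen_extChartAt_target x).mem_nhds hy)).mdifferentiableAt (by simp)

theorem hasMFDerivAt_extChartAt_symm {x : N} {y : E} (hy : y ∈ (extChartAt I x).target) :
    HasMFDerivAt 𝓘(ℝ, E) I (extChartAt I x).symm y (chartFrame I x y :) :=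
  (mdifferentiableAt_extChartAt_symm I hy).hasMFDerivAt

theorem isInvertible_chartFrame {x : N} {y : E} (hy : y ∈ (extChartAt I x).target) :
    (chartFrame I x y).IsInvertible := by
  have := isInvertible_mfderivWithin_extChartAt_symm (I := I) hy
  rw [I.range_eq_univ, mfderivWithin_univ] at this
  exact this

/-- At its own centre the preferred chart has identity frame, because tangent vectors are by
definition components in that chart. Hence local formulas read at the centre are already the
invariant ones. -/
theorem chartFrame_self (x : N) (v : E) : chartFrame I x (extChartAt I x x) v = v := by
  have := mfderivWithin_range_extChartAt_symm (I := I) (x := x)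
  rw [I.range_eq_univ, mfderivWithin_univ] at this
  exact congrArg (fun L ↦ L v) this

/-- The vector fields of the chart frame are smooth. -/
theorem contMDiffOn_chartFrame (x : N) (v : E) :
    ContMDiffOn 𝓘(ℝ, E) I.tangent ∞
      (fun y ↦ (⟨(extChartAt I x).symm y, chartFrame I x y v⟩ : TangentBundle I N))
      (extChartAt I x).target := by
  have h1 := (contMDiffOn_extChartAt_symm_target I x).contMDiffOn_tangentMapWithin (m := ∞)
    (by simp) (isOpen_extChartAt_target x).uniqueMDiffOn
  have h2 : ContMDiffOn 𝓘(ℝ, E) 𝓘(ℝ, E).tangent ∞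
      (fun y ↦ (⟨y, v⟩ : TangentBundle 𝓘(ℝ, E) E)) (extChartAt I x).target := by
    intro y hy
    rw [Bundle.contMDiffWithinAt_totalSpace]
    refine ⟨contMDiffWithinAt_id, ?_⟩
    simpa using contMDiffWithinAt_const
  refine (h1.comp h2 (fun y hy ↦ hy)).congr fun y hy ↦ ?_
  simp only [Function.comp, tangentMapWithin, chartFrame]
  rw [mfderivWithin_of_isOpen (isOpen_extChartAt_target x) hy]
  rfl

/-- The pullback of a bilinear form by a linear map. -/
def pullbackForm (b : E →L[ℝ] E →L[ℝ] ℝ) (A : E →L[ℝ] E) : E →L[ℝ] E →L[ℝ] ℝ :=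
  b.bilinearComp A A

theorem pullbackForm_nondegenerate {b : E →L[ℝ] E →L[ℝ] ℝ} {A : E →L[ℝ] E}
    (hb : ∀ v, (∀ w, b v w = 0) → v = 0) (hA : A.IsInvertible) (v : E)
    (hv : ∀ w, pullbackForm b A v w = 0) : v = 0 := by
  obtain ⟨e, rfl⟩ := hA
  have h1 : e v = 0 := hb _ fun w ↦ by simpa [pullbackForm] using hv (e.symm w)
  simpa using h1

/-- A one-parameter family of tensor fields, in the preferred chart at `x`. -/
def localMetric (h : ℝ → TwoTensor I N) (x : N) (z : E × ℝ) : E →L[ℝ] E →L[ℝ] ℝ :=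
  pullbackForm (E := E) (h z.2 ((extChartAt I x).symm z.1)) (chartFrame I x z.1)

/-- The part of the domain of a family of tensor fields seen in the preferred chart at `x`. -/
def localDomain (U : Set (N × ℝ)) (x : N) : Set (E × ℝ) :=
  {z | z.1 ∈ (extChartAt I x).target ∧ ((extChartAt I x).symm z.1, z.2) ∈ U}

/-- The inverse of the preferred chart at `x`, times the identity of `ℝ`. -/
def cylinderChartSymm (x : N) (z : E × ℝ) : N × ℝ := ((extChartAt I x).symm z.1, z.2)

theorem contMDiffOn_cylinderChartSymm (x : N) :
    ContMDiffOn 𝓘(ℝ, E × ℝ) (I.prod 𝓘(ℝ, ℝ)) ∞ (cylinderChartSymm I x)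
      ((extChartAt I x).target ×ˢ univ) := by
  rw [modelWithCornersSelf_prod, ← chartedSpaceSelf_prod]
  exact ((contMDiffOn_extChartAt_symm_target I x).comp contMDiffOn_fst fun z hz ↦ hz.1).prodMk
    contMDiffOn_snd

variable {I}

theorem localMetric_apply (h : ℝ → TwoTensor I N) (x : N) (z : E × ℝ) (v w : E) :
    localMetric I h x z v w =
      h z.2 ((extChartAt I x).symm z.1) (chartFrame I x z.1 v) (chartFrame I x z.1 w) := rfl

/-- Evaluate the smooth bundle section on the smooth vector fields of the chart frame; in finite
dimension, smoothness of all components suffices. -/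
theorem contDiffOn_localMetric [FiniteDimensional ℝ E] {h : ℝ → TwoTensor I N} {U : Set (N × ℝ)}
    (hh : SmoothFamilyOn h U) (x : N) :
    ContDiffOn ℝ ∞ (localMetric I h x) (localDomain I U x) := by
  refine contDiffOn_clm_apply.2 fun v ↦ contDiffOn_clm_apply.2 fun w ↦ ?_
  have hsub : localDomain I U x ⊆ (extChartAt I x).target ×ˢ univ := fun z hz ↦ ⟨hz.1, trivial⟩
  have h0 := (contMDiffOn_cylinderChartSymm I x).mono hsub
  have h1 := hh.comp h0 fun z hz ↦ hz.2
  have hv : ∀ v : E, ContMDiffOn 𝓘(ℝ, E × ℝ) I.tangent ∞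
      (fun z : E × ℝ ↦ (⟨(extChartAt I x).symm z.1, chartFrame I x z.1 v⟩ : TangentBundle I N))
      (localDomain I U x) := fun v ↦
    (contMDiffOn_chartFrame I x v).comp (t := (extChartAt I x).target) (f := Prod.fst)
      (contDiffOn_fst.contMDiffOn) fun z hz ↦ hz.1
  rw [← contMDiffOn_iff_contDiffOn]
  intro z hz
  have : ContMDiffWithinAt 𝓘(ℝ, E × ℝ) (I.prod 𝓘(ℝ, ℝ)) ∞
      (fun z : E × ℝ ↦ Bundle.TotalSpace.mk' ℝ (E := Bundle.Trivial N ℝ) ((extChartAt I x).symm z.1)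
        (localMetric I h x z v w)) (localDomain I U x) z := by
    apply ContMDiffWithinAt.clm_bundle_apply₂ (F₁ := E) (F₂ := E)
    · exact h1 z hz
    · exact hv v z hz
    · exact hv w z hz
  simp only [Bundle.contMDiffWithinAt_totalSpace] at this
  exact this.2

theorem exists_isOpen_localDomain {U : Set (N × ℝ)}
    (hU : ∃ W : Set (N × ℝ), IsOpen W ∧ U = W ∩ {z | 0 ≤ z.2}) (x : N) :
    ∃ W, IsOpen W ∧ localDomain I U x = W ∩ {z : E × ℝ | 0 ≤ z.2} := by
  obtain ⟨W, hW, rfl⟩ := hU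
  refine ⟨((extChartAt I x).target ×ˢ univ) ∩ cylinderChartSymm I x ⁻¹' W,
    (contMDiffOn_cylinderChartSymm I x).continuousOn.isOpen_inter_preimage
      ((isOpen_extChartAt_target x).prod isOpen_univ) hW, ?_⟩
  ext z
  simp only [localDomain, cylinderChartSymm, mem_inter_iff, mem_prod, mem_preimage, mem_univ,
    and_true, and_assoc]
  rfl

theorem localMetric_symm {h : ℝ → TwoTensor I N} {x : N} {z : E × ℝ}
    (hs : ∀ v w, h z.2 ((extChartAt I x).symm z.1) v w = h z.2 ((extChartAt I x).symm z.1) w v)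
    (v w : E) : localMetric I h x z v w = localMetric I h x z w v := hs _ _

theorem localMetric_nondegenerate {h : ℝ → TwoTensor I N} {x : N} {z : E × ℝ}
    (hz : z.1 ∈ (extChartAt I x).target)
    (hs : ∀ v, (∀ w, h z.2 ((extChartAt I x).symm z.1) v w = 0) → v = 0)
    (v : E) (hv : ∀ w, localMetric I h x z v w = 0) : v = 0 :=
  pullbackForm_nondegenerate (E := E) hs (isInvertible_chartFrame I hz) v hv

theorem isMetricFamily_localMetric [FiniteDimensional ℝ E] {h : ℝ → TwoTensor I N}
    {U : Set (N × ℝ)} {p q : ℕ} (hU : ∃ W : Set (N × ℝ), IsOpen W ∧ U = W ∩ {z | 0 ≤ z.2})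
    (hh : SmoothFamilyOn h U) (hs : ∀ z ∈ U, HasSignature (h z.2 z.1) p q) (x : N) :
    IsMetricFamily (localMetric I h x) (localDomain I U x) where
  exists_isOpen := exists_isOpen_localDomain hU x
  contDiffOn := contDiffOn_localMetric hh x
  symm _ hz := localMetric_symm (hs _ hz.2).symm
  nondegenerate _ hz := localMetric_nondegenerate hz.1 (hs _ hz.2).nondegenerate

end Chart

theorem exists_isOpen_inter_preimage {α β : Type*} [TopologicalSpace α] [TopologicalSpace β]
    {S C : Set α} (hS : ∃ W, IsOpen W ∧ S = W ∩ C) {F : α → β} (hF : ContinuousOn F S) {O : Set β}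
    (hO : IsOpen O) : ∃ W, IsOpen W ∧ S ∩ F ⁻¹' O = W ∩ C := by
  obtain ⟨W, hW, rfl⟩ := hS
  obtain ⟨u, hu, h⟩ := continuousOn_iff'.1 hF O hO
  refine ⟨u ∩ W, hu.inter hW, ?_⟩
  rw [inter_comm, h, inter_assoc]

/-! ### Chart cylinders -/

section Cylinder

variable {E : Type*} [NormedAddCommGroup E] [NormedSpace ℝ E]
  {H : Type*} [TopologicalSpace H] (I : ModelWithCorners ℝ E H) [I.Boundaryless]
  {N : Type*} [TopologicalSpace N] [ChartedSpace H N] [IsManifold I ∞ N]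

/-- The preferred chart at `x`, times the identity of `ℝ`. -/
def cylinderChart (x : N) (m : N × ℝ) : E × ℝ := (extChartAt I x m.1, m.2)

theorem contMDiffOn_cylinderChart (x : N) :
    ContMDiffOn (I.prod 𝓘(ℝ, ℝ)) 𝓘(ℝ, E × ℝ) ∞ (cylinderChart I x)
      ((extChartAt I x).source ×ˢ univ) := by
  rw [modelWithCornersSelf_prod, ← chartedSpaceSelf_prod]
  refine ((contMDiffOn_extChartAt (I := I) (x := x)).comp contMDiffOn_fst fun z hz ↦ ?_).prodMk
    contMDiffOn_snd
  simpa [extChartAt_source] using hz.1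

theorem cylinderChartSymm_cylinderChart {x : N} {m : N × ℝ} (hm : m.1 ∈ (extChartAt I x).source) :
    cylinderChartSymm I x (cylinderChart I x m) = m :=
  Prod.ext ((extChartAt I x).left_inv hm) rfl

theorem cylinderChart_cylinderChartSymm {x : N} {z : E × ℝ} (hz : z.1 ∈ (extChartAt I x).target) :
    cylinderChart I x (cylinderChartSymm I x z) = z :=
  Prod.ext ((extChartAt I x).right_inv hz) rfl

theorem hasMFDerivAt_cylinderChartSymm {x : N} {z : E × ℝ}
    (hz : z.1 ∈ (extChartAt I x).target) :
    HasMFDerivAt 𝓘(ℝ, E × ℝ) (I.prod 𝓘(ℝ, ℝ)) (cylinderChartSymm I x) z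
      (((chartFrame I x z.1).comp (ContinuousLinearMap.fst ℝ E ℝ)).prod
        (ContinuousLinearMap.snd ℝ E ℝ) :) := by
  have h1 : HasMFDerivAt 𝓘(ℝ, E × ℝ) 𝓘(ℝ, E) (Prod.fst : E × ℝ → E) z
    (ContinuousLinearMap.fst ℝ E ℝ :) := (hasFDerivAt_fst (p := z)).hasMFDerivAt
  have h2 : HasMFDerivAt 𝓘(ℝ, E × ℝ) 𝓘(ℝ, ℝ) (Prod.snd : E × ℝ → ℝ) z
    (ContinuousLinearMap.snd ℝ E ℝ :) := (hasFDerivAt_snd (p := z)).hasMFDerivAt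
  exact (HasMFDerivAt.comp z (hasMFDerivAt_extChartAt_symm I hz) h1).prodMk h2

end Cylinder

/-! ### Two normal forms differ by a transition map -/

section NormalForm

variable {n p q : ℕ}
  {M : Type*} [TopologicalSpace M] [ChartedSpace (EuclideanSpace ℝ (Fin n)) M]
  [IsManifold (𝓡 n) ∞ M]
  {X : Type*} [TopologicalSpace X]
  [ChartedSpace (EuclideanHalfSpace (n + 1)) X] [IsManifold (𝓡∂ (n + 1)) ∞ X]
  {ι : M → X} {gp : TwoTensor (𝓡∂ (n + 1)) X} {g g₀ : TwoTensor (𝓡 n) M}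
  {U U₀ : Set (M × ℝ)} {φ φ₀ : M × ℝ → X} {h h₀ : ℝ → TwoTensor (𝓡 n) M} {ψ : X → M × ℝ}

local notation "E" => EuclideanSpace ℝ (Fin n)

theorem IsNormalForm.contMDiffOn_comp_cylinderChartSymm (hN : IsNormalForm ι gp p q g U φ h)
    (x : M) : ContMDiffOn 𝓘(ℝ, E × ℝ) (𝓡∂ (n + 1)) ∞ (φ ∘ cylinderChartSymm (𝓡 n) x)
      (localDomain (𝓡 n) U x) :=
  hN.contMDiffOn.comp ((contMDiffOn_cylinderChartSymm (𝓡 n) x).mono fun _ hz ↦ ⟨hz.1, trivial⟩)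
    fun _ hz ↦ hz.2

/-- The pullback of the metric on the interior to the chart cylinder. -/
theorem IsNormalForm.pullback_cylinder (hN : IsNormalForm ι gp p q g U φ h) {x : M} {z : E × ℝ}
    (hz : z ∈ localDomain (𝓡 n) U x) (hz0 : 0 < z.2) :
    ∃ A : E × ℝ →L[ℝ] EuclideanSpace ℝ (Fin (n + 1)),
      HasMFDerivAt 𝓘(ℝ, E × ℝ) (𝓡∂ (n + 1)) (φ ∘ cylinderChartSymm (𝓡 n) x) z A ∧
      ∀ e e' : E × ℝ, gp (φ (cylinderChartSymm (𝓡 n) x z)) (A e) (A e') =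
        (z.2 ^ 2)⁻¹ * (e.2 * e'.2 + localMetric (𝓡 n) h x z e.1 e'.1) := by
  have hmem : U ∈ 𝓝 (cylinderChartSymm (𝓡 n) x z) := by
    obtain ⟨W, hW, h2⟩ := hN.isOpen
    have hz' := hz.2
    rw [h2] at hz' ⊢
    exact inter_mem (hW.mem_nhds hz'.1) (((continuous_snd (X := M)).continuousAt.eventually
      (lt_mem_nhds (a := (0 : ℝ)) (b := (cylinderChartSymm (𝓡 n) x z).2) hz0)).mono
      fun _ hm ↦ le_of_lt hm)
  have h1 := (((hN.contMDiffOn.contMDiffAt hmem).mdifferentiableAt (by simp)).hasMFDerivAt).comp z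
    (hasMFDerivAt_cylinderChartSymm (𝓡 n) hz.1)
  refine ⟨_, h1, fun e e' ↦ ?_⟩
  exact hN.pullback _ _ hz0 hz.2 (chartFrame (𝓡 n) x z.1 e.1) (chartFrame (𝓡 n) x z.1 e'.1) e.2 e'.2

/-- The transition map between two normal forms, in the chart cylinder. -/
def localTransition (x : M) (φ : M × ℝ → X) (ψ : X → M × ℝ) (z : E × ℝ) : E × ℝ :=
  cylinderChart (𝓡 n) x (ψ (φ (cylinderChartSymm (𝓡 n) x z)))

/-- The domain of the transition map between two normal forms, in the chart cylinder. -/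
def transitionDomain (x : M) (U : Set (M × ℝ)) (φ : M × ℝ → X) (V : Set X) (ψ : X → M × ℝ) :
    Set (E × ℝ) :=
  (localDomain (𝓡 n) U x ∩ (φ ∘ cylinderChartSymm (𝓡 n) x) ⁻¹' V) ∩
    (ψ ∘ φ ∘ cylinderChartSymm (𝓡 n) x) ⁻¹' ((extChartAt (𝓡 n) x).source ×ˢ univ)

theorem comp_cylinderChartSymm_localTransition
    (hψ : LeftInvOn ψ φ₀ U₀) {x : M} {z : E × ℝ} (hz : z ∈ transitionDomain x U φ (φ₀ '' U₀) ψ) :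
    localTransition x φ ψ z ∈ localDomain (𝓡 n) U₀ x ∧
      φ₀ (cylinderChartSymm (𝓡 n) x (localTransition x φ ψ z)) =
        φ (cylinderChartSymm (𝓡 n) x z) := by
  obtain ⟨⟨hz1, m, hm, hm2⟩, hz3⟩ := hz
  have h1 : ψ (φ (cylinderChartSymm (𝓡 n) x z)) = m := by
    rw [← hψ hm]; exact congrArg ψ hm2.symm
  have hs : m.1 ∈ (extChartAt (𝓡 n) x).source := by
    rw [← h1]; exact hz3.1
  have h2 : cylinderChartSymm (𝓡 n) x (localTransition x φ ψ z) = m := by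
    rw [localTransition, h1, cylinderChartSymm_cylinderChart _ hs]
  refine ⟨⟨?_, ?_⟩, ?_⟩
  · rw [localTransition, h1]; exact (extChartAt (𝓡 n) x).map_source hs
  · change cylinderChartSymm (𝓡 n) x (localTransition x φ ψ z) ∈ U₀
    rwa [h2]
  · rw [h2]; exact hm2

/-- Both normal forms pull back the same metric and `φ₀ ∘ Ψ = φ` in the chart, so the pullback
identity follows from the chain rule. -/
theorem IsNormalForm.isTransition (hN : IsNormalForm ι gp p q g U φ h)
    (hN₀ : IsNormalForm ι gp p q g₀ U₀ φ₀ h₀) {f : M → ℝ}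
    (hg : ∀ y, g y = Real.exp (2 * f y) • g₀ y) (hψ : LeftInvOn ψ φ₀ U₀)
    (hψs : ContMDiffOn (𝓡∂ (n + 1)) ((𝓡 n).prod 𝓘(ℝ, ℝ)) ∞ ψ (φ₀ '' U₀)) (x : M) :
    IsTransition (localMetric (𝓡 n) h₀ x) (localDomain (𝓡 n) U₀ x) (localMetric (𝓡 n) h x)
      (transitionDomain (n := n) x U φ (φ₀ '' U₀) ψ) (localTransition (n := n) x φ ψ)
      (fun y ↦ f ((extChartAt (𝓡 n) x).symm y)) := by
  have hc1 := hN.contMDiffOn_comp_cylinderChartSymm x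
  have hc2 : ContMDiffOn 𝓘(ℝ, E × ℝ) ((𝓡 n).prod 𝓘(ℝ, ℝ)) ∞ (ψ ∘ φ ∘ cylinderChartSymm (𝓡 n) x)
      (localDomain (𝓡 n) U x ∩ (φ ∘ cylinderChartSymm (𝓡 n) x) ⁻¹' (φ₀ '' U₀)) :=
    hψs.comp (hc1.mono inter_subset_left) fun z hz ↦ hz.2
  have hsub : transitionDomain (n := n) x U φ (φ₀ '' U₀) ψ ⊆ localDomain (𝓡 n) U x := fun z hz ↦ hz.1.1
  have hopen : ∃ W, IsOpen W ∧ transitionDomain (n := n) x U φ (φ₀ '' U₀) ψ = W ∩ {z | 0 ≤ z.2} :=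
    exists_isOpen_inter_preimage (exists_isOpen_inter_preimage
      (exists_isOpen_localDomain hN.isOpen x) hc1.continuousOn hN₀.isOpen_image) hc2.continuousOn
      ((isOpen_extChartAt_source (I := 𝓡 n) x).prod isOpen_univ)
  have hcd : ContDiffOn ℝ ∞ (localTransition (n := n) x φ ψ) (transitionDomain (n := n) x U φ (φ₀ '' U₀) ψ) := by
    rw [← contMDiffOn_iff_contDiffOn]
    exact (contMDiffOn_cylinderChart (𝓡 n) x).comp (hc2.mono inter_subset_left) fun z hz ↦ hz.2
  have hkey := fun z (hz : z ∈ transitionDomain (n := n) x U φ (φ₀ '' U₀) ψ) ↦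
    comp_cylinderChartSymm_localTransition hψ hz
  have hpos : ∀ z ∈ transitionDomain (n := n) x U φ (φ₀ '' U₀) ψ, 0 < z.2 →
      0 < (localTransition (n := n) x φ ψ z).2 := by
    intro z hz hz0
    obtain ⟨h1, h2⟩ := hkey z hz
    have h3 : 0 ≤ (localTransition (n := n) x φ ψ z).2 := by
      obtain ⟨W, -, h3⟩ := hN₀.isOpen
      have := h1.2
      rw [h3] at this
      exact this.2
    -- If the normal coordinate vanished, `φ` would take at an interior point a value it already
    -- takes on `M × {0}`, against injectivity.
    refine h3.lt_of_ne' fun h4 ↦ ?_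
    have h5 : cylinderChartSymm (𝓡 n) x (localTransition (n := n) x φ ψ z) =
        ((extChartAt (𝓡 n) x).symm (localTransition (n := n) x φ ψ z).1, 0) := Prod.ext rfl h4
    rw [h5, hN₀.apply_zero, ← hN.apply_zero] at h2
    have h6 := hN.injOn (hN.mem _) hz.1.1.2 h2
    exact hz0.ne (congrArg Prod.snd h6)
  refine ⟨hopen, hcd, fun z hz ↦ (hkey z hz).1, hpos, ?_, ?_, ?_, ?_, ?_⟩
  · intro y hy
    have h1 : cylinderChartSymm (𝓡 n) x (y, (0 : ℝ)) = ((extChartAt (𝓡 n) x).symm y, 0) := rfl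
    rw [localTransition, h1, hN.apply_zero, ← hN₀.apply_zero, hψ (hN₀.mem _), ← h1,
      cylinderChart_cylinderChartSymm _ hy.1.1.1]
  · exact (contDiffOn_localMetric hN.smooth x).continuousOn.mono hsub
  · intro y hy
    ext v w
    rw [localMetric_apply]
    simp only [hN.initial, hg]
    rw [← hN₀.initial]
    rfl
  · intro z hz
    exact localMetric_nondegenerate (hsub hz).1 (hN.signature _ (hsub hz).2).nondegenerate
  · intro z hz hz0 e e'
    obtain ⟨hm, heq⟩ := hkey z hz
    obtain ⟨A, hA, hA2⟩ := hN.pullback_cylinder (hsub hz) hz0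
    obtain ⟨A₀, hA₀, hA₀2⟩ := hN₀.pullback_cylinder hm (hpos z hz hz0)
    have hnhds := mem_nhds_of_halfSpace hopen hz hz0
    have hd : HasMFDerivAt 𝓘(ℝ, E × ℝ) 𝓘(ℝ, E × ℝ) (localTransition (n := n) x φ ψ) z
        (fderiv ℝ (localTransition (n := n) x φ ψ) z :) :=
      (((hcd.contDiffAt hnhds).differentiableAt (by simp)).hasFDerivAt).hasMFDerivAt
    have hA' := (HasMFDerivAt.comp z hA₀ hd).congr_of_eventuallyEq
      (Filter.mem_of_superset hnhds fun z' hz' ↦ ((hkey z' hz').2.symm))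
    have hAA : ∀ e : E × ℝ, A e = A₀ (fderiv ℝ (localTransition (n := n) x φ ψ) z e) := fun e ↦
      congrArg (fun L : E × ℝ →L[ℝ] EuclideanSpace ℝ (Fin (n + 1)) ↦ L e)
        (hasMFDerivAt_unique hA hA')
    have h3 := hA2 e e'
    have h4 := hA₀2 (fderiv ℝ (localTransition (n := n) x φ ψ) z e) (fderiv ℝ (localTransition (n := n) x φ ψ) z e')
    rw [hAA e, hAA e', ← heq] at h3
    have h5 := h3.symm.trans h4
    have h6 := (hpos z hz hz0).ne'
    have h7 := hz0.ne'
    field_simp at h5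
    linarith

end NormalForm

/-! ### Reading local formulas at the centre of the chart -/

section Self

variable {E : Type*} [NormedAddCommGroup E] [NormedSpace ℝ E]
  {H : Type*} [TopologicalSpace H] {I : ModelWithCorners ℝ E H} [I.Boundaryless]
  {N : Type*} [TopologicalSpace N] [ChartedSpace H N] [IsManifold I ∞ N]

theorem localMetric_self (h : ℝ → TwoTensor I N) (x : N) (r : ℝ) (v w : E) :
    localMetric I h x (extChartAt I x x, r) v w = h r x v w := by
  rw [localMetric_apply]
  simp only [chartFrame_self]
  let b : N → E →L[ℝ] E →L[ℝ] ℝ := h r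
  exact congrArg (fun y ↦ b y v w) (extChartAt_to_inv x)

theorem cylinderChartSymm_self (x : N) (s : ℝ) :
    cylinderChartSymm I x (extChartAt I x x, s) = (x, s) :=
  Prod.ext (extChartAt_to_inv x) rfl

theorem mem_localDomain_self {U : Set (N × ℝ)} {x : N} {s : ℝ} (hs : (x, s) ∈ U) :
    (extChartAt I x x, s) ∈ localDomain I U x :=
  ⟨mem_extChartAt_target x, by
    change cylinderChartSymm I x (extChartAt I x x, s) ∈ U
    rwa [cylinderChartSymm_self]⟩

theorem contDiffOn_comp_extChartAt_symm {f : N → ℝ} (hf : ContMDiff I 𝓘(ℝ, ℝ) ∞ f) (x : N) :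
    ContDiffOn ℝ ∞ (fun y ↦ f ((extChartAt I x).symm y)) (extChartAt I x).target := by
  rw [← contMDiffOn_iff_contDiffOn]
  exact hf.comp_contMDiffOn (contMDiffOn_extChartAt_symm_target I x)

end Self

/-! ### The variation of the normal form in chart components -/

section NormalForm

variable {n p q : ℕ}
  {M : Type*} [TopologicalSpace M] [ChartedSpace (EuclideanSpace ℝ (Fin n)) M]
  [IsManifold (𝓡 n) ∞ M]
  {X : Type*} [TopologicalSpace X]
  [ChartedSpace (EuclideanHalfSpace (n + 1)) X] [IsManifold (𝓡∂ (n + 1)) ∞ X]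
  {ι : M → X} {gp : TwoTensor (𝓡∂ (n + 1)) X} {g g₀ : TwoTensor (𝓡 n) M}
  {U U₀ : Set (M × ℝ)} {φ φ₀ : M × ℝ → X} {h h₀ : ℝ → TwoTensor (𝓡 n) M} {ψ : X → M × ℝ}

local notation "E" => EuclideanSpace ℝ (Fin n)

theorem mem_transitionDomain_zero (hN : IsNormalForm ι gp p q g U φ h)
    (hN₀ : IsNormalForm ι gp p q g₀ U₀ φ₀ h₀) (hψ : LeftInvOn ψ φ₀ U₀) (x : M) :
    (extChartAt (𝓡 n) x x, (0 : ℝ)) ∈ transitionDomain (n := n) x U φ (φ₀ '' U₀) ψ := by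
  have h1 : φ (cylinderChartSymm (𝓡 n) x (extChartAt (𝓡 n) x x, (0 : ℝ))) = φ₀ (x, 0) := by
    rw [cylinderChartSymm_self, hN.apply_zero, hN₀.apply_zero]
  refine ⟨⟨mem_localDomain_self (hN.mem x), ?_⟩, ?_, trivial⟩
  · rw [mem_preimage, Function.comp_apply, h1]
    exact mem_image_of_mem _ (hN₀.mem x)
  · rw [Function.comp_apply, Function.comp_apply, h1, hψ (hN₀.mem x)]
    exact mem_extChartAt_source x

/-- The set is the preimage of `φ₀(K)` under `s ↦ φ(x, s)`. The image of a compact set is closed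
because `X` is Hausdorff; without this, distinct continuations could share the earlier part of the
curve. -/
theorem isClosed_transition_mem [T2Space X] (hN : IsNormalForm ι gp p q g U φ h)
    (hN₀ : IsNormalForm ι gp p q g₀ U₀ φ₀ h₀) (hψ : LeftInvOn ψ φ₀ U₀) {x : M} {r : ℝ}
    (hU : ∀ s ∈ Icc 0 r, (x, s) ∈ U) {K : Set (E × ℝ)} (hKS : K ⊆ localDomain (𝓡 n) U₀ x)
    (hK : IsCompact K) :
    IsClosed {s | s ∈ Icc 0 r ∧
      (extChartAt (𝓡 n) x x, s) ∈ transitionDomain (n := n) x U φ (φ₀ '' U₀) ψ ∧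
      localTransition (n := n) x φ ψ (extChartAt (𝓡 n) x x, s) ∈ K} := by
  have hK' : IsClosed ((φ₀ ∘ cylinderChartSymm (𝓡 n) x) '' K) :=
    (hK.image_of_continuousOn
      ((hN₀.contMDiffOn_comp_cylinderChartSymm x).continuousOn.mono hKS)).isClosed
  have hc : ContinuousOn (fun s : ℝ ↦ φ (x, s)) (Icc 0 r) :=
    hN.contMDiffOn.continuousOn.comp (by fun_prop) hU
  convert! hc.preimage_isClosed_of_isClosed isClosed_Icc hK' using 1
  ext s
  refine ⟨fun ⟨hs, hD, hm⟩ ↦ ⟨hs, _, hm, ?_⟩, fun ⟨hs, m, hm, hms⟩ ↦ ?_⟩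
  · have := (comp_cylinderChartSymm_localTransition hψ hD).2
    rwa [cylinderChartSymm_self] at this
  · have h1 : φ (cylinderChartSymm (𝓡 n) x (extChartAt (𝓡 n) x x, s)) =
        φ₀ (cylinderChartSymm (𝓡 n) x m) := by
      rw [cylinderChartSymm_self]; exact hms.symm
    have h2 : ψ (φ (cylinderChartSymm (𝓡 n) x (extChartAt (𝓡 n) x x, s))) =
        cylinderChartSymm (𝓡 n) x m := by
      rw [h1]; exact hψ (hKS hm).2
    refine ⟨hs, ⟨⟨mem_localDomain_self (hU s hs), ?_⟩, ?_, trivial⟩, ?_⟩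
    · rw [mem_preimage, Function.comp_apply, h1]
      exact mem_image_of_mem _ (hKS hm).2
    · rw [Function.comp_apply, Function.comp_apply, h2]
      exact (extChartAt (𝓡 n) x).map_target (hKS hm).1
    · rw [localTransition, h2, cylinderChart_cylinderChartSymm _ (hKS hm).1]
      exact hm

/-- The variation of the normal form, in terms of the components in the preferred chart. -/
theorem hasDerivAt_normalForm_local [T2Space X] (hn : n ≠ 0) {g : TwoTensor (𝓡 n) M} {om : M → ℝ}
    (hom : ContMDiff (𝓡 n) 𝓘(ℝ, ℝ) ∞ om) {U : ℝ → Set (M × ℝ)} {φ : ℝ → M × ℝ → X}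
    {h : ℝ → ℝ → TwoTensor (𝓡 n) M}
    (hφ : ∀ t : ℝ, IsNormalForm ι gp p q (fun x ↦ Real.exp (2 * t * om x) • g x) (U t) (φ t) (h t))
    {x : M} {r : ℝ} (hr : 0 < r) (hU : ∀ᶠ t in 𝓝 (0 : ℝ), ∀ s ∈ Icc 0 r, (x, s) ∈ U t) (v w : E) :
    HasDerivAt (fun t ↦ h t r x v w)
      (om x * (2 * h 0 r x v w -
          r * fderiv ℝ (localMetric (𝓡 n) (h 0) x) (extChartAt (𝓡 n) x x, r) (0, 1) v w) +
        (fderiv ℝ (localMetric (𝓡 n) (h 0) x) (extChartAt (𝓡 n) x x, r)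
            (localField (localMetric (𝓡 n) (h 0) x) (fun y ↦ om ((extChartAt (𝓡 n) x).symm y)) r
              (extChartAt (𝓡 n) x x), 0) v w +
          localMetric (𝓡 n) (h 0) x (extChartAt (𝓡 n) x x, r)
            (localFieldDeriv (localMetric (𝓡 n) (h 0) x) (localDomain (𝓡 n) (U 0) x)
              (fun y ↦ om ((extChartAt (𝓡 n) x).symm y)) r (extChartAt (𝓡 n) x x) v) w +
          localMetric (𝓡 n) (h 0) x (extChartAt (𝓡 n) x x, r) v
            (localFieldDeriv (localMetric (𝓡 n) (h 0) x) (localDomain (𝓡 n) (U 0) x)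
              (fun y ↦ om ((extChartAt (𝓡 n) x).symm y)) r (extChartAt (𝓡 n) x x) w))) 0 := by
  have : NeZero n := ⟨hn⟩
  obtain ⟨ψ, hψ, hψs⟩ := (hφ 0).contMDiffOn_inverse
  have hU0 := hU.self_of_nhds
  have hk := isMetricFamily_localMetric (hφ 0).isOpen (hφ 0).smooth (hφ 0).signature x
  have h1 := hasDerivAt_metric_of_transition hk
    (kt := fun t ↦ localMetric (𝓡 n) (h t) x)
    (D := fun t ↦ transitionDomain x (U t) (φ t) (φ 0 '' U 0) ψ)
    (Ψ := fun t ↦ localTransition x (φ t) ψ)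
    (f := fun y ↦ om ((extChartAt (𝓡 n) x).symm y))
    (x := extChartAt (𝓡 n) x x) (r := r)
    (Eventually.of_forall fun t ↦ (hφ t).isTransition (hφ 0) (f := fun y ↦ t * om y)
      (fun y ↦ by simp [mul_assoc]) hψ hψs x)
    (Eventually.of_forall fun t ↦ mem_transitionDomain_zero (hφ t) (hφ 0) hψ x)
    ((contDiffOn_comp_extChartAt_symm hom x).contDiffAt (extChartAt_target_mem_nhds x))
    hr (fun s hs ↦ mem_localDomain_self (hU0 s hs))
    (hU.mono fun t ht K hKS hK ↦ isClosed_transition_mem (hφ t) (hφ 0) hψ ht hKS hK) v w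
  simp only [localMetric_self, extChartAt_to_inv] at h1 ⊢
  exact h1

end NormalForm

/-! ### Identification with the invariant expressions -/

section Identification

variable {E : Type*} [NormedAddCommGroup E] [NormedSpace ℝ E] [FiniteDimensional ℝ E]
  {H : Type*} [TopologicalSpace H] {I : ModelWithCorners ℝ E H} [I.Boundaryless]
  {N : Type*} [TopologicalSpace N] [ChartedSpace H N] [IsManifold I ∞ N]

theorem inverse_apply_self {b : E →L[ℝ] E →L[ℝ] ℝ} (hb : ∀ v, (∀ w, b v w = 0) → v = 0) (v : E) :
    ContinuousLinearMap.inverse b (b v) = v := by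
  obtain ⟨e, rfl⟩ := isInvertible_of_nondegenerate hb
  simp

/-- Naturality of raising an index under an invertible change of frame. -/
theorem inverse_eq_of_pullbackForm {b : E →L[ℝ] E →L[ℝ] ℝ} (hb : ∀ v, (∀ w, b v w = 0) → v = 0)
    {A : E →L[ℝ] E} (hA : A.IsInvertible) {α : E →L[ℝ] ℝ} {u : E}
    (hu : ∀ w, pullbackForm b A u w = α (A w)) : ContinuousLinearMap.inverse b α = A u := by
  have h1 : b (A u) = α := by
    obtain ⟨e, rfl⟩ := hA
    ext w
    simpa [pullbackForm] using hu (e.symm w)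
  rw [← h1, inverse_apply_self hb]

theorem mvfderiv_chartFrame {f : N → ℝ} (hf : ContMDiff I 𝓘(ℝ, ℝ) ∞ f) {x : N} {y : E}
    (hy : y ∈ (extChartAt I x).target) (v : E) :
    mvfderiv I f ((extChartAt I x).symm y) (chartFrame I x y v) =
      fderiv ℝ (fun y ↦ f ((extChartAt I x).symm y)) y v := by
  have h1 := ((hf ((extChartAt I x).symm y)).mdifferentiableAt (by simp)).hasMFDerivAt.comp y
    (hasMFDerivAt_extChartAt_symm I hy)
  have h2 := h1.mfderiv
  rw [mfderiv_eq_fderiv] at h2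
  exact DFunLike.congr_fun h2.symm v

variable {h : ℝ → TwoTensor I N} {U : Set (N × ℝ)} {om : N → ℝ} {x : N} {r : ℝ}

theorem sharp_extChartAt_symm
    (hk : IsMetricFamily (localMetric I h x) (localDomain I U x))
    (hs : ∀ z ∈ U, ∀ v, (∀ w, h z.2 z.1 v w = 0) → v = 0)
    (hom : ContMDiff I 𝓘(ℝ, ℝ) ∞ om) {y : E} {s : ℝ} (hy : (y, s) ∈ localDomain I U x) :
    sharp (h s ((extChartAt I x).symm y)) (mvfderiv I om ((extChartAt I x).symm y)) =
      chartFrame I x y (inverseFamily (localMetric I h x) (y, s)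
        (fderiv ℝ (fun y ↦ om ((extChartAt I x).symm y)) y)) := by
  refine inverse_eq_of_pullbackForm (E := E) (hs _ hy.2) (isInvertible_chartFrame I hy.1)
    fun w ↦ ?_
  refine Eq.trans ?_ (mvfderiv_chartFrame hom hy.1 w).symm
  exact congrArg (fun L : E →L[ℝ] ℝ ↦ L w) (hk.apply_inverseFamily hy _)

/-- The chart frame at `y` does not depend on `s`, so it commutes with the integral. -/
theorem fieldX_extChartAt_symm
    (hk : IsMetricFamily (localMetric I h x) (localDomain I U x))
    (hs : ∀ z ∈ U, ∀ v, (∀ w, h z.2 z.1 v w = 0) → v = 0)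
    (hom : ContMDiff I 𝓘(ℝ, ℝ) ∞ om) (hr : 0 ≤ r) {y : E}
    (hy : ∀ s ∈ Icc 0 r, (y, s) ∈ localDomain I U x) :
    fieldX h om r ((extChartAt I x).symm y) = chartFrame I x y
      (localField (localMetric I h x) (fun y ↦ om ((extChartAt I x).symm y)) r y) := by
  have : CompleteSpace E := FiniteDimensional.complete ℝ E
  have h1 : IntervalIntegrable (fun s ↦ s • inverseFamily (localMetric I h x) (y, s)
      (fderiv ℝ (fun y ↦ om ((extChartAt I x).symm y)) y)) MeasureTheory.volume 0 r := by
    refine ContinuousOn.intervalIntegrable ?_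
    rw [uIcc_of_le hr]
    exact hk.continuousOn_localField_integrand hy
  let F : ℝ → E := fun s ↦
    s • sharp (h s ((extChartAt I x).symm y)) (mvfderiv I om ((extChartAt I x).symm y))
  change (∫ s in (0 : ℝ)..r, F s) = _
  refine Eq.trans ?_ ((chartFrame I x y).intervalIntegral_comp_comm h1)
  refine intervalIntegral.integral_congr fun s hs' ↦ ?_
  rw [uIcc_of_le hr] at hs'
  refine Eq.trans ?_ ((chartFrame I x y).map_smul s _).symm
  exact congrArg (fun u : E ↦ s • u) (sharp_extChartAt_symm hk hs hom (hy s hs'))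

theorem fderiv_chartComponent (hk : IsMetricFamily (localMetric I h x) (localDomain I U x))
    (hx : (extChartAt I x x, r) ∈ localDomain I U x) (hr : 0 < r) (u v w : E) :
    fderiv ℝ (chartComponent I (h r) x u v) (extChartAt I x x) w =
      fderiv ℝ (localMetric I h x) (extChartAt I x x, r) (w, 0) u v := by
  have h1 := ((hk.contDiffOn.contDiffAt (mem_nhds_of_halfSpace hk.exists_isOpen hx hr)
    ).differentiableAt (by simp)).hasFDerivAt
  have h2 := h1.comp (extChartAt I x x) (hasFDerivAt_prodMk_left (𝕜 := ℝ) (extChartAt I x x) r)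
  have h3 := (h2.clm_apply (hasFDerivAt_const u _)).clm_apply (hasFDerivAt_const v _)
  have h4 : fderiv ℝ (chartComponent I (h r) x u v) (extChartAt I x x) = _ := h3.fderiv
  rw [h4]
  simp

theorem fderiv_localMetric_symm (hk : IsMetricFamily (localMetric I h x) (localDomain I U x))
    (hx : (extChartAt I x x, r) ∈ localDomain I U x) (hr : 0 < r) (e : E × ℝ) (u v : E) :
    fderiv ℝ (localMetric I h x) (extChartAt I x x, r) e u v =
      fderiv ℝ (localMetric I h x) (extChartAt I x x, r) e v u := by
  have hn := mem_nhds_of_halfSpace hk.exists_isOpen hx hr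
  have h1 := ((hk.contDiffOn.contDiffAt hn).differentiableAt (by simp)).hasFDerivAt
  have h2 := (h1.clm_apply (hasFDerivAt_const u _)).clm_apply (hasFDerivAt_const v _)
  have h3 := (h1.clm_apply (hasFDerivAt_const v _)).clm_apply (hasFDerivAt_const u _)
  have h4 := h2.unique (h3.congr_of_eventuallyEq
    (Filter.mem_of_superset hn fun z hz ↦ hk.symm z hz u v))
  simpa using congrArg (fun L ↦ L e) h4

theorem fderiv_chartComponentOneForm_formX
    (hk : IsMetricFamily (localMetric I h x) (localDomain I U x))
    (hs : ∀ z ∈ U, ∀ v, (∀ w, h z.2 z.1 v w = 0) → v = 0)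
    (hom : ContMDiff I 𝓘(ℝ, ℝ) ∞ om) (hr : 0 < r)
    (hx : ∀ s ∈ Icc 0 r, (extChartAt I x x, s) ∈ localDomain I U x) (v w : E) :
    fderiv ℝ (chartComponentOneForm I (formX h om r) x w) (extChartAt I x x) v =
      fderiv ℝ (localMetric I h x) (extChartAt I x x, r) (v, 0)
        (localField (localMetric I h x) (fun y ↦ om ((extChartAt I x).symm y)) r
          (extChartAt I x x)) w +
      localMetric I h x (extChartAt I x x, r)
        (localFieldDeriv (localMetric I h x) (localDomain I U x)
          (fun y ↦ om ((extChartAt I x).symm y)) r (extChartAt I x x) v) w := by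
  have hf := (contDiffOn_comp_extChartAt_symm hom x).contDiffAt (extChartAt_target_mem_nhds x)
  have h0 := hasFDerivAt_localField hk hf hr.le hx
  have h1 := ((hk.contDiffOn.contDiffAt (mem_nhds_of_halfSpace hk.exists_isOpen
    (hx r (right_mem_Icc.2 hr.le)) hr)).differentiableAt (by simp)).hasFDerivAt
  have h2 := h1.comp (extChartAt I x x) (hasFDerivAt_prodMk_left (𝕜 := ℝ) (extChartAt I x x) r)
  have h3 := (h2.clm_apply h0).clm_apply (hasFDerivAt_const w _)
  -- Agreement is needed near the centre, not only at it, since the component is about to be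
  -- differentiated; compactness of `[0, r]` provides the neighbourhood.
  have h4 : chartComponentOneForm I (formX h om r) x w =ᶠ[𝓝 (extChartAt I x x)] fun y ↦
      localMetric I h x (y, r)
        (localField (localMetric I h x) (fun y ↦ om ((extChartAt I x).symm y)) r y) w := by
    filter_upwards [eventually_forall_mem_of_halfSpace hk.exists_isOpen hx] with y hy
    exact congrArg (fun u ↦ h r ((extChartAt I x).symm y) u (chartFrame I x y w))
      (fieldX_extChartAt_symm hk hs hom hr.le hy)
  rw [(h3.congr_of_eventuallyEq h4).fderiv]
  simp [add_comm]

theorem sharp_formX (hk : IsMetricFamily (localMetric I h x) (localDomain I U x))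
    (hs : ∀ z ∈ U, ∀ v, (∀ w, h z.2 z.1 v w = 0) → v = 0)
    (hom : ContMDiff I 𝓘(ℝ, ℝ) ∞ om) (hr : 0 ≤ r) (hU : ∀ s ∈ Icc 0 r, (x, s) ∈ U) :
    sharp (h r x) (formX h om r x) =
      localField (localMetric I h x) (fun y ↦ om ((extChartAt I x).symm y)) r
        (extChartAt I x x) := by
  have h1 : sharp (h r x) (formX h om r x) = fieldX h om r x :=
    inverse_apply_self (E := E) (hs _ (hU r (right_mem_Icc.2 hr))) _
  have h2 := fieldX_extChartAt_symm hk hs hom hr fun s hs ↦ mem_localDomain_self (hU s hs)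
  rw [chartFrame_self] at h2
  let F : N → E := fieldX h om r
  exact h1.trans ((congrArg F (extChartAt_to_inv (I := I) x)).symm.trans h2)

/-- The Lie derivative of the metric along `X`, as a symmetrized covariant derivative. -/
theorem two_mul_symmCovDeriv_formX (hk : IsMetricFamily (localMetric I h x) (localDomain I U x))
    (hs : ∀ z ∈ U, ∀ v, (∀ w, h z.2 z.1 v w = 0) → v = 0)
    (hom : ContMDiff I 𝓘(ℝ, ℝ) ∞ om) (hr : 0 < r) (hU : ∀ s ∈ Icc 0 r, (x, s) ∈ U) (v w : E) :
    2 * symmCovDeriv (h r) (formX h om r) x v w =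
      fderiv ℝ (localMetric I h x) (extChartAt I x x, r)
        (localField (localMetric I h x) (fun y ↦ om ((extChartAt I x).symm y)) r
          (extChartAt I x x), 0) v w +
      localMetric I h x (extChartAt I x x, r)
        (localFieldDeriv (localMetric I h x) (localDomain I U x)
          (fun y ↦ om ((extChartAt I x).symm y)) r (extChartAt I x x) v) w +
      localMetric I h x (extChartAt I x x, r) v
        (localFieldDeriv (localMetric I h x) (localDomain I U x)
          (fun y ↦ om ((extChartAt I x).symm y)) r (extChartAt I x x) w) := by
  have hS : ∀ s ∈ Icc 0 r, (extChartAt I x x, s) ∈ localDomain I U x :=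
    fun s hs ↦ mem_localDomain_self (hU s hs)
  have hxr := hS r (right_mem_Icc.2 hr.le)
  have e1 := fun v w ↦ fderiv_chartComponentOneForm_formX hk hs hom hr hS v w
  have e2 := sharp_formX hk hs hom hr.le hU
  have e3 := fun u v w ↦ fderiv_chartComponent hk hxr hr u v w
  have e4 := fun e u v ↦ fderiv_localMetric_symm hk hxr hr e u v
  set Y := localField (localMetric I h x) (fun y ↦ om ((extChartAt I x).symm y)) r
    (extChartAt I x x)
  have e5 : 2 * symmCovDeriv (h r) (formX h om r) x v w = 2 * ((1 / 2) *
      ((fderiv ℝ (chartComponentOneForm I (formX h om r) x w) (extChartAt I x x) v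
        - christoffel I (h r) x v w Y)
      + (fderiv ℝ (chartComponentOneForm I (formX h om r) x v) (extChartAt I x x) w
        - christoffel I (h r) x w v Y))) := by
    rw [← e2]
    rfl
  rw [e5, e1, e1, christoffel, christoffel]
  simp only [e3]
  -- The two Christoffel terms add up to `∂_v k(w, Y) + ∂_w k(v, Y) - ∂_Y k(v, w)`. The first two
  -- cancel the derivatives of `k` from the product rule, and the last is the transport term of the
  -- Lie derivative.
  rw [e4 (Y, 0) w v, e4 (v, 0) Y w, e4 (w, 0) Y v, hk.symm _ hxr v]
  ring

theorem derivWithin_eq_fderiv_localMetric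
    (hk : IsMetricFamily (localMetric I h x) (localDomain I U x))
    (hx : (extChartAt I x x, r) ∈ localDomain I U x) (hr : 0 < r) (v w : E) :
    derivWithin (fun s ↦ h s x v w) (Ici 0) r =
      fderiv ℝ (localMetric I h x) (extChartAt I x x, r) (0, 1) v w := by
  have h1 := ((hk.contDiffOn.contDiffAt (mem_nhds_of_halfSpace hk.exists_isOpen hx hr)
    ).differentiableAt (by simp)).hasFDerivAt
  have h2 : HasDerivAt (fun s : ℝ ↦ localMetric I h x (extChartAt I x x, s)) _ r :=
    h1.comp_hasDerivAt r ((hasDerivAt_const r (extChartAt I x x)).prodMk (hasDerivAt_id r))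
  have h3 := (h2.clm_apply (hasDerivAt_const r v)).clm_apply (hasDerivAt_const r w)
  simp only [map_zero, add_zero] at h3
  simp only [localMetric_self] at h3
  rw [derivWithin_of_mem_nhds (Ici_mem_nhds hr)]
  exact h3.deriv

end Identification

/-! ### The degenerate cases: `r = 0` and dimension zero -/

section Boundary

variable {E : Type*} [NormedAddCommGroup E] [NormedSpace ℝ E]
  {H : Type*} [TopologicalSpace H] {I : ModelWithCorners ℝ E H}
  {N : Type*} [TopologicalSpace N] [ChartedSpace H N] [IsManifold I ∞ N]

theorem formX_zero (h : ℝ → TwoTensor I N) (om : N → ℝ) : formX h om 0 = fun _ ↦ 0 := by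
  funext y
  have h1 : fieldX h om 0 y = (0 : E) := intervalIntegral.integral_same (E := E)
  let B : E →L[ℝ] E →L[ℝ] ℝ := h 0 y
  exact (congrArg B h1).trans B.map_zero

theorem symmCovDeriv_zero (b : TwoTensor I N) (x : N) (v w : TangentSpace I x) :
    symmCovDeriv b (fun _ ↦ 0) x v w = 0 := by
  have h1 : ∀ v w : E, christoffel I b x v w 0 = 0 := by
    intro v w
    have h2 : ∀ u : E, chartComponent I b x u 0 = fun _ ↦ 0 := fun u ↦ by
      funext y
      let B : E →L[ℝ] E →L[ℝ] ℝ := b ((extChartAt I x).symm y)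
      change B (chartFrame I x y u) (chartFrame I x y 0) = 0
      rw [map_zero, map_zero]
    simp [christoffel, h2]
  have h3 : ∀ v w : E, covDeriv b (fun _ ↦ 0) x v w = 0 := by
    intro v w
    let B : E →L[ℝ] E →L[ℝ] ℝ := b x
    have h4 : sharp (b x) 0 = (0 : E) := (ContinuousLinearMap.inverse B).map_zero
    have h5 : covDeriv b (fun _ ↦ 0) x v w = fderiv ℝ (fun _ : E ↦ (0 : ℝ)) (extChartAt I x x) v
      - christoffel I b x v w (sharp (b x) 0 : E) := rfl
    rw [h5, h4, h1]
    simp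
  refine Eq.trans (congrArg (fun a : ℝ ↦ (1 / 2) * a)
    (congrArg₂ (· + ·) (h3 v w) (h3 w v))) ?_
  norm_num

theorem symmCovDeriv_of_subsingleton [Subsingleton E] (b : TwoTensor I N) (α : OneForm I N) (x : N)
    (v w : TangentSpace I x) : symmCovDeriv b α x v w = 0 := by
  have h1 : ∀ (L : E →L[ℝ] ℝ) (u : E), L u = 0 := fun L u ↦ by
    rw [Subsingleton.elim u 0, map_zero]
  have h2 : ∀ u v w : E, christoffel I b x u v w = 0 := fun u v w ↦ by simp [christoffel, h1]
  have h3 : ∀ v w : E, covDeriv b α x v w = 0 := fun v w ↦ by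
    refine Eq.trans (congrArg₂ (· - ·) (h1 _ v) (h2 v w _)) (sub_zero 0)
  refine Eq.trans (congrArg (fun a : ℝ ↦ (1 / 2) * a)
    (congrArg₂ (· + ·) (h3 v w) (h3 w v))) ?_
  norm_num

end Boundary

end AHMetric

end

/-! ### The variation formula -/

theorem theorem3p1 {n p q : ℕ}
    {M : Type*} [TopologicalSpace M] [ChartedSpace (EuclideanSpace ℝ (Fin n)) M]
    [IsManifold (𝓡 n) ∞ M]
    {X : Type*} [TopologicalSpace X] [T2Space X] [SecondCountableTopology X]
    [ChartedSpace (EuclideanHalfSpace (n + 1)) X] [IsManifold (𝓡∂ (n + 1)) ∞ X]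
    {ι : M → X} (hι : AHMetric.IsBoundaryInclusion (n := n) ι)
    {g : AHMetric.TwoTensor (𝓡 n) M} (hg : AHMetric.IsMetric g p q)
    {gp : AHMetric.TwoTensor (𝓡∂ (n + 1)) X}
    (hgp : AHMetric.IsAsymptoticallyHyperbolic ι gp g p q)
    {om : M → ℝ} (hom : ContMDiff (𝓡 n) 𝓘(ℝ, ℝ) ∞ om)
    {U : ℝ → Set (M × ℝ)} {φ : ℝ → M × ℝ → X} {h : ℝ → ℝ → AHMetric.TwoTensor (𝓡 n) M}
    (hφ : ∀ t : ℝ, AHMetric.IsNormalForm ι gp p q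
      (fun x ↦ Real.exp (2 * t * om x) • g x) (U t) (φ t) (h t))
    {x : M} {r : ℝ} (hr : 0 ≤ r)
    (hU : ∀ᶠ t in 𝓝 (0 : ℝ), ∀ s ∈ Icc 0 r, (x, s) ∈ U t)
    (v w : TangentSpace (𝓡 n) x) :
    HasDerivAt (fun t ↦ h t r x v w)
      (om x * (2 * h 0 r x v w - r * derivWithin (fun s ↦ h 0 s x v w) (Ici 0) r)
        + 2 * AHMetric.symmCovDeriv (h 0 r) (AHMetric.formX (h 0) om r) x v w) 0 := by
  rcases hr.eq_or_lt with rfl | hr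
  -- At the boundary the family is prescribed, so only the conformal factor is differentiated; the
  -- field `X` and the factor `r` vanish.
  · have h1 : ∀ t, h t 0 x v w = Real.exp (2 * t * om x) * g x v w := fun t ↦
      congrArg (fun b : AHMetric.TwoTensor (𝓡 n) M ↦ b x v w) (hφ t).initial
    rw [AHMetric.formX_zero, AHMetric.symmCovDeriv_zero]
    simp only [h1]
    have h2 : HasDerivAt (fun t : ℝ ↦ 2 * t * om x) (2 * om x) 0 := by
      simpa using ((hasDerivAt_id (0 : ℝ)).const_mul 2).mul_const (om x)
    convert! h2.exp.mul_const (g x v w) using 1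
    simp
    ring
  rcases eq_or_ne n 0 with rfl | hn
  -- In dimension zero the boundary metric does not determine the normal scale, so the general
  -- argument fails; but all tensors on `M` are zero.
  · have hv : v = 0 := Subsingleton.elim (α := EuclideanSpace ℝ (Fin 0)) v 0
    have hw : w = 0 := Subsingleton.elim (α := EuclideanSpace ℝ (Fin 0)) w 0
    have h1 : ∀ t s, h t s x v w = 0 := fun t s ↦ by rw [hw, map_zero]
    have h2 : ∀ b α, AHMetric.symmCovDeriv b α x v w = 0 := fun b α ↦
      AHMetric.symmCovDeriv_of_subsingleton b α x v w
    simp [h1, h2, hasDerivAt_const]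
  have h1 := AHMetric.hasDerivAt_normalForm_local hn hom hφ hr hU v w
  have hU0 := hU.self_of_nhds
  have hk := AHMetric.isMetricFamily_localMetric (hφ 0).isOpen (hφ 0).smooth (hφ 0).signature x
  rwa [AHMetric.two_mul_symmCovDeriv_formX hk
      (fun z hz ↦ ((hφ 0).signature z hz).nondegenerate) hom hr hU0 v w,
    AHMetric.derivWithin_eq_fderiv_localMetric hk
      (AHMetric.mem_localDomain_self (hU0 r (right_mem_Icc.2 hr.le))) hr v w]
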